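/- Let $q\ge 1$ be an integer and $\gamma>0$. A partition of length $N$ is a non-decreasing tuple $b=(b_1,\dots,b_N)\in\mathbb N_0^N$. Put $M(b)!=\prod_{k\ge0}\#\{j: b_j=k\}!$. Let $\mu_\gamma$ be the measure $e^{-x^2}\,dx\,dy$ on the strip $\{x+iy: x\in\mathbb R,\ 0\le y<2\pi/\gamma\}$, let $\|\cdot\|$ be the norm of $L^2(\mu_\gamma^{\otimes N})$, and let $$\varphi_k(z)=\sqrt{\tfrac{\gamma}{2\pi^{3/2}}}\,e^{-\gamma^2k^2/2}e^{\gamma zk}\quad(k\in\mathbb N_0),\qquad \Phi_\lambda(z)=\frac1{\sqrt{M(\lambda)!\,N!}}\sum_{\sigma\in S_N}(\operatorname{sgn}\sigma)^q\prod_{j=1}^N\varphi_{\lambda_j}(z_{\sigma(j)})$$ be the orbitals of the cylinder and the Slater determinants ($q$ odd) or permanents ($q$ even) labelled by partitions $\lambda$ of length $N$. For a partition $b$ of length $N$ let $$\Psi_{b,N}(z)=\kappa_{b,N}\,\frac1{M(b)!}\sum_{\sigma\in S_N}\prod_{j=1}^N e^{\gamma b_jz_{\sigma(j)}}\prod_{1\le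 j<k\le N}\big(e^{\gamma z_j}-e^{\gamma z_k}\big)^q,$$ $$\frac1{\kappa_{b,N}}=(-1)^{qN(N-1)/2}\sqrt{N!}\,\Big(\frac{2\pi^{3/2}}{\gamma}\Big)^{N/2}\exp\Big(\frac{\gamma^2}2\sum_{j=1}^N\big[q(j-1)+b_j\big]^2\Big).$$ For $N_1,N_2\ge1$ and partitions $b^{(1)},b^{(2)}$ of lengths $N_1,N_2$ put $N=N_1+N_2$ and $b=(b^{(1)},b^{(2)}):=(b^{(1)}_1,\dots,b^{(1)}_{N_1},b^{(1)}_{N_1}+b^{(2)}_1,\dots,b^{(1)}_{N_1}+b^{(2)}_{N_2})$. Let $\odot$ be the bilinear product with $\Phi_\lambda\odot\Phi_\mu=\Phi_\lambda\otimes_q\Phi_{T\mu}$ for partitions $\lambda,\mu$ of lengths $N_1,N_2$, where $T\mu=(qN_1+b^{(1)}_{N_1}+\mu_1,\dots,qN_1+b^{(1)}_{N_1}+\mu_{N_2})$ and $$(f\otimes_q g)(z)=\frac1{\sqrt{N!\,N_1!\,N_2!}}\sum_{\sigma\in S_N}(\operatorname{sgn}\sigma)^q f(z_{\sigma(1)},\dots,z_{\sigma(N_1)})\,g(z_{\sigma(N_1+1)},\dots,z_{\sigma(N)}).$$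 If $$C_q(\gamma):=(\gamma^2-2(4q+1))-2q^{-1}\ln\big(1-e^{-(4q+1)}\big)-\pi\sqrt{2/3}>0,$$ then $\Psi_{b,N}$, $\Psi_{b^{(1)},N_1}$, $\Psi_{b^{(2)},N_2}$ are nonzero and $$\left\|\frac{\Psi_{b,N}}{\|\Psi_{b,N}\|}-\frac{\Psi_{b^{(1)},N_1}}{\|\Psi_{b^{(1)},N_1}\|}\odot\frac{\Psi_{b^{(2)},N_2}}{\|\Psi_{b^{(2)},N_2}\|}\right\|\le\frac{2e^{-C_q(\gamma)q/2}}{1-e^{-C_q(\gamma)q}}.$$ -/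

import Mathlib

open MeasureTheory Finset
open scoped Nat BigOperators

namespace FQHE

noncomputable section

/-! ### Partitions

A partition of length `N` is a non-decreasing function `Fin N → ℕ`. -/

/-- The root partition `(b₁, q + b₂, …, q (N - 1) + b_N)`. -/
def rootPartition (q : ℕ) {N : ℕ} (b : Fin N → ℕ) (j : Fin N) : ℕ := q * (j : ℕ) + b j

/-- The last (largest) entry `b_N` of a partition of positive length. -/
def lastEntry {N : ℕ} [NeZero N] (b : Fin N → ℕ) : ℕ := b ⊤

/-- The composition `(b₁, b₂)` of two partitions:
the entries of `b₁`, followed by the entries of `b₂` raised by the last entry of `b₁`. -/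
def compose {N₁ N₂ : ℕ} [NeZero N₁] (b₁ : Fin N₁ → ℕ) (b₂ : Fin N₂ → ℕ) : Fin (N₁ + N₂) → ℕ :=
  Fin.append b₁ (fun j => lastEntry b₁ + b₂ j)

/-- The shift of a partition `mu` to the end of a segment with root given by `b₁`:
every entry is raised by `q N₁ + (b₁)_{N₁}`. -/
def shift (q : ℕ) {N₁ N₂ : ℕ} [NeZero N₁] (b₁ : Fin N₁ → ℕ) (mu : Fin N₂ → ℕ) : Fin N₂ → ℕ :=
  fun j => q * N₁ + lastEntry b₁ + mu j

/-- `M(lam)! = ∏ₖ m(lam, k)!`, where `m(lam, k)` is the number of entries of `lam` equal to `k`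
(the factors with `m(lam, k) = 0` equal one). -/
def occFactorial {N : ℕ} (lam : Fin N → ℕ) : ℕ :=
  ∏ k ∈ univ.image lam, (#{j | lam j = k})!

/-! ### The Hilbert space of the cylinder -/

/-- The measure `e^{-x²} dx dy` on the strip `ℝ + i [0, 2π/γ)`. -/
def cylMeasure (γ : ℝ) : Measure ℂ :=
  (volume.restrict {z : ℂ | 0 ≤ z.im ∧ z.im < 2 * Real.pi / γ}).withDensity
    (fun z => ENNReal.ofReal (Real.exp (-z.re ^ 2)))

instance (γ : ℝ) : SigmaFinite (cylMeasure γ) := by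
  unfold cylMeasure
  exact SigmaFinite.withDensity_ofReal _

/-- The `N`-fold product of the cylinder measure. -/
abbrev cylMeasureN (γ : ℝ) (N : ℕ) : Measure (Fin N → ℂ) := Measure.pi (fun _ => cylMeasure γ)

/-- The `N`-particle `L²` space, which contains the space of `N` bosons or fermions. -/
abbrev NSpace (γ : ℝ) (N : ℕ) : Type := Lp ℂ 2 (cylMeasureN γ N)

/-- The one-particle orbital
`φ_k(z) = √(γ / (2 π^{3/2})) e^{-γ² k² / 2} exp(γ z k)`. -/
def orbital (γ : ℝ) (k : ℕ) (z : ℂ) : ℂ :=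
  (Real.sqrt (γ / (2 * Real.pi ^ (3 / 2 : ℝ))) * Real.exp (-γ ^ 2 * k ^ 2 / 2) : ℝ) *
    Complex.exp (γ * z * k)

/-- The Slater determinant (`q` odd) or permanent (`q` even) of the orbitals `φ_{lam_j}`. -/
def slaterFun (γ : ℝ) (q : ℕ) {N : ℕ} (lam : Fin N → ℕ) (z : Fin N → ℂ) : ℂ :=
  ((1 / Real.sqrt (occFactorial lam * N ! : ℝ) : ℝ) : ℂ) *
    ∑ σ : Equiv.Perm (Fin N), ((Equiv.Perm.sign σ : ℤ) : ℂ) ^ q * ∏ j, orbital γ (lam j) (z (σ j))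

/-- The `q`-symmetrized product `f ⊗_q g` of an `N₁`- and an `N₂`-particle wavefunction. -/
def qProdFun (q : ℕ) {N₁ N₂ : ℕ} (f : (Fin N₁ → ℂ) → ℂ) (g : (Fin N₂ → ℂ) → ℂ)
    (z : Fin (N₁ + N₂) → ℂ) : ℂ :=
  ((1 / Real.sqrt ((N₁ + N₂)! * N₁ ! * N₂ ! : ℝ) : ℝ) : ℂ) *
    ∑ σ : Equiv.Perm (Fin (N₁ + N₂)), ((Equiv.Perm.sign σ : ℤ) : ℂ) ^ q *
      (f (fun i => z (σ (Fin.castAdd N₂ i))) * g (fun i => z (σ (Fin.natAdd N₁ i))))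

/-! ### The wavefunctions -/

/-- The monomial symmetric polynomial `m_b`, evaluated at `x`. -/
def monomialSym {N : ℕ} (b : Fin N → ℕ) (x : Fin N → ℂ) : ℂ :=
  (1 / (occFactorial b : ℂ)) * ∑ σ : Equiv.Perm (Fin N), ∏ j, x (σ j) ^ b j

/-- The prefactor `κ_{b,N}`. In `Fin N` indices start at `0`,
so the root partition has the entries `q j + b j`. -/
def kappa (γ : ℝ) (q : ℕ) {N : ℕ} (b : Fin N → ℕ) : ℝ :=
  1 / ((-1) ^ (q * (N * (N - 1) / 2)) * Real.sqrt (N ! : ℝ) *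
    Real.sqrt (2 * Real.pi ^ (3 / 2 : ℝ) / γ) ^ N *
    Real.exp (γ ^ 2 / 2 * ∑ j : Fin N, ((rootPartition q b j : ℕ) : ℝ) ^ 2))

/-- The model wavefunction on the cylinder,
`κ_{b,N} m_b(e^{γ z₁}, …, e^{γ z_N}) ∏_{j < k} (e^{γ z_j} - e^{γ z_k})^q`. -/
def psiFun (γ : ℝ) (q : ℕ) {N : ℕ} (b : Fin N → ℕ) (z : Fin N → ℂ) : ℂ :=
  (kappa γ q b : ℂ) * monomialSym b (fun j => Complex.exp (γ * z j)) *
    ∏ j : Fin N, ∏ k ∈ Finset.Ioi j, (Complex.exp (γ * z j) - Complex.exp (γ * z k)) ^ q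

/-! ### Square integrability

All functions above are polynomials in the variables `e^{γ z_j}`, hence square integrable. -/

/-- `f` is a polynomial in `e^{γ z₁}, …, e^{γ z_N}`. -/
def IsExpPoly (γ : ℝ) {N : ℕ} (f : (Fin N → ℂ) → ℂ) : Prop :=
  ∃ P : MvPolynomial (Fin N) ℂ, ∀ z, f z = P.eval (fun j => Complex.exp (γ * z j))

theorem integrable_exp_cyl (γ c : ℝ) :
    Integrable (fun z : ℂ => Real.exp (c * z.re)) (cylMeasure γ) := by
  unfold cylMeasure
  rw [integrable_withDensity_iff (by fun_prop) (by simp)]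
  have h1 : Integrable (fun x : ℝ => Real.exp (c * x) * Real.exp (-x ^ 2)) := by
    have h := ((integrable_exp_neg_mul_sq one_pos).comp_sub_right (c / 2)).const_mul
      (Real.exp (c ^ 2 / 4))
    refine h.congr (Filter.Eventually.of_forall fun x => ?_)
    simp only [← Real.exp_add]
    congr 1
    ring
  have h2 : Integrable (fun _ : ℝ => (1 : ℝ))
      (volume.restrict (Set.Ico 0 (2 * Real.pi / γ))) := integrable_const _
  have h3 := h1.mul_prod h2
  nth_rewrite 1 [← Measure.restrict_univ (μ := (volume : Measure ℝ))] at h3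
  rw [Measure.prod_restrict] at h3
  have h4 := (Complex.volume_preserving_equiv_real_prod.integrableOn_comp_preimage
    Complex.measurableEquivRealProd.measurableEmbedding).2 h3
  refine (h4.mono_set fun z hz => ?_).congr (Filter.Eventually.of_forall fun z => ?_)
  · simpa using hz
  · simp [(Real.exp_pos _).le]

theorem memLp_monomial (γ : ℝ) {N : ℕ} (d : Fin N → ℕ) :
    MemLp (fun z : Fin N → ℂ => ∏ i, Complex.exp (γ * z i) ^ d i) 2 (cylMeasureN γ N) := by
  have hc : Continuous fun z : Fin N → ℂ => ∏ i, Complex.exp (γ * z i) ^ d i := by fun_prop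
  refine (memLp_two_iff_integrable_sq_norm hc.aestronglyMeasurable).2 ?_
  have h := Integrable.fintype_prod (μ := fun _ : Fin N => cylMeasure γ)
    (f := fun i z => Real.exp ((2 * d i * γ) * z.re))
    (fun i => integrable_exp_cyl γ (2 * d i * γ))
  refine h.congr (Filter.Eventually.of_forall fun z => ?_)
  simp only [norm_prod, norm_pow, Complex.norm_exp, ← Finset.prod_pow, ← Real.exp_nat_mul]
  refine Finset.prod_congr rfl fun i _ => ?_
  congr 1
  rw [Complex.re_ofReal_mul]
  push_cast
  ring

theorem IsExpPoly.memLp {γ : ℝ} {N : ℕ} {f : (Fin N → ℂ) → ℂ} (hf : IsExpPoly γ f) :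
    MemLp f 2 (cylMeasureN γ N) := by
  obtain ⟨P, hP⟩ := hf
  have hf : f = fun z => ∑ d ∈ P.support, P.coeff d * ∏ i, Complex.exp (γ * z i) ^ d i :=
    funext fun z => by rw [hP, MvPolynomial.eval_eq']
  rw [hf]
  exact memLp_finsetSum _ fun d _ => (memLp_monomial γ d).const_mul _

theorem isExpPoly_slaterFun (γ : ℝ) (q : ℕ) {N : ℕ} (lam : Fin N → ℕ) :
    IsExpPoly γ (slaterFun γ q lam) := by
  refine ⟨MvPolynomial.C ((1 / Real.sqrt (occFactorial lam * N ! : ℝ) : ℝ) : ℂ) *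
    ∑ σ : Equiv.Perm (Fin N), MvPolynomial.C (((Equiv.Perm.sign σ : ℤ) : ℂ) ^ q) *
      ∏ j, (MvPolynomial.C
        ((Real.sqrt (γ / (2 * Real.pi ^ (3 / 2 : ℝ))) *
          Real.exp (-γ ^ 2 * (lam j : ℝ) ^ 2 / 2) : ℝ) : ℂ) *
        MvPolynomial.X (σ j) ^ lam j), fun z => ?_⟩
  simp only [slaterFun, orbital, map_mul, map_sum, map_prod, map_pow, MvPolynomial.eval_C,
    MvPolynomial.eval_X, ← Complex.exp_nat_mul]
  congr 1
  refine Finset.sum_congr rfl fun σ _ => ?_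
  congr 1
  refine Finset.prod_congr rfl fun j _ => ?_
  rw [mul_comm (γ * z (σ j) : ℂ)]

theorem IsExpPoly.qProdFun {γ : ℝ} (q : ℕ) {N₁ N₂ : ℕ} {f : (Fin N₁ → ℂ) → ℂ}
    {g : (Fin N₂ → ℂ) → ℂ} (hf : IsExpPoly γ f) (hg : IsExpPoly γ g) :
    IsExpPoly γ (qProdFun q f g) := by
  obtain ⟨P, hP⟩ := hf
  obtain ⟨Q, hQ⟩ := hg
  refine ⟨MvPolynomial.C ((1 / Real.sqrt ((N₁ + N₂)! * N₁ ! * N₂ ! : ℝ) : ℝ) : ℂ) *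
    ∑ σ : Equiv.Perm (Fin (N₁ + N₂)), MvPolynomial.C (((Equiv.Perm.sign σ : ℤ) : ℂ) ^ q) *
      (MvPolynomial.rename (fun i => σ (Fin.castAdd N₂ i)) P *
        MvPolynomial.rename (fun i => σ (Fin.natAdd N₁ i)) Q), fun z => ?_⟩
  simp only [FQHE.qProdFun, hP, hQ, map_mul, map_sum, MvPolynomial.eval_C,
    MvPolynomial.eval_rename, Function.comp_def]

theorem isExpPoly_psiFun (γ : ℝ) (q : ℕ) {N : ℕ} (b : Fin N → ℕ) :
    IsExpPoly γ (psiFun γ q b) := by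
  refine ⟨MvPolynomial.C (kappa γ q b : ℂ) * (MvPolynomial.C (1 / (occFactorial b : ℂ)) *
    ∑ σ : Equiv.Perm (Fin N), ∏ j, MvPolynomial.X (σ j) ^ b j) *
    ∏ j : Fin N, ∏ k ∈ Finset.Ioi j, (MvPolynomial.X j - MvPolynomial.X k) ^ q, fun z => ?_⟩
  simp only [psiFun, monomialSym, map_mul, map_sum, map_prod, map_pow, map_sub,
    MvPolynomial.eval_C, MvPolynomial.eval_X]

/-! ### Vectors in the Hilbert space and the product `⊙` -/

/-- The occupation basis vector `Φ_lam`. -/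
def slater (γ : ℝ) (q : ℕ) {N : ℕ} (lam : Fin N → ℕ) : NSpace γ N :=
  (isExpPoly_slaterFun γ q lam).memLp.toLp (slaterFun γ q lam)

/-- The (unnormalized) model wavefunction `Ψ_{b,N}` as a vector. -/
def psi (γ : ℝ) (q : ℕ) {N : ℕ} (b : Fin N → ℕ) : NSpace γ N :=
  (isExpPoly_psiFun γ q b).memLp.toLp (psiFun γ q b)

/-- The product `Φ_lam ⊙ Φ_mu = Φ_lam ⊗_q Φ_{T mu}` of occupation basis vectors,
with `T` the shift to the end of the segment with root given by `b₁`. -/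
def odotBasis (γ : ℝ) (q : ℕ) {N₁ N₂ : ℕ} [NeZero N₁] (b₁ : Fin N₁ → ℕ) (lam : Fin N₁ → ℕ)
    (mu : Fin N₂ → ℕ) : NSpace γ (N₁ + N₂) :=
  ((isExpPoly_slaterFun γ q lam).qProdFun q (isExpPoly_slaterFun γ q (shift q b₁ mu))).memLp.toLp
    (qProdFun q (slaterFun γ q lam) (slaterFun γ q (shift q b₁ mu)))

/-- The product `⊙`, the bilinear extension of `odotBasis` from the orthonormal occupation basis:
`f ⊙ g = ∑ ⟨Φ_lam, f⟩ ⟨Φ_mu, g⟩ Φ_lam ⊙ Φ_mu`, over all pairs of partitions `lam`, `mu`.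
For finite linear combinations of basis vectors the sum has finitely many nonzero terms. -/
def odot (γ : ℝ) (q : ℕ) {N₁ N₂ : ℕ} [NeZero N₁] (b₁ : Fin N₁ → ℕ) (f : NSpace γ N₁)
    (g : NSpace γ N₂) : NSpace γ (N₁ + N₂) :=
  ∑' p : {lam : Fin N₁ → ℕ // Monotone lam} × {mu : Fin N₂ → ℕ // Monotone mu},
    (inner ℂ (slater γ q p.1.1) f * inner ℂ (slater γ q p.2.1) g) • odotBasis γ q b₁ p.1.1 p.2.1

/-- The normalized vector `f / ‖f‖`. -/
def normalized {γ : ℝ} {N : ℕ} (f : NSpace γ N) : NSpace γ N := ((‖f‖ : ℂ)⁻¹) • f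

/-- The decay rate
`C_q(γ) = (γ² - 2 (4 q + 1)) - 2 q⁻¹ ln (1 - e^{-(4 q + 1)}) - π √(2/3)`. -/
def decayRate (q : ℕ) (γ : ℝ) : ℝ :=
  (γ ^ 2 - 2 * (4 * q + 1)) - 2 * (q : ℝ)⁻¹ * Real.log (1 - Real.exp (-(4 * q + 1)))
    - Real.pi * Real.sqrt (2 / 3)

end

end FQHE

/-!
The expansion of `Ψ_b` in the occupation basis is concentrated on the partitions that split at the
cut between the two segments, and on these it agrees with the product of the two expansions.

In the variables `X c = exp (γ z_c)` the wavefunction is a polynomial, and its expansion is read off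
from the coefficients of the non-decreasing exponent vectors `d` (`exists_psi_eq_smul_modelVec`).
The partial sums of such a vector are at least those of the root partition `c ↦ q c + b c`
(`sum_root_le_lowDeg`). The vector is *cut* at `n` if equality holds there. The part of lowest degree
in the first `n` variables is the product of the polynomials of the two segments, hence the
coefficient of a vector that is cut at `n` is the product of coefficients of the two segments
(`coeff_segPoly_eq_mul`). Since the vectors cut at `n` are the concatenations of vectors of
the first segment with shifted vectors of the second one, `Ψ_{b₁} ⊙ Ψ_{b₂}` is a positive multiple of
the orthogonal projection of `Ψ_b` to the span of the basis vectors that are cut at `N₁`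
(`exists_odot_modelVec`).

It remains to bound the weight of the vectors that are not cut. Such a vector has an irreducible block
around the position in question, bounded by two cuts and without a cut in between. By the product
rule, replacing the block by the root partition splits off a factor that depends only on the block,
and so the total weight of the vectors with a block at a given place is at most the weight of the
irreducible vectors of that segment times the weight of all vectors (`sum_weight_block_le`). The
weight of the irreducible vectors is small for the following reason (`sum_irreducible_le`). Let `s` be
the sum of the excesses of the partial sums of `d` over those of the root partition, which for an
irreducible vector is at least the number of interior positions. As the root partition grows by at
least `q` in each step, summation by parts shows that the Gaussian normalization suppresses `d` by the
factor `exp (-γ ^ 2 * q * s)` (`sum_sq_sub_sq_ge`). On the other hand the coefficients grow at most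
exponentially. To see this, replace the coefficients of the Vandermonde product by their moduli and
evaluate at `X c = 2 ^ c`: the monomial with exponents `d` takes the value of the root monomial times
`2 ^ (-s)`, and the whole polynomial exceeds the root monomial at most by a factor `2 * exp q` for
each variable but the first (`sum_norm_coeff_segPoly_le`).

With `t = exp (-decayRate q γ * q)`, a block with `k` interior positions has a relative weight of at
most `t ^ k`. Summation over all blocks around the position gives `t / (1 - t) ^ 2`
(`sum_weight_not_isCut_le`), and an orthogonal remainder with this fraction of the squared norm moves
the normalized vector by at most `2 * √t / (1 - t)` (`norm_inv_smul_sub_le`).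
-/

namespace FQHE

noncomputable section

open MvPolynomial

/-! ### Parts of lowest degree -/

/-- The degree of the exponent vector `d` in the variables `X c` with `c < j`. -/
def lowDeg (j : ℕ) (d : ℕ →₀ ℕ) : ℕ := ∑ c ∈ range j, d c

theorem lowDeg_add (j : ℕ) (d e : ℕ →₀ ℕ) : lowDeg j (d + e) = lowDeg j d + lowDeg j e := by
  simp [lowDeg, sum_add_distrib]

/-- `f` is the part of lowest degree of `F` with respect to the variables `X c`, `c < j`,
and that degree is `m`. -/
def HasLowPart (j m : ℕ) (F f : MvPolynomial ℕ ℂ) : Prop :=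
  (∀ d ∈ f.support, lowDeg j d = m) ∧ ∀ d ∈ (F - f).support, m < lowDeg j d

theorem HasLowPart.coeff_eq {j m : ℕ} {F f : MvPolynomial ℕ ℂ} (h : HasLowPart j m F f)
    {d : ℕ →₀ ℕ} (hd : lowDeg j d = m) : F.coeff d = f.coeff d := by
  by_contra hne
  have : d ∈ (F - f).support := by
    rw [mem_support_iff, coeff_sub]
    exact sub_ne_zero.2 hne
  exact (h.2 d this).ne' hd

theorem HasLowPart.le_lowDeg {j m : ℕ} {F f : MvPolynomial ℕ ℂ} (h : HasLowPart j m F f)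
    {d : ℕ →₀ ℕ} (hd : F.coeff d ≠ 0) : m ≤ lowDeg j d := by
  by_cases hf : f.coeff d = 0
  · refine (h.2 d ?_).le
    rwa [mem_support_iff, coeff_sub, hf, sub_zero]
  · exact (h.1 d (mem_support_iff.2 hf)).ge

theorem HasLowPart.refl {j m : ℕ} {F : MvPolynomial ℕ ℂ} (h : ∀ d ∈ F.support, lowDeg j d = m) :
    HasLowPart j m F F := ⟨h, by simp⟩

theorem HasLowPart.mul {j m n : ℕ} {F f G g : MvPolynomial ℕ ℂ} (hF : HasLowPart j m F f)
    (hG : HasLowPart j n G g) : HasLowPart j (m + n) (F * G) (f * g) := by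
  classical
  constructor
  · intro d hd
    obtain ⟨e, he, e', he', rfl⟩ := Finset.mem_add.1 (support_mul f g hd)
    rw [lowDeg_add, hF.1 e he, hG.1 e' he']
  · intro d hd
    have : F * G - f * g = (F - f) * G + f * (G - g) := by ring
    rw [this] at hd
    rcases Finset.mem_union.1 (support_add hd) with h | h
    · obtain ⟨e, he, e', he', rfl⟩ := Finset.mem_add.1 (support_mul _ _ h)
      have h1 := hF.2 e he
      have h2 := hG.le_lowDeg (mem_support_iff.1 he')
      rw [lowDeg_add]
      omega
    · obtain ⟨e, he, e', he', rfl⟩ := Finset.mem_add.1 (support_mul _ _ h)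
      have h1 := hF.1 e he
      have h2 := hG.2 e' he'
      rw [lowDeg_add]
      omega

theorem HasLowPart.one (j : ℕ) : HasLowPart j 0 1 1 := by
  refine .refl fun d hd => ?_
  rw [mem_support_iff, coeff_one] at hd
  have : d = 0 := by
    by_contra h
    exact hd (if_neg (Ne.symm h))
  simp [this, lowDeg]

theorem HasLowPart.prod {j : ℕ} {ι : Type*} {s : Finset ι} {m : ι → ℕ}
    {F f : ι → MvPolynomial ℕ ℂ} (h : ∀ i ∈ s, HasLowPart j (m i) (F i) (f i)) :
    HasLowPart j (∑ i ∈ s, m i) (∏ i ∈ s, F i) (∏ i ∈ s, f i) := by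
  classical
  induction s using Finset.induction_on with
  | empty => simpa using HasLowPart.one j
  | insert a s ha ih =>
    rw [sum_insert ha, prod_insert ha, prod_insert ha]
    exact (h a (mem_insert_self a s)).mul (ih fun i hi => h i (mem_insert_of_mem hi))

theorem HasLowPart.pow {j m : ℕ} {F f : MvPolynomial ℕ ℂ} (h : HasLowPart j m F f) (n : ℕ) :
    HasLowPart j (n * m) (F ^ n) (f ^ n) := by
  simpa using HasLowPart.prod (s := range n) (m := fun _ => m) fun _ _ => h

theorem lowDeg_single (j c n : ℕ) : lowDeg j (Finsupp.single c n) = if c < j then n else 0 := by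
  simp only [lowDeg, Finsupp.single_apply]
  rw [Finset.sum_ite_eq]
  simp

theorem HasLowPart.X (j c : ℕ) : HasLowPart j (if c < j then 1 else 0) (X c) (X c) := by
  refine .refl fun d hd => ?_
  rw [support_X, Finset.mem_singleton] at hd
  rw [hd, lowDeg_single]

/-- The part of lowest degree of `X c - X a` for `a < c`. -/
theorem HasLowPart.X_sub_X {j a c : ℕ} (hac : a < c) :
    HasLowPart j (if c < j then 1 else 0) (MvPolynomial.X c - MvPolynomial.X a)
      (if a < j ∧ j ≤ c then MvPolynomial.X c else MvPolynomial.X c - MvPolynomial.X a) := by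
  classical
  split_ifs with h1 h2 h2
  · omega
  · refine .refl fun d hd => ?_
    rcases Finset.mem_union.1 (support_sub _ _ _ hd) with h | h <;>
      rw [support_X, Finset.mem_singleton] at h <;> rw [h, lowDeg_single, if_pos (by omega)]
  · refine ⟨by simpa [h1] using (HasLowPart.X j c).1, fun d hd => ?_⟩
    rw [sub_sub_cancel_left, support_neg, support_X, Finset.mem_singleton] at hd
    rw [hd, lowDeg_single, if_pos h2.1]
    exact one_pos
  · refine .refl fun d hd => ?_
    rcases Finset.mem_union.1 (support_sub _ _ _ hd) with h | h <;>
      rw [support_X, Finset.mem_singleton] at h <;> rw [h, lowDeg_single, if_neg (by omega)]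

/-! ### Rearrangements of a non-decreasing sequence -/

/-- Two non-decreasing stretches `A`, `B` of a multiset, all elements of `A` lying below those of
`B`: among the sub-multisets of `A + B` with the size of `A`, the sum of `A` is the smallest, and
`A` is the only one with this sum. -/
theorem sum_le_sum_of_add_eq_add {A B A' B' : Multiset ℕ} (v : ℕ) (hA : ∀ x ∈ A, x ≤ v)
    (hB : ∀ x ∈ B, v ≤ x) (h : A' + B' = A + B) (hcard : A'.card = A.card) :
    A.sum ≤ A'.sum ∧ (A'.sum = A.sum → A' = A ∧ B' = B) := by
  -- the truncated differences `v - x` measure how far elements lie below the threshold `v`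
  have key : ∀ M : Multiset ℕ, (M.map fun x => v - x).sum + M.sum =
      M.card * v + (M.map fun x => x - v).sum := by
    intro M
    induction M using Multiset.induction_on with
    | empty => simp
    | cons a M ih =>
      simp only [Multiset.map_cons, Multiset.sum_cons, Multiset.card_cons, add_mul, one_mul]
      omega
  have zero_iff : ∀ (M : Multiset ℕ) (f : ℕ → ℕ), (M.map f).sum = 0 ↔ ∀ x ∈ M, f x = 0 := by
    intro M f
    rw [Multiset.sum_eq_zero_iff]
    simp
  have hA0 := (zero_iff A fun x => x - v).2 fun x hx => by have := hA x hx; omega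
  have hB0 := (zero_iff B fun x => v - x).2 fun x hx => by have := hB x hx; omega
  have hd := congrArg (fun M : Multiset ℕ => (M.map fun x => v - x).sum) h
  simp only [Multiset.map_add, Multiset.sum_add, hB0] at hd
  have h1 := key A
  have h2 := key A'
  rw [hcard] at h2
  refine ⟨by omega, fun hs => ?_⟩
  have hA1 := (zero_iff A' fun x => x - v).1 (by omega)
  have hB1 := (zero_iff B' fun x => v - x).1 (by omega)
  have hAA : A' = A := by
    have hlt : A'.filter (· < v) = A.filter (· < v) := by
      have := congrArg (Multiset.filter (· < v)) h
      have hB' : B'.filter (· < v) = 0 :=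
        Multiset.filter_eq_nil.2 fun x hx => by have := hB1 x hx; omega
      have hB0 : B.filter (· < v) = 0 :=
        Multiset.filter_eq_nil.2 fun x hx => by have := hB x hx; omega
      rwa [Multiset.filter_add, Multiset.filter_add, hB', hB0, add_zero, add_zero] at this
    have hge : ∀ M : Multiset ℕ, (∀ x ∈ M, x ≤ v) → M.filter (fun x => ¬ x < v) =
        Multiset.replicate (M.filter (fun x => ¬ x < v)).card v := by
      intro M hM
      refine Multiset.eq_replicate_card.2 fun x hx => ?_
      rw [Multiset.mem_filter] at hx
      have := hM x hx.1
      omega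
    have hA1' : ∀ x ∈ A', x ≤ v := fun x hx => by have := hA1 x hx; omega
    have e1 := Multiset.filter_add_not (· < v) A'
    have e2 := Multiset.filter_add_not (· < v) A
    have c1 := congrArg Multiset.card e1
    have c2 := congrArg Multiset.card e2
    rw [Multiset.card_add] at c1 c2
    rw [← e1, ← e2, hge A' hA1', hge A hA, hlt]
    rw [hlt] at c1
    congr 2
    omega
  subst hAA
  exact ⟨rfl, add_left_cancel h⟩

/-- The rearrangements of the entries `b i, …, b (j - 1)`, as exponent vectors supported on the
interval `[i, j)`. -/
def rearr (b : ℕ → ℕ) (i j : ℕ) : Finset (ℕ →₀ ℕ) :=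
  ((Ico i j).finsupp fun _ => (Ico i j).image b).filter
    fun d => (Ico i j).val.map d = (Ico i j).val.map b

theorem mem_rearr {b : ℕ → ℕ} {i j : ℕ} {d : ℕ →₀ ℕ} :
    d ∈ rearr b i j ↔ d.support ⊆ Ico i j ∧ (Ico i j).val.map d = (Ico i j).val.map b := by
  rw [rearr, Finset.mem_filter, Finset.mem_finsupp_iff]
  refine ⟨fun h => ⟨h.1.1, h.2⟩, fun h => ⟨⟨h.1, fun c hc => ?_⟩, h.2⟩⟩
  have : d c ∈ (Ico i j).val.map d := Multiset.mem_map_of_mem d hc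
  rw [h.2, Multiset.mem_map] at this
  obtain ⟨e, he, h⟩ := this
  exact Finset.mem_image.2 ⟨e, he, h⟩

theorem lowDeg_eq_sum_Ico {d : ℕ →₀ ℕ} {i j : ℕ} (hij : i ≤ j) (hd : ∀ c < i, d c = 0) :
    lowDeg j d = ∑ c ∈ Ico i j, d c := by
  rw [lowDeg, ← Finset.sum_range_add_sum_Ico _ hij,
    Finset.sum_eq_zero fun c hc => hd c (Finset.mem_range.1 hc), zero_add]

theorem Ico_val_add {i j k : ℕ} (hij : i ≤ j) (hjk : j ≤ k) :
    (Ico i k).val = (Ico i j).val + (Ico j k).val := by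
  rw [← Ico_union_Ico_eq_Ico hij hjk, ← Finset.disjUnion_eq_union _ _
    (Ico_disjoint_Ico_consecutive i j k)]
  rfl

/-- The partial sums of a rearrangement are at least those of the sorted sequence, and in the case of
equality it splits into rearrangements of the two halves. -/
theorem rearr_lowDeg {b : ℕ → ℕ} (hb : Monotone b) {i j k : ℕ} (hij : i ≤ j) (hjk : j ≤ k)
    {d : ℕ →₀ ℕ} (hd : d ∈ rearr b i k) :
    ∑ c ∈ Ico i j, b c ≤ lowDeg j d ∧ (lowDeg j d = ∑ c ∈ Ico i j, b c →
      (Ico i j).val.map d = (Ico i j).val.map b ∧ (Ico j k).val.map d = (Ico j k).val.map b) := by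
  rw [mem_rearr] at hd
  have hz : ∀ c < i, d c = 0 := fun c hc => by
    by_contra h
    have := Finset.mem_Ico.1 (hd.1 (Finsupp.mem_support_iff.2 h))
    omega
  rw [lowDeg_eq_sum_Ico hij hz]
  have h := hd.2
  rw [Ico_val_add hij hjk, Multiset.map_add, Multiset.map_add] at h
  refine sum_le_sum_of_add_eq_add (b j) ?_ ?_ h (by simp)
  · intro x hx
    obtain ⟨c, hc, rfl⟩ := Multiset.mem_map.1 hx
    exact hb (Finset.mem_Ico.1 hc).2.le
  · intro x hx
    obtain ⟨c, hc, rfl⟩ := Multiset.mem_map.1 hx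
    exact hb (Finset.mem_Ico.1 hc).1

/-- The monomial symmetric polynomial of `b i, …, b (j - 1)` in the variables `X i, …, X (j - 1)`,
the sum of the distinct rearrangements. -/
def msym (b : ℕ → ℕ) (i j : ℕ) : MvPolynomial ℕ ℂ := ∑ d ∈ rearr b i j, monomial d 1

theorem support_subset_of_mem_rearr {b : ℕ → ℕ} {i j : ℕ} {d : ℕ →₀ ℕ} (hd : d ∈ rearr b i j)
    {c : ℕ} (hc : ¬ (i ≤ c ∧ c < j)) : d c = 0 := by
  by_contra h
  exact hc (Finset.mem_Ico.1 ((mem_rearr.1 hd).1 (Finsupp.mem_support_iff.2 h)))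

theorem filter_mem_rearr {b : ℕ → ℕ} {i j i' j' : ℕ} {d : ℕ →₀ ℕ} {p : ℕ → Prop} [DecidablePred p]
    (hd : d ∈ rearr b i j) (hp : ∀ c, i ≤ c → c < j → (p c ↔ i' ≤ c ∧ c < j'))
    (hi : i ≤ i') (hj : j' ≤ j)
    (h : (Ico i' j').val.map d = (Ico i' j').val.map b) : d.filter p ∈ rearr b i' j' := by
  rw [mem_rearr]
  constructor
  · intro c hc
    rw [Finsupp.support_filter, Finset.mem_filter] at hc
    have h1 := Finset.mem_Ico.1 ((mem_rearr.1 hd).1 hc.1)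
    exact Finset.mem_Ico.2 ((hp c h1.1 h1.2).1 hc.2)
  · rw [← h]
    refine Multiset.map_congr rfl fun c hc => ?_
    have hc := Finset.mem_Ico.1 (Finset.mem_def.2 hc)
    exact Finsupp.filter_apply_pos _ _ ((hp c (by omega) (by omega)).2 hc)

theorem hasLowPart_msym {b : ℕ → ℕ} (hb : Monotone b) {i j k : ℕ} (hij : i ≤ j) (hjk : j ≤ k) :
    HasLowPart j (∑ c ∈ Ico i j, b c) (msym b i k) (msym b i j * msym b j k) := by
  classical
  have hprod : msym b i j * msym b j k =
      ∑ d ∈ (rearr b i k).filter (fun d => lowDeg j d = ∑ c ∈ Ico i j, b c), monomial d 1 := by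
    rw [msym, msym, Finset.sum_mul_sum, ← Finset.sum_product']
    refine Finset.sum_bij' (fun p _ => p.1 + p.2)
      (fun d _ => (d.filter (· < j), d.filter (fun c => ¬ c < j))) ?_ ?_ ?_ ?_ ?_
    · rintro ⟨e, f⟩ hef
      obtain ⟨he, hf⟩ := Finset.mem_product.1 hef
      have e0 := fun c => support_subset_of_mem_rearr (c := c) he
      have f0 := fun c => support_subset_of_mem_rearr (c := c) hf
      have hL : (Ico i j).val.map (e + f) = (Ico i j).val.map b := by
        rw [← (mem_rearr.1 he).2]
        refine Multiset.map_congr rfl fun c hc => ?_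
        have hc := Finset.mem_Ico.1 (Finset.mem_def.2 hc)
        simp [f0 c (by omega)]
      have hR : (Ico j k).val.map (e + f) = (Ico j k).val.map b := by
        rw [← (mem_rearr.1 hf).2]
        refine Multiset.map_congr rfl fun c hc => ?_
        have hc := Finset.mem_Ico.1 (Finset.mem_def.2 hc)
        simp [e0 c (by omega)]
      rw [Finset.mem_filter, mem_rearr]
      refine ⟨⟨fun c hc => ?_, ?_⟩, ?_⟩
      · by_contra hn
        rw [Finset.mem_Ico] at hn
        exact Finsupp.mem_support_iff.1 hc (by simp [e0 c (by omega), f0 c (by omega)])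
      · rw [Ico_val_add hij hjk, Multiset.map_add, Multiset.map_add, hL, hR]
      · rw [lowDeg_eq_sum_Ico hij fun c hc => by simp [e0 c (by omega), f0 c (by omega)]]
        exact congrArg Multiset.sum hL
    · intro d hd
      rw [Finset.mem_filter] at hd
      obtain ⟨h1, h2⟩ := (rearr_lowDeg hb hij hjk hd.1).2 hd.2
      exact Finset.mem_product.2
        ⟨filter_mem_rearr hd.1 (fun c _ _ => by omega) le_rfl hjk h1,
          filter_mem_rearr hd.1 (fun c _ _ => by omega) hij le_rfl h2⟩
    · rintro ⟨e, f⟩ hef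
      obtain ⟨he, hf⟩ := Finset.mem_product.1 hef
      have e0 := fun c => support_subset_of_mem_rearr (c := c) he
      have f0 := fun c => support_subset_of_mem_rearr (c := c) hf
      refine Prod.ext (Finsupp.ext fun c => ?_) (Finsupp.ext fun c => ?_)
      · by_cases hc : c < j
        · simp [hc, f0 c (by omega)]
        · simp [hc, e0 c (by omega)]
      · by_cases hc : c < j
        · simp [hc, f0 c (by omega)]
        · simp [Finsupp.filter_apply, hc, e0 c (by omega)]
    · intro d _
      exact Finsupp.filter_add_filter_not d _
    · rintro ⟨e, f⟩ _
      simp [monomial_mul]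
  rw [hprod]
  constructor
  · intro d hd
    obtain ⟨e, he, hde⟩ := Finset.mem_biUnion.1 (support_sum hd)
    rw [support_monomial, if_neg one_ne_zero, Finset.mem_singleton] at hde
    rw [hde]
    exact (Finset.mem_filter.1 he).2
  · intro d hd
    rw [msym, ← Finset.sum_filter_add_sum_filter_not (rearr b i k)
      (fun d => lowDeg j d = ∑ c ∈ Ico i j, b c), add_sub_cancel_left] at hd
    obtain ⟨e, he, hde⟩ := Finset.mem_biUnion.1 (support_sum hd)
    rw [support_monomial, if_neg one_ne_zero, Finset.mem_singleton] at hde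
    rw [hde]
    have := Finset.mem_filter.1 he
    exact lt_of_le_of_ne (rearr_lowDeg hb hij hjk this.1).1 (Ne.symm this.2)

/-! ### The polynomials of the segments of a root partition -/

/-- The root partition `c ↦ q c + b c` of a sequence `b`. -/
def root (q : ℕ) (b : ℕ → ℕ) (c : ℕ) : ℕ := q * c + b c

/-- The power of the Vandermonde product in the variables `X i, …, X (j - 1)`, multiplied by the
`q i`-th power of each variable. -/
def vand (q i j : ℕ) : MvPolynomial ℕ ℂ :=
  ∏ c ∈ Ico i j, (X c ^ (q * i) * ∏ a ∈ Ico i c, (X c - X a) ^ q)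

/-- The polynomial of the segment `[i, j)` of the root partition: up to a power of the product of
its variables it is the model polynomial of `b i, …, b (j - 1)`, and the normalization is such that
the exponents start with the root partition of the whole sequence. -/
def segPoly (q : ℕ) (b : ℕ → ℕ) (i j : ℕ) : MvPolynomial ℕ ℂ := msym b i j * vand q i j

theorem hasLowPart_vand (q : ℕ) {i j k : ℕ} (hij : i ≤ j) (hjk : j ≤ k) :
    HasLowPart j (∑ c ∈ Ico i j, q * c) (vand q i k) (vand q i j * vand q j k) := by
  have h1 : HasLowPart j (∑ c ∈ Ico i j, q * c) (vand q i j) (vand q i j) := by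
    refine HasLowPart.prod fun c hc => ?_
    have hc := Finset.mem_Ico.1 hc
    have h : HasLowPart j (∑ a ∈ Ico i c, q * 1) (∏ a ∈ Ico i c, (X c - X a) ^ q)
        (∏ a ∈ Ico i c, (X c - X a) ^ q) := by
      refine HasLowPart.prod fun a ha => ?_
      have ha := Finset.mem_Ico.1 ha
      have := HasLowPart.X_sub_X (j := j) ha.2
      rw [if_pos hc.2, if_neg (by omega)] at this
      exact this.pow q
    have hX := HasLowPart.X j c
    rw [if_pos hc.2] at hX
    have := (hX.pow (q * i)).mul h
    have he : q * i * 1 + ∑ a ∈ Ico i c, q * 1 = q * c := by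
      simp only [mul_one, Finset.sum_const, Nat.card_Ico, smul_eq_mul]
      rw [mul_comm (c - i), ← mul_add]
      congr 1
      omega
    rwa [he] at this
  have h2 : HasLowPart j 0
      (∏ c ∈ Ico j k, (X c ^ (q * i) * ∏ a ∈ Ico i c, (X c - X a) ^ q)) (vand q j k) := by
    have : HasLowPart j (∑ c ∈ Ico j k, 0)
      (∏ c ∈ Ico j k, (X c ^ (q * i) * ∏ a ∈ Ico i c, (X c - X a) ^ q)) (vand q j k) := by
      refine HasLowPart.prod fun c hc => ?_
      have hc := Finset.mem_Ico.1 hc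
      have hX := HasLowPart.X j c
      rw [if_neg (by omega)] at hX
      have hL : HasLowPart j (∑ a ∈ Ico i j, q * 0) (∏ a ∈ Ico i j, (X c - X a) ^ q)
          (∏ a ∈ Ico i j, X c ^ q) := by
        refine HasLowPart.prod fun a ha => ?_
        have ha := Finset.mem_Ico.1 ha
        have := HasLowPart.X_sub_X (j := j) (a := a) (c := c) (by omega)
        rw [if_neg (by omega), if_pos (by omega)] at this
        exact this.pow q
      have hR : HasLowPart j (∑ a ∈ Ico j c, q * 0) (∏ a ∈ Ico j c, (X c - X a) ^ q)
          (∏ a ∈ Ico j c, (X c - X a) ^ q) := by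
        refine HasLowPart.prod fun a ha => ?_
        have ha := Finset.mem_Ico.1 ha
        have := HasLowPart.X_sub_X (j := j) (a := a) (c := c) (by omega)
        rw [if_neg (by omega), if_neg (by omega)] at this
        exact this.pow q
      have := (hX.pow (q * i)).mul (hL.mul hR)
      rw [Finset.prod_Ico_consecutive _ hij hc.1] at this
      have he : (X c : MvPolynomial ℕ ℂ) ^ (q * i) * ((∏ a ∈ Ico i j, X c ^ q) *
          ∏ a ∈ Ico j c, (X c - X a) ^ q) = X c ^ (q * j) * ∏ a ∈ Ico j c, (X c - X a) ^ q := by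
        rw [Finset.prod_const, Nat.card_Ico, ← mul_assoc, ← pow_mul, ← pow_add, ← mul_add]
        congr 3
        omega
      rw [he] at this
      simpa using this
    simpa using this
  have h1' : vand q i k = vand q i j *
      ∏ c ∈ Ico j k, (X c ^ (q * i) * ∏ a ∈ Ico i c, (X c - X a) ^ q) :=
    (Finset.prod_Ico_consecutive _ hij hjk).symm
  rw [h1']
  exact h1.mul h2

/-- The part of lowest degree of a segment polynomial is the product of the polynomials of the two
subsegments; this is the source of the product rule for its coefficients. -/
theorem hasLowPart_segPoly (q : ℕ) {b : ℕ → ℕ} (hb : Monotone b) {i j k : ℕ} (hij : i ≤ j)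
    (hjk : j ≤ k) : HasLowPart j (∑ c ∈ Ico i j, root q b c) (segPoly q b i k)
      (segPoly q b i j * segPoly q b j k) := by
  have h := (hasLowPart_msym hb hij hjk).mul (hasLowPart_vand q hij hjk)
  rw [← Finset.sum_add_distrib, mul_mul_mul_comm] at h
  simpa only [root, add_comm, segPoly] using h

theorem segPoly_mem_supported (q : ℕ) (b : ℕ → ℕ) (i j : ℕ) :
    segPoly q b i j ∈ supported ℂ (Set.Ico i j) := by
  refine mul_mem (sum_mem fun d hd => ?_) (prod_mem fun c hc => mul_mem (pow_mem ?_ _)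
    (prod_mem fun a ha => pow_mem (sub_mem ?_ ?_) _))
  · rw [mem_supported, vars_monomial one_ne_zero]
    intro c hc
    exact Finset.mem_Ico.1 ((mem_rearr.1 hd).1 hc)
  · exact X_mem_supported.2 (Finset.mem_Ico.1 hc)
  · exact X_mem_supported.2 (Finset.mem_Ico.1 hc)
  · have := Finset.mem_Ico.1 hc
    have := Finset.mem_Ico.1 ha
    exact X_mem_supported.2 ⟨by omega, by omega⟩

theorem apply_eq_zero_of_coeff_ne_zero {F : MvPolynomial ℕ ℂ} {s : Set ℕ}
    (hF : F ∈ supported ℂ s) {d : ℕ →₀ ℕ} (hd : F.coeff d ≠ 0) {c : ℕ} (hc : c ∉ s) : d c = 0 := by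
  by_contra h
  refine hc (mem_supported.1 hF ?_)
  exact (mem_vars_iff_mem_support c).2 ⟨d, mem_support_iff.2 hd, Finsupp.mem_support_iff.2 h⟩

theorem segPoly_apply_eq_zero {q : ℕ} {b : ℕ → ℕ} {i j : ℕ} {d : ℕ →₀ ℕ}
    (hd : (segPoly q b i j).coeff d ≠ 0) {c : ℕ} (hc : ¬ (i ≤ c ∧ c < j)) : d c = 0 :=
  apply_eq_zero_of_coeff_ne_zero (segPoly_mem_supported q b i j) hd hc

theorem coeff_mul_of_disjoint {F G : MvPolynomial ℕ ℂ} {j : ℕ}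
    (hF : ∀ d, F.coeff d ≠ 0 → ∀ c, j ≤ c → d c = 0) (hG : ∀ d, G.coeff d ≠ 0 → ∀ c < j, d c = 0)
    (d : ℕ →₀ ℕ) : (F * G).coeff d =
      F.coeff (d.filter (· < j)) * G.coeff (d.filter (fun c => ¬ c < j)) := by
  classical
  rw [coeff_mul]
  refine Finset.sum_eq_single_of_mem (d.filter (· < j), d.filter (fun c => ¬ c < j))
    (Finset.HasAntidiagonal.mem_antidiagonal.2 (Finsupp.filter_add_filter_not d _)) ?_
  rintro ⟨e, f⟩ hef hne
  by_contra h
  have he := hF e (left_ne_zero_of_mul h)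
  have hf := hG f (right_ne_zero_of_mul h)
  have hef : e + f = d := Finset.HasAntidiagonal.mem_antidiagonal.1 hef
  refine hne (Prod.ext (Finsupp.ext fun c => ?_) (Finsupp.ext fun c => ?_)) <;>
    rw [← hef] <;> by_cases hc : c < j
  · simp [hc, hf c hc]
  · simp [hc, he c (by omega)]
  · simp [hc, hf c hc]
  · simp [Finsupp.filter_apply, hc, he c (by omega)]

/-- The product rule: coefficients factorize where the partial sums of an exponent vector meet
those of the root partition. -/
theorem coeff_segPoly_eq_mul (q : ℕ) {b : ℕ → ℕ} (hb : Monotone b) {i j k : ℕ} (hij : i ≤ j)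
    (hjk : j ≤ k) {d : ℕ →₀ ℕ} (hd : lowDeg j d = ∑ c ∈ Ico i j, root q b c) :
    (segPoly q b i k).coeff d = (segPoly q b i j).coeff (d.filter (· < j)) *
      (segPoly q b j k).coeff (d.filter (fun c => ¬ c < j)) := by
  rw [(hasLowPart_segPoly q hb hij hjk).coeff_eq hd]
  exact coeff_mul_of_disjoint (fun d hd c hc => segPoly_apply_eq_zero hd (by omega))
    (fun d hd c hc => segPoly_apply_eq_zero hd (by omega)) d

/-- Exponent vectors of a segment polynomial are dominated by the root partition. -/
theorem sum_root_le_lowDeg {q : ℕ} {b : ℕ → ℕ} (hb : Monotone b) {i j k : ℕ} (hij : i ≤ j)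
    (hjk : j ≤ k) {d : ℕ →₀ ℕ} (hd : (segPoly q b i k).coeff d ≠ 0) :
    ∑ c ∈ Ico i j, root q b c ≤ lowDeg j d :=
  (hasLowPart_segPoly q hb hij hjk).le_lowDeg hd

theorem segPoly_self (q : ℕ) (b : ℕ → ℕ) (i : ℕ) : segPoly q b i i = 1 := by
  have : rearr b i i = {0} := by
    ext d
    rw [mem_rearr]
    simp
  rw [segPoly, msym, this, vand]
  simp

/-- Segment polynomials are homogeneous. -/
theorem lowDeg_eq_sum_root {q : ℕ} {b : ℕ → ℕ} (hb : Monotone b) {i j : ℕ} (hij : i ≤ j)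
    {d : ℕ →₀ ℕ} (hd : (segPoly q b i j).coeff d ≠ 0) :
    lowDeg j d = ∑ c ∈ Ico i j, root q b c := by
  have h := hasLowPart_segPoly q hb hij le_rfl
  rw [segPoly_self, mul_one] at h
  exact h.1 d (mem_support_iff.2 hd)

/-- The exponent vector of a segment of the root partition. -/
def rootVec (q : ℕ) (b : ℕ → ℕ) (i j : ℕ) : ℕ →₀ ℕ :=
  Finsupp.onFinset (Ico i j) (fun c => if c ∈ Ico i j then root q b c else 0) (by simp_all)

theorem rootVec_apply (q : ℕ) (b : ℕ → ℕ) (i j c : ℕ) :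
    rootVec q b i j c = if i ≤ c ∧ c < j then root q b c else 0 := by
  simp [rootVec]

theorem coeff_rootVec (q : ℕ) {b : ℕ → ℕ} (hb : Monotone b) {i j : ℕ} (hij : i ≤ j) :
    (segPoly q b i j).coeff (rootVec q b i j) = 1 := by
  induction j, hij using Nat.le_induction with
  | base =>
    rw [segPoly_self]
    have : rootVec q b i i = 0 := by
      ext c
      rw [rootVec_apply, if_neg (by omega)]
      rfl
    rw [this, coeff_zero_one]
  | succ j hij ih =>
    rw [coeff_segPoly_eq_mul q hb hij (Nat.le_succ j)]
    · have h1 : (rootVec q b i (j + 1)).filter (· < j) = rootVec q b i j := by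
        ext c
        simp only [Finsupp.filter_apply, rootVec_apply]
        split_ifs <;> first | rfl | omega
      have h2 : (rootVec q b i (j + 1)).filter (fun c => ¬ c < j) =
          Finsupp.single j (root q b j) := by
        ext c
        simp only [Finsupp.filter_apply, rootVec_apply, Finsupp.single_apply]
        split_ifs with h1 h2 h3 h3 <;> first | rfl | omega | skip
        rw [h3]
      have h3 : segPoly q b j (j + 1) = monomial (Finsupp.single j (root q b j)) 1 := by
        have : rearr b j (j + 1) = {Finsupp.single j (b j)} := by
          ext d
          rw [mem_rearr, Finset.mem_singleton]
          simp only [Nat.Ico_succ_singleton, Finset.singleton_val, Multiset.map_singleton,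
            Multiset.singleton_inj]
          refine ⟨fun h => ?_, fun h => ?_⟩
          · rw [← h.2]
            exact Finsupp.support_subset_singleton.1 h.1
          · rw [h]
            exact ⟨Finsupp.support_single_subset, by simp⟩
        rw [segPoly, msym, this, vand]
        simp only [Finset.sum_singleton, Nat.Ico_succ_singleton, Finset.prod_singleton,
          Finset.Ico_self, Finset.prod_empty, mul_one]
        rw [X_pow_eq_monomial, monomial_mul, ← Finsupp.single_add, mul_one, root, add_comm]
      rw [h1, h2, h3, ih]
      simp
    · rw [lowDeg_eq_sum_Ico hij fun c hc => by rw [rootVec_apply, if_neg (by omega)]]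
      refine Finset.sum_congr rfl fun c hc => ?_
      have := Finset.mem_Ico.1 hc
      rw [rootVec_apply, if_pos (by omega)]

/-! ### Domination by polynomials with nonnegative coefficients -/

/-- The coefficients of `F` are bounded in modulus by those of `G`. -/
def Dominated (F : MvPolynomial ℕ ℂ) (G : MvPolynomial ℕ ℝ) : Prop :=
  ∀ d, ‖F.coeff d‖ ≤ G.coeff d

theorem Dominated.mul {F F' : MvPolynomial ℕ ℂ} {G G' : MvPolynomial ℕ ℝ} (h : Dominated F G)
    (h' : Dominated F' G') : Dominated (F * F') (G * G') := by
  classical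
  intro d
  rw [coeff_mul, coeff_mul]
  refine (norm_sum_le _ _).trans (Finset.sum_le_sum fun p _ => ?_)
  rw [norm_mul]
  exact mul_le_mul (h _) (h' _) (norm_nonneg _) ((norm_nonneg _).trans (h _))

theorem Dominated.one : Dominated 1 1 := by
  classical
  intro d
  rw [coeff_one, coeff_one]
  split_ifs <;> simp

theorem Dominated.prod {ι : Type*} {s : Finset ι} {F : ι → MvPolynomial ℕ ℂ}
    {G : ι → MvPolynomial ℕ ℝ} (h : ∀ i ∈ s, Dominated (F i) (G i)) :
    Dominated (∏ i ∈ s, F i) (∏ i ∈ s, G i) := by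
  classical
  induction s using Finset.induction_on with
  | empty => simpa using Dominated.one
  | insert a s ha ih =>
    rw [prod_insert ha, prod_insert ha]
    exact (h a (mem_insert_self a s)).mul (ih fun i hi => h i (mem_insert_of_mem hi))

theorem Dominated.pow {F : MvPolynomial ℕ ℂ} {G : MvPolynomial ℕ ℝ} (h : Dominated F G) (n : ℕ) :
    Dominated (F ^ n) (G ^ n) := by
  simpa using Dominated.prod (s := range n) fun _ _ => h

theorem Dominated.sum {ι : Type*} {s : Finset ι} {F : ι → MvPolynomial ℕ ℂ}
    {G : ι → MvPolynomial ℕ ℝ} (h : ∀ i ∈ s, Dominated (F i) (G i)) :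
    Dominated (∑ i ∈ s, F i) (∑ i ∈ s, G i) := by
  intro d
  rw [coeff_sum, coeff_sum]
  exact (norm_sum_le _ _).trans (Finset.sum_le_sum fun i hi => h i hi d)

theorem Dominated.monomial (d : ℕ →₀ ℕ) :
    Dominated (MvPolynomial.monomial d 1) (MvPolynomial.monomial d 1) := by
  classical
  intro e
  rw [coeff_monomial, coeff_monomial]
  split_ifs <;> simp

theorem Dominated.X (c : ℕ) : Dominated (MvPolynomial.X c) (MvPolynomial.X c) :=
  Dominated.monomial _

theorem Dominated.sub {F F' : MvPolynomial ℕ ℂ} {G G' : MvPolynomial ℕ ℝ} (h : Dominated F G)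
    (h' : Dominated F' G') : Dominated (F - F') (G + G') := by
  intro d
  rw [coeff_sub, coeff_add]
  exact (norm_sub_le _ _).trans (add_le_add (h d) (h' d))

theorem Dominated.sum_le_eval {F : MvPolynomial ℕ ℂ} {G : MvPolynomial ℕ ℝ} (h : Dominated F G)
    {x : ℕ → ℝ} (hx : ∀ c, 0 ≤ x c) (T : Finset (ℕ →₀ ℕ)) :
    ∑ d ∈ T, ‖F.coeff d‖ * d.prod (fun c n => x c ^ n) ≤ G.eval x := by
  classical
  have hpos : ∀ d : ℕ →₀ ℕ, 0 ≤ d.prod (fun c n => x c ^ n) := fun d =>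
    Finset.prod_nonneg fun c _ => pow_nonneg (hx c) _
  calc ∑ d ∈ T, ‖F.coeff d‖ * d.prod (fun c n => x c ^ n)
      ≤ ∑ d ∈ T, G.coeff d * d.prod (fun c n => x c ^ n) :=
        Finset.sum_le_sum fun d _ => mul_le_mul_of_nonneg_right (h d) (hpos d)
    _ ≤ ∑ d ∈ T ∪ G.support, G.coeff d * d.prod (fun c n => x c ^ n) :=
        Finset.sum_le_sum_of_subset_of_nonneg Finset.subset_union_left fun d _ _ =>
          mul_nonneg ((norm_nonneg _).trans (h d)) (hpos d)
    _ = ∑ d ∈ G.support, G.coeff d * d.prod (fun c n => x c ^ n) := by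
        refine (Finset.sum_subset Finset.subset_union_right fun d _ hd => ?_).symm
        rw [notMem_support_iff.1 hd, zero_mul]
    _ = G.eval x := by
        rw [eval_eq]
        rfl

/-! ### Partial sums and moments -/

/-- Summation by parts. -/
theorem sum_Ico_succ_mul (f u : ℕ → ℝ) {i j : ℕ} (hij : i ≤ j) :
    ∑ c ∈ Ico i (j + 1), f c * u c = f j * ∑ c ∈ Ico i (j + 1), u c -
      ∑ k ∈ Ico i j, (f (k + 1) - f k) * ∑ c ∈ Ico i (k + 1), u c := by
  induction j, hij using Nat.le_induction with
  | base => simp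
  | succ j hij ih =>
    have hij' : i ≤ j + 1 := by omega
    rw [Finset.sum_Ico_succ_top hij' fun c => f c * u c, ih,
      Finset.sum_Ico_succ_top hij fun k => (f (k + 1) - f k) * ∑ c ∈ Ico i (k + 1), u c,
      Finset.sum_Ico_succ_top hij' u]
    ring

/-- The first moment `∑ c * d c` of an exponent vector. The monomial with exponents `d` takes the
value `2 ^ moment d` at the point `X c = 2 ^ c`. -/
def moment (d : ℕ →₀ ℕ) : ℕ := d.sum fun c n => c * n

theorem prod_two_pow (d : ℕ →₀ ℕ) : d.prod (fun c n => ((2 : ℝ) ^ c) ^ n) = 2 ^ moment d := by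
  rw [moment, Finsupp.prod, Finsupp.sum, ← Finset.prod_pow_eq_pow_sum]
  simp only [pow_mul]

theorem moment_eq_sum {d : ℕ →₀ ℕ} {i j : ℕ} (hd : ∀ c, ¬ (i ≤ c ∧ c < j) → d c = 0) :
    moment d = ∑ c ∈ Ico i j, c * d c := by
  refine Finsupp.sum_of_support_subset _ (fun c hc => ?_) _ (by simp)
  by_contra h
  exact Finsupp.mem_support_iff.1 hc (hd c (by simpa using h))

/-- The moment of a vector falls below that of a sequence `r` with the same total by the sum of the
excesses of its partial sums over those of `r`. -/
theorem moment_add_sum_excess {d : ℕ →₀ ℕ} {r : ℕ → ℕ} {i j : ℕ} (hij : i ≤ j)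
    (hd : ∀ c, ¬ (i ≤ c ∧ c < j + 1) → d c = 0)
    (hle : ∀ k ∈ Ico i j, ∑ c ∈ Ico i (k + 1), r c ≤ lowDeg (k + 1) d)
    (htot : lowDeg (j + 1) d = ∑ c ∈ Ico i (j + 1), r c) :
    moment d + ∑ k ∈ Ico i j, (lowDeg (k + 1) d - ∑ c ∈ Ico i (k + 1), r c) =
      ∑ c ∈ Ico i (j + 1), c * r c := by
  have hlow : ∀ k, i ≤ k → lowDeg k d = ∑ c ∈ Ico i k, d c := fun k hk =>
    lowDeg_eq_sum_Ico hk fun c hc => hd c (by omega)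
  have h := sum_Ico_succ_mul (fun c => (c : ℝ)) (fun c => (r c : ℝ) - d c) hij
  have h0 : ∑ c ∈ Ico i (j + 1), ((r c : ℝ) - d c) = 0 := by
    rw [hlow _ (by omega)] at htot
    rw [Finset.sum_sub_distrib, sub_eq_zero]
    exact_mod_cast htot.symm
  rw [h0, mul_zero, zero_sub, ← Finset.sum_neg_distrib] at h
  rw [moment_eq_sum hd]
  have h2 : ∀ k ∈ Ico i j, ((lowDeg (k + 1) d - ∑ c ∈ Ico i (k + 1), r c : ℕ) : ℝ) =
      -((((k + 1 : ℕ) : ℝ) - k) * ∑ c ∈ Ico i (k + 1), ((r c : ℝ) - d c)) := by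
    intro k hk
    rw [Nat.cast_sub (hle k hk), hlow _ (by have := Finset.mem_Ico.1 hk; omega),
      Finset.sum_sub_distrib]
    push_cast
    ring
  have h3 : (∑ c ∈ Ico i (j + 1), (c : ℝ) * d c) +
      ∑ k ∈ Ico i j, ((lowDeg (k + 1) d - ∑ c ∈ Ico i (k + 1), r c : ℕ) : ℝ) =
      ∑ c ∈ Ico i (j + 1), (c : ℝ) * r c := by
    rw [Finset.sum_congr rfl h2, ← h]
    simp only [mul_sub, Finset.sum_sub_distrib]
    ring
  exact_mod_cast h3

/-- The monotone exponent vectors `d` have a smaller sum of squares than the root partition. The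
deficit is at least `q` times the sum of the excesses of their partial sums, because the root
partition increases by at least `q` in each step. -/
theorem sum_sq_sub_sq_ge {q : ℕ} {b : ℕ → ℕ} (hb : Monotone b) {d : ℕ →₀ ℕ} {i j : ℕ} (hij : i ≤ j)
    (hd : ∀ c, ¬ (i ≤ c ∧ c < j + 1) → d c = 0)
    (hle : ∀ k ∈ Ico i j, ∑ c ∈ Ico i (k + 1), root q b c ≤ lowDeg (k + 1) d)
    (htot : lowDeg (j + 1) d = ∑ c ∈ Ico i (j + 1), root q b c)
    (hmono : ∀ k ∈ Ico i j, d k ≤ d (k + 1)) :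
    (q : ℝ) * ((∑ k ∈ Ico i j, (lowDeg (k + 1) d - ∑ c ∈ Ico i (k + 1), root q b c) : ℕ) : ℝ) ≤
      ∑ c ∈ Ico i (j + 1), ((root q b c : ℝ) ^ 2 - (d c : ℝ) ^ 2) := by
  have hlow : ∀ k, i ≤ k → lowDeg k d = ∑ c ∈ Ico i k, d c := fun k hk =>
    lowDeg_eq_sum_Ico hk fun c hc => hd c (by omega)
  have h := sum_Ico_succ_mul (fun c => (root q b c : ℝ) + d c) (fun c => (root q b c : ℝ) - d c) hij
  have h0 : ∑ c ∈ Ico i (j + 1), ((root q b c : ℝ) - d c) = 0 := by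
    rw [hlow _ (by omega)] at htot
    rw [Finset.sum_sub_distrib, sub_eq_zero]
    exact_mod_cast htot.symm
  rw [h0, mul_zero, zero_sub, ← Finset.sum_neg_distrib] at h
  simp only [sq_sub_sq]
  rw [h, Nat.cast_sum, Finset.mul_sum]
  refine Finset.sum_le_sum fun k hk => ?_
  rw [Nat.cast_sub (hle k hk), hlow _ (by have := Finset.mem_Ico.1 hk; omega),
      Finset.sum_sub_distrib, ← mul_neg, neg_sub]
  have hle' := hle k hk
  rw [hlow _ (by have := Finset.mem_Ico.1 hk; omega)] at hle'
  have hle'' : (∑ c ∈ Ico i (k + 1), (root q b c : ℝ)) ≤ ∑ c ∈ Ico i (k + 1), (d c : ℝ) := by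
    exact_mod_cast hle'
  push_cast
  refine mul_le_mul_of_nonneg_right ?_ (sub_nonneg.2 hle'')
  have h1 : (d k : ℝ) ≤ d (k + 1) := by exact_mod_cast hmono k hk
  have h2 : (q : ℝ) + root q b k ≤ root q b (k + 1) := by
    have : b k ≤ b (k + 1) := hb (Nat.le_succ k)
    have : q + root q b k ≤ root q b (k + 1) := by
      simp only [root, mul_add, mul_one]
      omega
    exact_mod_cast this
  linarith

/-! ### The weighted sum of the coefficients of a segment -/

/-- Elements that are determined by their coordinates `s d k`, `k ∈ K`, contribute to the sum at most
one geometric series for each coordinate. -/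
theorem sum_prod_half_pow_le {α : Type*} (K : Finset ℕ) (T : Finset α) (s : α → ℕ → ℕ)
    (hinj : ∀ d ∈ T, ∀ e ∈ T, (∀ k ∈ K, s d k = s e k) → d = e) :
    ∑ d ∈ T, ∏ k ∈ K, (1 / 2 : ℝ) ^ s d k ≤ 2 ^ #K := by
  classical
  induction K using Finset.induction_on generalizing T with
  | empty =>
    have : #T ≤ 1 := Finset.card_le_one.2 fun d hd e he => hinj d hd e he (by simp)
    simpa using this
  | insert k K hk ih =>
    have hmaps : ∀ d ∈ T, s d k ∈ T.image (s · k) := fun d hd => Finset.mem_image_of_mem _ hd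
    rw [← Finset.sum_fiberwise_of_maps_to hmaps]
    have hfib : ∀ v ∈ T.image (s · k), ∑ d ∈ T with s d k = v,
        ∏ l ∈ insert k K, (1 / 2 : ℝ) ^ s d l ≤ (1 / 2) ^ v * 2 ^ #K := by
      intro v _
      have : ∑ d ∈ T with s d k = v, ∏ l ∈ insert k K, (1 / 2 : ℝ) ^ s d l =
          (1 / 2) ^ v * ∑ d ∈ T with s d k = v, ∏ l ∈ K, (1 / 2 : ℝ) ^ s d l := by
        rw [Finset.mul_sum]
        refine Finset.sum_congr rfl fun d hd => ?_
        rw [Finset.prod_insert hk, (Finset.mem_filter.1 hd).2]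
      rw [this]
      refine mul_le_mul_of_nonneg_left (ih _ fun d hd e he h => ?_) (by positivity)
      rw [Finset.mem_filter] at hd he
      refine hinj d hd.1 e he.1 fun l hl => ?_
      rcases Finset.mem_insert.1 hl with rfl | hl
      · rw [hd.2, he.2]
      · exact h l hl
    refine (Finset.sum_le_sum hfib).trans ?_
    rw [← Finset.sum_mul, Finset.card_insert_of_notMem hk, pow_succ, mul_comm]
    refine mul_le_mul_of_nonneg_left ?_ (by positivity)
    exact (summable_geometric_two.sum_le_tsum _ fun v _ => by positivity).trans_eq
      tsum_geometric_two

/-- The value of the monomial symmetric polynomial at `X c = 2 ^ c`. A rearrangement is determined by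
the excesses of its partial sums over those of the sorted sequence, and each unit of excess costs a
factor `1 / 2`. -/
theorem eval_msym_le {b : ℕ → ℕ} (hb : Monotone b) {i j : ℕ} (hij : i ≤ j) :
    ∑ d ∈ rearr b i (j + 1), (2 : ℝ) ^ moment d ≤
      2 ^ (∑ c ∈ Ico i (j + 1), c * b c) * 2 ^ (j - i) := by
  have hsupp := fun d (hd : d ∈ rearr b i (j + 1)) c hc =>
    support_subset_of_mem_rearr (c := c) hd hc
  have hle := fun d (hd : d ∈ rearr b i (j + 1)) k (hk : k ∈ Ico i j) =>
    (rearr_lowDeg hb (j := k + 1) (by have := Finset.mem_Ico.1 hk; omega)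
      (by have := Finset.mem_Ico.1 hk; omega) hd).1
  have htot : ∀ d ∈ rearr b i (j + 1), lowDeg (j + 1) d = ∑ c ∈ Ico i (j + 1), b c := by
    intro d hd
    rw [lowDeg_eq_sum_Ico (i := i) (by omega) fun c hc => hsupp d hd c (by omega)]
    exact congrArg Multiset.sum (mem_rearr.1 hd).2
  have h := sum_prod_half_pow_le (Ico i j) (rearr b i (j + 1))
    (fun d k => lowDeg (k + 1) d - ∑ c ∈ Ico i (k + 1), b c) fun d hd e he h => by
      have hall : ∀ k, k ≤ j → lowDeg (k + 1) d = lowDeg (k + 1) e := by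
        intro k hk
        rcases lt_or_ge k i with h1 | h1
        · rw [lowDeg, lowDeg, Finset.sum_eq_zero, Finset.sum_eq_zero]
          · exact fun c hc => hsupp e he c (by have := Finset.mem_range.1 hc; omega)
          · exact fun c hc => hsupp d hd c (by have := Finset.mem_range.1 hc; omega)
        rcases hk.lt_or_eq with h2 | rfl
        · have hk := Finset.mem_Ico.2 ⟨h1, h2⟩
          have h3 := h k hk
          have h4 := hle d hd k hk
          have h5 := hle e he k hk
          omega
        · rw [htot d hd, htot e he]
      ext c
      by_cases hc : i ≤ c ∧ c < j + 1
      · have h1 := hall c (by omega)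
        rw [lowDeg, lowDeg, Finset.sum_range_succ, Finset.sum_range_succ] at h1
        rcases Nat.eq_zero_or_pos c with rfl | hc0
        · simpa using h1
        · have h2 := hall (c - 1) (by omega)
          rw [Nat.sub_add_cancel hc0, lowDeg, lowDeg] at h2
          omega
      · rw [hsupp d hd c hc, hsupp e he c hc]
  rw [Nat.card_Ico] at h
  refine le_trans (le_of_eq ?_) (mul_le_mul_of_nonneg_left h (by positivity))
  rw [Finset.mul_sum]
  refine Finset.sum_congr rfl fun d hd => ?_
  rw [← moment_add_sum_excess hij (hsupp d hd) (hle d hd) (htot d hd), pow_add,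
    Finset.prod_pow_eq_pow_sum, mul_assoc, ← mul_pow]
  norm_num

/-- The bound `∏ (1 + 2 ^ (a - c)) ≤ exp (∑ 2 ^ (a - c)) ≤ exp 1` for one variable's share of the
Vandermonde product. -/
theorem prod_two_pow_add_le (i c : ℕ) :
    ∏ a ∈ Ico i c, ((2 : ℝ) ^ c + 2 ^ a) ≤ (2 ^ c) ^ (c - i) * Real.exp 1 := by
  have h1 : ∀ a ∈ Ico i c, (2 : ℝ) ^ c + 2 ^ a ≤ 2 ^ c * Real.exp (2 ^ a / 2 ^ c) := by
    intro a _
    have := Real.add_one_le_exp ((2 : ℝ) ^ a / 2 ^ c)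
    calc (2 : ℝ) ^ c + 2 ^ a = 2 ^ c * (2 ^ a / 2 ^ c + 1) := by field_simp; ring
      _ ≤ _ := by gcongr
  refine (Finset.prod_le_prod (fun a _ => by positivity) h1).trans ?_
  rw [Finset.prod_mul_distrib, Finset.prod_const, Nat.card_Ico, ← Real.exp_sum]
  gcongr
  rw [← Finset.sum_div, div_le_one (by positivity)]
  have : ∑ a ∈ range c, (2 : ℝ) ^ a = 2 ^ c - 1 := by
    rw [geom_sum_eq (by norm_num)]
    norm_num
  calc ∑ a ∈ Ico i c, (2 : ℝ) ^ a ≤ ∑ a ∈ range c, (2 : ℝ) ^ a :=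
        Finset.sum_le_sum_of_subset_of_nonneg
          (fun a ha => Finset.mem_range.2 (Finset.mem_Ico.1 ha).2) fun _ _ _ => by positivity
    _ ≤ 2 ^ c := by rw [this]; linarith

/-- The sum of the moduli of the coefficients of a segment, weighted by the values of the monomials
at `X c = 2 ^ c`, exceeds the contribution of the root partition at most by a factor that is
exponential in the length of the segment. -/
theorem sum_norm_coeff_segPoly_le (q : ℕ) {b : ℕ → ℕ} (hb : Monotone b) {i j : ℕ} (hij : i ≤ j)
    (T : Finset (ℕ →₀ ℕ)) :
    ∑ d ∈ T, ‖(segPoly q b i (j + 1)).coeff d‖ * 2 ^ moment d ≤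
      2 ^ (∑ c ∈ Ico i (j + 1), c * root q b c) * (2 * Real.exp q) ^ (j - i) := by
  have hdom : Dominated (segPoly q b i (j + 1)) ((∑ d ∈ rearr b i (j + 1), monomial d 1) *
      ∏ c ∈ Ico i (j + 1), (X c ^ (q * i) * ∏ a ∈ Ico i c, (X c + X a) ^ q)) :=
    (Dominated.sum fun d _ => .monomial d).mul (.prod fun c _ => ((Dominated.X c).pow _).mul
      (.prod fun a _ => ((Dominated.X c).sub (.X a)).pow q))
  have h := hdom.sum_le_eval (x := fun c => 2 ^ c) (fun c => by positivity) T
  simp only [prod_two_pow] at h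
  refine h.trans ?_
  simp only [map_mul, map_sum, map_prod, map_pow, map_add, eval_X, eval_monomial, one_mul,
    prod_two_pow]
  have hv : ∏ c ∈ Ico i (j + 1), (((2 : ℝ) ^ c) ^ (q * i) * ∏ a ∈ Ico i c, (2 ^ c + 2 ^ a) ^ q) ≤
      2 ^ (∑ c ∈ Ico i (j + 1), c * (q * c)) * Real.exp q ^ (j - i) := by
    calc _ ≤ ∏ c ∈ Ico i (j + 1), ((2 : ℝ) ^ (c * (q * c)) * if c = i then 1 else Real.exp q) := by
          refine Finset.prod_le_prod (fun c _ => by positivity) fun c hc => ?_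
          have hic := (Finset.mem_Ico.1 hc).1
          split_ifs with hci
          · rw [hci]
            simp [pow_mul]
          · rw [Finset.prod_pow]
            calc ((2 : ℝ) ^ c) ^ (q * i) * (∏ a ∈ Ico i c, (2 ^ c + 2 ^ a)) ^ q
                ≤ (2 ^ c) ^ (q * i) * ((2 ^ c) ^ (c - i) * Real.exp 1) ^ q := by
                  gcongr
                  exact prod_two_pow_add_le i c
              _ = 2 ^ (c * (q * c)) * Real.exp q := by
                  rw [mul_pow, ← Real.exp_nat_mul, mul_one, ← mul_assoc, ← pow_mul (2 ^ c), ← pow_add,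
                    ← pow_mul]
                  congr 3
                  rw [mul_comm (c - i), ← mul_add]
                  congr 1
                  omega
      _ = _ := by
          rw [Finset.prod_mul_distrib, Finset.prod_pow_eq_pow_sum,
            Finset.prod_eq_prod_Ico_succ_bot (by omega), if_pos rfl, one_mul,
            Finset.prod_congr rfl fun c hc => if_neg (by have := Finset.mem_Ico.1 hc; omega),
            Finset.prod_const, Nat.card_Ico, Nat.add_sub_add_right]
  refine (mul_le_mul (eval_msym_le hb hij) hv (by positivity) (by positivity)).trans (le_of_eq ?_)
  have : ∑ c ∈ Ico i (j + 1), c * root q b c =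
      ∑ c ∈ Ico i (j + 1), c * b c + ∑ c ∈ Ico i (j + 1), c * (q * c) := by
    rw [← Finset.sum_add_distrib]
    refine Finset.sum_congr rfl fun c _ => ?_
    rw [root]
    ring
  rw [this, pow_add, mul_pow]
  ring

/-- The total weight of the irreducible exponent vectors of a segment, those whose partial sums
exceed the ones of the root partition at each interior point, decays exponentially with the length
of the segment. If `s ≥ j - i` is the sum of all excesses, the exponential is at most
`(t / (16 * exp q ^ 2)) ^ s`, while `2 ^ moment d` falls below its value at the root partition by the
factor `2 ^ s`. Part of the exponential turns the sum of squares into the one bounded by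
`sum_norm_coeff_segPoly_le`, and the rest absorbs that bound. -/
theorem sum_irreducible_le (q : ℕ) {γ t : ℝ} (ht : 0 < t) (ht1 : t ≤ 1)
    (hγ : Real.exp (-(γ ^ 2 * q)) ≤ t / (16 * Real.exp q ^ 2)) {b : ℕ → ℕ} (hb : Monotone b)
    {i j : ℕ} (hij : i ≤ j) {T : Finset (ℕ →₀ ℕ)}
    (hT : ∀ d ∈ T, (segPoly q b i (j + 1)).coeff d ≠ 0)
    (hmono : ∀ d ∈ T, ∀ k ∈ Ico i j, d k ≤ d (k + 1))
    (hirr : ∀ d ∈ T, ∀ k ∈ Ico i j, ∑ c ∈ Ico i (k + 1), root q b c < lowDeg (k + 1) d) :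
    ∑ d ∈ T, ‖(segPoly q b i (j + 1)).coeff d‖ ^ 2 *
      Real.exp (-(γ ^ 2 * ∑ c ∈ Ico i (j + 1), ((root q b c : ℝ) ^ 2 - (d c : ℝ) ^ 2))) ≤
      t ^ (j - i) := by
  set R := ∑ c ∈ Ico i (j + 1), c * root q b c with hR
  -- the factor `4 * exp q ^ 2` is the square of the base in `sum_norm_coeff_segPoly_le`
  set u := t / (4 * Real.exp q ^ 2) with hu
  have hu0 : 0 ≤ u := by positivity
  have hexp : 1 ≤ Real.exp q := Real.one_le_exp (by positivity)
  have hu1 : u ≤ 1 := by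
    rw [hu, div_le_one (by positivity)]
    nlinarith
  have hterm : ∀ d ∈ T, ‖(segPoly q b i (j + 1)).coeff d‖ ^ 2 *
      Real.exp (-(γ ^ 2 * ∑ c ∈ Ico i (j + 1), ((root q b c : ℝ) ^ 2 - (d c : ℝ) ^ 2))) ≤
      u ^ (j - i) * (‖(segPoly q b i (j + 1)).coeff d‖ * 2 ^ moment d / 2 ^ R) ^ 2 := by
    intro d hd
    have hsupp := fun c hc => segPoly_apply_eq_zero (c := c) (hT d hd) hc
    have hle := fun k (hk : k ∈ Ico i j) => (hirr d hd k hk).le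
    have htot := lowDeg_eq_sum_root hb (by omega) (hT d hd)
    set s := ∑ k ∈ Ico i j, (lowDeg (k + 1) d - ∑ c ∈ Ico i (k + 1), root q b c) with hs
    have hE := sum_sq_sub_sq_ge hb hij hsupp hle htot (hmono d hd)
    have hm := moment_add_sum_excess hij hsupp hle htot
    rw [← hs, ← hR] at hm
    rw [← hs] at hE
    have hns : j - i ≤ s := by
      have := Finset.card_nsmul_le_sum (Ico i j)
        (fun k => lowDeg (k + 1) d - ∑ c ∈ Ico i (k + 1), root q b c) 1 fun k hk => by
          have := hirr d hd k hk
          omega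
      simpa using this
    have h1 : Real.exp (-(γ ^ 2 * ∑ c ∈ Ico i (j + 1), ((root q b c : ℝ) ^ 2 - (d c : ℝ) ^ 2))) ≤
        u ^ (j - i) * ((1 / 2) ^ s) ^ 2 := by
      calc _ ≤ Real.exp (-(γ ^ 2 * q)) ^ s := by
            rw [← Real.exp_nat_mul]
            gcongr
            nlinarith [mul_le_mul_of_nonneg_left hE (sq_nonneg γ)]
        _ ≤ (t / (16 * Real.exp q ^ 2)) ^ s := by gcongr
        _ = u ^ s * ((1 / 2) ^ s) ^ 2 := by
            rw [← pow_mul, mul_comm s 2, pow_mul, ← mul_pow]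
            congr 1
            rw [hu]
            field_simp
            norm_num
        _ ≤ _ := by
            gcongr ?_ * _
            exact pow_le_pow_of_le_one hu0 hu1 hns
    have h2 : (2 : ℝ) ^ moment d / 2 ^ R = (1 / 2) ^ s := by
      rw [← hm, pow_add, one_div, inv_pow]
      field_simp
    calc _ ≤ ‖(segPoly q b i (j + 1)).coeff d‖ ^ 2 * (u ^ (j - i) * ((1 / 2) ^ s) ^ 2) := by gcongr
      _ = _ := by rw [mul_div_assoc, h2]; ring
  refine (Finset.sum_le_sum hterm).trans ?_
  rw [← Finset.mul_sum]
  have hsq : ∑ d ∈ T, (‖(segPoly q b i (j + 1)).coeff d‖ * 2 ^ moment d / 2 ^ R) ^ 2 ≤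
      ((2 * Real.exp q) ^ (j - i)) ^ 2 := by
    refine (Finset.sum_sq_le_sq_sum_of_nonneg fun d _ => by positivity).trans ?_
    gcongr
    rw [← Finset.sum_div, div_le_iff₀ (by positivity), mul_comm]
    exact sum_norm_coeff_segPoly_le q hb hij T
  refine (mul_le_mul_of_nonneg_left hsq (by positivity)).trans (le_of_eq ?_)
  rw [← pow_mul, mul_comm (j - i) 2, pow_mul, ← mul_pow]
  congr 1
  rw [hu]
  field_simp
  norm_num

/-! ### The renewal structure -/

/-- The first `N` entries of `d` are non-decreasing. -/
def IsSorted (N : ℕ) (d : ℕ →₀ ℕ) : Prop := ∀ k, k + 1 < N → d k ≤ d (k + 1)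

theorem IsSorted.le {N : ℕ} {d : ℕ →₀ ℕ} (h : IsSorted N d) {a c : ℕ} (hac : a ≤ c) (hc : c < N) :
    d a ≤ d c := by
  induction c, hac using Nat.le_induction with
  | base => exact le_rfl
  | succ c _ ih => exact (ih (by omega)).trans (h c hc)

open scoped Classical in
/-- The sorted exponent vectors of the polynomial of the segment `[0, N)`. -/
def sortedSupport (q : ℕ) (b : ℕ → ℕ) (N : ℕ) : Finset (ℕ →₀ ℕ) :=
  {d ∈ (segPoly q b 0 N).support | IsSorted N d}

theorem mem_sortedSupport {q : ℕ} {b : ℕ → ℕ} {N : ℕ} {d : ℕ →₀ ℕ} :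
    d ∈ sortedSupport q b N ↔ (segPoly q b 0 N).coeff d ≠ 0 ∧ IsSorted N d := by
  classical
  rw [sortedSupport, Finset.mem_filter, mem_support_iff]

/-- The number of permutations that leave the first `N` entries of `d` unchanged. -/
def stabCard (N : ℕ) (d : ℕ →₀ ℕ) : ℕ :=
  #{σ : Equiv.Perm (Fin N) | ∀ c, d (σ c) = d c}

theorem stabCard_pos (N : ℕ) (d : ℕ →₀ ℕ) : 0 < stabCard N d :=
  Finset.card_pos.2 ⟨1, by simp⟩

/-- The weight of an exponent vector in the squared norm of the model wavefunction, up to a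
constant factor. -/
def weight (q : ℕ) (γ : ℝ) (b : ℕ → ℕ) (N : ℕ) (d : ℕ →₀ ℕ) : ℝ :=
  ‖(segPoly q b 0 N).coeff d‖ ^ 2 / stabCard N d * Real.exp (γ ^ 2 * ∑ c ∈ range N, (d c : ℝ) ^ 2)

theorem weight_nonneg (q : ℕ) (γ : ℝ) (b : ℕ → ℕ) (N : ℕ) (d : ℕ →₀ ℕ) :
    0 ≤ weight q γ b N d := by
  unfold weight
  positivity

/-- The vector `d` is cut at `k`: the sum of its first `k` entries is that of the root partition. -/
def IsCut (q : ℕ) (b : ℕ → ℕ) (k : ℕ) (d : ℕ →₀ ℕ) : Prop :=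
  lowDeg k d = ∑ c ∈ Ico 0 k, root q b c

theorem root_strictMono {q : ℕ} (hq : 0 < q) {b : ℕ → ℕ} (hb : Monotone b) :
    StrictMono (root q b) := by
  intro a c hac
  have h1 := hb hac.le
  have h2 := Nat.mul_lt_mul_of_pos_left hac hq
  simp only [root]
  omega

theorem lowDeg_succ (k : ℕ) (d : ℕ →₀ ℕ) : lowDeg (k + 1) d = lowDeg k d + d k :=
  Finset.sum_range_succ _ _

theorem lowDeg_eq_add {i j : ℕ} (hij : i ≤ j) (d : ℕ →₀ ℕ) :
    lowDeg j d = lowDeg i d + ∑ c ∈ Ico i j, d c :=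
  (Finset.sum_range_add_sum_Ico _ hij).symm

theorem IsCut.le_root {q : ℕ} {b : ℕ → ℕ} (hb : Monotone b) {N k : ℕ} {d : ℕ →₀ ℕ}
    (hd : d ∈ sortedSupport q b N) (hk : IsCut q b k d) (hkN : k ≤ N) {c : ℕ} (hc : c < k) :
    d c ≤ root q b (k - 1) := by
  obtain ⟨k, rfl⟩ := Nat.exists_eq_succ_of_ne_zero (by omega : k ≠ 0)
  rw [mem_sortedSupport] at hd
  have h1 := sum_root_le_lowDeg hb (Nat.zero_le k) (by omega) hd.1
  rw [IsCut, Nat.succ_eq_add_one, lowDeg_succ, Finset.sum_Ico_succ_top (Nat.zero_le k)] at hk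
  have h2 := hd.2.le (Nat.lt_succ_iff.1 hc) (by omega)
  simp only [Nat.succ_eq_add_one, Nat.add_sub_cancel]
  omega

theorem IsCut.root_le {q : ℕ} {b : ℕ → ℕ} (hb : Monotone b) {N k : ℕ} {d : ℕ →₀ ℕ}
    (hd : d ∈ sortedSupport q b N) (hk : IsCut q b k d) {c : ℕ} (hc : k ≤ c) (hcN : c < N) :
    root q b k ≤ d c := by
  rw [mem_sortedSupport] at hd
  have h1 := sum_root_le_lowDeg hb (Nat.zero_le (k + 1)) (by omega) hd.1
  rw [lowDeg_succ, Finset.sum_Ico_succ_top (Nat.zero_le k)] at h1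
  have h2 := hd.2.le hc hcN
  rw [IsCut] at hk
  omega

theorem sum_Ico_eq_of_isCut {q : ℕ} {b : ℕ → ℕ} {i j : ℕ} (hij : i ≤ j) {d : ℕ →₀ ℕ}
    (hi : IsCut q b i d) (hj : IsCut q b j d) :
    ∑ c ∈ Ico i j, d c = ∑ c ∈ Ico i j, root q b c := by
  rw [IsCut] at hi hj
  rw [lowDeg_eq_add hij, ← Finset.sum_Ico_consecutive _ (Nat.zero_le i) hij] at hj
  omega

theorem coeff_segPoly_of_two_cuts (q : ℕ) {b : ℕ → ℕ} (hb : Monotone b) {i j N : ℕ} (hij : i ≤ j)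
    (hjN : j ≤ N) {d : ℕ →₀ ℕ} (hi : IsCut q b i d) (hj : IsCut q b j d) :
    (segPoly q b 0 N).coeff d = (segPoly q b 0 i).coeff (d.filter (· < i)) *
      ((segPoly q b i j).coeff (d.filter (fun c => i ≤ c ∧ c < j)) *
        (segPoly q b j N).coeff (d.filter (fun c => j ≤ c))) := by
  rw [coeff_segPoly_eq_mul q hb (Nat.zero_le i) (hij.trans hjN) hi]
  have h : lowDeg j (d.filter (fun c => ¬ c < i)) = ∑ c ∈ Ico i j, root q b c := by
    rw [lowDeg_eq_sum_Ico hij fun c hc => by simp [hc], ← sum_Ico_eq_of_isCut hij hi hj]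
    exact Finset.sum_congr rfl fun c hc =>
      Finsupp.filter_apply_pos _ _ (by have := Finset.mem_Ico.1 hc; omega)
  rw [coeff_segPoly_eq_mul q hb hij hjN h]
  congr 3
  · ext c
    simp only [Finsupp.filter_apply]
    split_ifs <;> first | rfl | omega
  · ext c
    simp only [Finsupp.filter_apply]
    split_ifs <;> first | rfl | omega

/-- Replacement of the entries in `[i, j)` by those of the root partition. -/
def replaceRoot (q : ℕ) (b : ℕ → ℕ) (i j : ℕ) (d : ℕ →₀ ℕ) : ℕ →₀ ℕ :=
  d.filter (fun c => ¬ (i ≤ c ∧ c < j)) + rootVec q b i j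

theorem replaceRoot_apply (q : ℕ) (b : ℕ → ℕ) (i j : ℕ) (d : ℕ →₀ ℕ) (c : ℕ) :
    replaceRoot q b i j d c = if i ≤ c ∧ c < j then root q b c else d c := by
  rw [replaceRoot, Finsupp.add_apply, Finsupp.filter_apply, rootVec_apply]
  split_ifs <;> simp

theorem isCut_replaceRoot {q : ℕ} {b : ℕ → ℕ} {i j : ℕ} (hij : i ≤ j) {d : ℕ →₀ ℕ}
    (hi : IsCut q b i d) : IsCut q b i (replaceRoot q b i j d) ∧
      IsCut q b j (replaceRoot q b i j d) := by
  have h1 : IsCut q b i (replaceRoot q b i j d) := by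
    rw [IsCut, ← hi]
    refine Finset.sum_congr rfl fun c hc => ?_
    rw [replaceRoot_apply, if_neg (by have := Finset.mem_range.1 hc; omega)]
  refine ⟨h1, ?_⟩
  rw [IsCut] at h1 ⊢
  rw [lowDeg_eq_add hij, h1, ← Finset.sum_Ico_consecutive _ (Nat.zero_le i) hij]
  congr 1
  refine Finset.sum_congr rfl fun c hc => ?_
  rw [replaceRoot_apply, if_pos (Finset.mem_Ico.1 hc)]

/-- The coefficient of a vector is the product of the coefficient of a block between two cuts and of
the coefficient that remains after replacing the block by the root partition. -/
theorem coeff_replaceRoot {q : ℕ} {b : ℕ → ℕ} (hb : Monotone b) {i j N : ℕ} (hij : i ≤ j)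
    (hjN : j ≤ N) {d : ℕ →₀ ℕ} (hi : IsCut q b i d) (hj : IsCut q b j d) :
    (segPoly q b 0 N).coeff d = (segPoly q b i j).coeff (d.filter (fun c => i ≤ c ∧ c < j)) *
      (segPoly q b 0 N).coeff (replaceRoot q b i j d) := by
  rw [coeff_segPoly_of_two_cuts q hb hij hjN hi hj,
    coeff_segPoly_of_two_cuts q hb hij hjN (isCut_replaceRoot hij hi).1 (isCut_replaceRoot hij hi).2]
  have h1 : (replaceRoot q b i j d).filter (· < i) = d.filter (· < i) := by
    ext c
    simp only [Finsupp.filter_apply, replaceRoot_apply]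
    split_ifs <;> first | rfl | omega
  have h2 : (replaceRoot q b i j d).filter (fun c => i ≤ c ∧ c < j) = rootVec q b i j := by
    ext c
    simp only [Finsupp.filter_apply, replaceRoot_apply, rootVec_apply]
    split_ifs <;> rfl
  have h3 : (replaceRoot q b i j d).filter (fun c => j ≤ c) = d.filter (fun c => j ≤ c) := by
    ext c
    simp only [Finsupp.filter_apply, replaceRoot_apply]
    split_ifs <;> first | rfl | omega
  rw [h1, h2, h3, coeff_rootVec q hb hij]
  ring

theorem replaceRoot_mem {q : ℕ} (hq : 0 < q) {b : ℕ → ℕ} (hb : Monotone b) {i j N : ℕ} (hij : i ≤ j)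
    (hjN : j ≤ N) {d : ℕ →₀ ℕ} (hd : d ∈ sortedSupport q b N) (hi : IsCut q b i d)
    (hj : IsCut q b j d) : replaceRoot q b i j d ∈ sortedSupport q b N := by
  have hd' := mem_sortedSupport.1 hd
  have hr := (root_strictMono hq hb).monotone
  refine mem_sortedSupport.2 ⟨?_, fun k hk => ?_⟩
  · have h := hd'.1
    rw [coeff_replaceRoot hb hij hjN hi hj] at h
    exact right_ne_zero_of_mul h
  · rw [replaceRoot_apply, replaceRoot_apply]
    split_ifs with h1 h2 h2
    · exact hr (Nat.le_succ k)
    · exact (hr (by omega)).trans (hj.root_le hb hd (by omega) hk)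
    · exact (hi.le_root hb hd (by omega) (by omega)).trans (hr (by omega))
    · exact hd'.2 k hk

/-- Entries in different parts of a sorted vector that is cut at `i` and `j` differ, and so do the
entries of the root partition: a permutation that preserves `replaceRoot q b i j d` fixes all
points of `[i, j)`, hence it preserves `d`. -/
theorem stabCard_replaceRoot_le {q : ℕ} (hq : 0 < q) {b : ℕ → ℕ} (hb : Monotone b) {i j N : ℕ}
    (hij : i ≤ j) (hjN : j ≤ N) {d : ℕ →₀ ℕ} (hd : d ∈ sortedSupport q b N) (hi : IsCut q b i d)
    (hj : IsCut q b j d) : stabCard N (replaceRoot q b i j d) ≤ stabCard N d := by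
  have hr := root_strictMono hq hb
  have hin : ∀ a c, i ≤ a ∧ a < j → c < N → ¬ (i ≤ c ∧ c < j) → d c ≠ root q b a := by
    intro a c ha hcN hc
    by_cases hci : c < i
    · have h1 := hi.le_root hb hd (by omega) hci
      have h2 : root q b (i - 1) < root q b a := hr (by omega)
      omega
    · have h1 := hj.root_le hb hd (c := c) (by omega) hcN
      have h2 : root q b a < root q b j := hr ha.2
      omega
  refine Finset.card_le_card fun σ hσ => ?_
  simp only [Finset.mem_filter, Finset.mem_univ, true_and, replaceRoot_apply] at hσ ⊢
  intro c
  have h := hσ c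
  split_ifs at h with h1 h2 h2
  · rw [hr.injective h]
  · exact absurd h.symm (hin _ _ h1 c.2 h2)
  · exact absurd h (hin _ _ h2 (σ c).2 h1)
  · exact h

/-- The vector is cut at `i` and at `j + 1`, and at no point in between: its entries in `[i, j + 1)`
form an irreducible block. -/
def IsBlock (q : ℕ) (b : ℕ → ℕ) (i j : ℕ) (d : ℕ →₀ ℕ) : Prop :=
  IsCut q b i d ∧ IsCut q b (j + 1) d ∧ ∀ k ∈ Ico i j, ¬ IsCut q b (k + 1) d

/-- The weight of a vector is bounded by the weight of the vector with the root partition in place of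
a block, times the weight of the block. -/
theorem weight_le {q : ℕ} (hq : 0 < q) (γ : ℝ) {b : ℕ → ℕ} (hb : Monotone b) {i j N : ℕ}
    (hij : i ≤ j) (hjN : j ≤ N) {d : ℕ →₀ ℕ} (hd : d ∈ sortedSupport q b N) (hi : IsCut q b i d)
    (hj : IsCut q b j d) : weight q γ b N d ≤
      ‖(segPoly q b i j).coeff (d.filter (fun c => i ≤ c ∧ c < j))‖ ^ 2 *
        Real.exp (-(γ ^ 2 * ∑ c ∈ Ico i j, ((root q b c : ℝ) ^ 2 -
          (d.filter (fun c => i ≤ c ∧ c < j) c : ℝ) ^ 2))) *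
        weight q γ b N (replaceRoot q b i j d) := by
  have hsum : ∑ c ∈ range N, (d c : ℝ) ^ 2 = -∑ c ∈ Ico i j, ((root q b c : ℝ) ^ 2 -
      (d.filter (fun c => i ≤ c ∧ c < j) c : ℝ) ^ 2) +
      ∑ c ∈ range N, (replaceRoot q b i j d c : ℝ) ^ 2 := by
    rw [neg_add_eq_sub, eq_sub_iff_add_eq', ← eq_sub_iff_add_eq, ← Finset.sum_sub_distrib]
    refine Finset.sum_congr_of_eq_on_inter ?_ ?_ ?_
    · intro c hc hcN
      have := Finset.mem_Ico.1 hc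
      exact absurd (Finset.mem_range.2 (by omega)) hcN
    · intro c _ hc
      rw [Finset.mem_Ico] at hc
      rw [replaceRoot_apply, if_neg hc, sub_self]
    · intro c hc _
      rw [Finset.mem_Ico] at hc
      rw [replaceRoot_apply, if_pos hc, Finsupp.filter_apply, if_pos hc]
  have hst : (stabCard N (replaceRoot q b i j d) : ℝ) ≤ stabCard N d := by
    exact_mod_cast stabCard_replaceRoot_le hq hb hij hjN hd hi hj
  have h0 : (0 : ℝ) < stabCard N (replaceRoot q b i j d) := by exact_mod_cast stabCard_pos N _
  rw [weight, weight, coeff_replaceRoot hb hij hjN hi hj, hsum, mul_add, Real.exp_add, norm_mul,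
    mul_pow, mul_neg]
  set A := ‖(segPoly q b i j).coeff (d.filter (fun c => i ≤ c ∧ c < j))‖
  set B := ‖(segPoly q b 0 N).coeff (replaceRoot q b i j d)‖
  calc A ^ 2 * B ^ 2 / stabCard N d * _
      ≤ A ^ 2 * B ^ 2 / stabCard N (replaceRoot q b i j d) * _ := by gcongr
    _ = _ := by ring

open scoped Classical in
/-- The sorted vectors with an irreducible block in `[i, j + 1)` make up at most the fraction
`t ^ (j - i)` of the total weight: replacing the block by the root partition gives a sorted
vector of the same kind. -/
theorem sum_weight_block_le {q : ℕ} (hq : 0 < q) {γ t : ℝ} (ht : 0 < t) (ht1 : t ≤ 1)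
    (hγ : Real.exp (-(γ ^ 2 * q)) ≤ t / (16 * Real.exp q ^ 2)) {b : ℕ → ℕ} (hb : Monotone b)
    {i j N : ℕ} (hij : i ≤ j) (hjN : j < N) :
    ∑ d ∈ sortedSupport q b N with IsBlock q b i j d, weight q γ b N d ≤
      t ^ (j - i) * ∑ d ∈ sortedSupport q b N, weight q γ b N d := by
  set S := (sortedSupport q b N).filter (IsBlock q b i j) with hS
  set mid : (ℕ →₀ ℕ) → (ℕ →₀ ℕ) := fun d => d.filter (fun c => i ≤ c ∧ c < j + 1) with hmid
  set v : (ℕ →₀ ℕ) → ℝ := fun e => ‖(segPoly q b i (j + 1)).coeff e‖ ^ 2 *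
    Real.exp (-(γ ^ 2 * ∑ c ∈ Ico i (j + 1), ((root q b c : ℝ) ^ 2 - (e c : ℝ) ^ 2))) with hv
  have hle : ∀ d ∈ S, weight q γ b N d ≤ v (mid d) * weight q γ b N (replaceRoot q b i (j + 1) d) := by
    intro d hd
    rw [hS, Finset.mem_filter] at hd
    exact weight_le hq γ hb (by omega) hjN hd.1 hd.2.1 hd.2.2.1
  have hinj : Set.InjOn (fun d => (mid d, replaceRoot q b i (j + 1) d)) S := by
    intro d _ e _ h
    obtain ⟨h1, h2⟩ := Prod.ext_iff.1 h
    ext c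
    have h1 := DFunLike.congr_fun h1 c
    have h2 := DFunLike.congr_fun h2 c
    simp only [hmid, Finsupp.filter_apply, replaceRoot_apply] at h1 h2
    split_ifs at h1 h2
    · exact h1
    · exact h2
  have hnn : ∀ e, 0 ≤ v e := fun e => by simp only [hv]; positivity
  calc ∑ d ∈ S, weight q γ b N d
      ≤ ∑ d ∈ S, v (mid d) * weight q γ b N (replaceRoot q b i (j + 1) d) := Finset.sum_le_sum hle
    _ = ∑ p ∈ S.image (fun d => (mid d, replaceRoot q b i (j + 1) d)),
          v p.1 * weight q γ b N p.2 :=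
        (Finset.sum_image (f := fun p : (ℕ →₀ ℕ) × (ℕ →₀ ℕ) => v p.1 * weight q γ b N p.2) hinj).symm
    _ ≤ ∑ p ∈ S.image mid ×ˢ sortedSupport q b N, v p.1 * weight q γ b N p.2 := by
        refine Finset.sum_le_sum_of_subset_of_nonneg ?_ fun p _ _ =>
          mul_nonneg (hnn _) (weight_nonneg _ _ _ _ _)
        intro p hp
        obtain ⟨d, hd, rfl⟩ := Finset.mem_image.1 hp
        refine Finset.mem_product.2 ⟨Finset.mem_image_of_mem _ hd, ?_⟩
        rw [hS, Finset.mem_filter] at hd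
        exact replaceRoot_mem hq hb (by omega) hjN hd.1 hd.2.1 hd.2.2.1
    _ = (∑ e ∈ S.image mid, v e) * ∑ d ∈ sortedSupport q b N, weight q γ b N d := by
        rw [Finset.sum_mul_sum, ← Finset.sum_product']
    _ ≤ _ := by
        refine mul_le_mul_of_nonneg_right ?_ (Finset.sum_nonneg fun d _ => weight_nonneg _ _ _ _ _)
        refine sum_irreducible_le q ht ht1 hγ hb hij ?_ ?_ ?_
        · intro e he
          obtain ⟨d, hd, rfl⟩ := Finset.mem_image.1 he
          rw [hS, Finset.mem_filter] at hd
          have h := (mem_sortedSupport.1 hd.1).1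
          rw [coeff_replaceRoot hb (by omega) hjN hd.2.1 hd.2.2.1] at h
          exact left_ne_zero_of_mul h
        · intro e he k hk
          obtain ⟨d, hd, rfl⟩ := Finset.mem_image.1 he
          rw [hS, Finset.mem_filter] at hd
          have hk := Finset.mem_Ico.1 hk
          simp only [hmid]
          rw [Finsupp.filter_apply_pos _ _ (by omega), Finsupp.filter_apply_pos _ _ (by omega)]
          exact (mem_sortedSupport.1 hd.1).2 k (by omega)
        · intro e he k hk
          obtain ⟨d, hd, rfl⟩ := Finset.mem_image.1 he
          rw [hS, Finset.mem_filter] at hd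
          have hirr := hd.2.2.2 k hk
          have hdom := sum_root_le_lowDeg hb (Nat.zero_le (k + 1))
            (by have := Finset.mem_Ico.1 hk; omega) (mem_sortedSupport.1 hd.1).1
          have hk := Finset.mem_Ico.1 hk
          have hcut := hd.2.1
          rw [IsCut] at hirr hcut
          have h1 : lowDeg (k + 1) (mid d) = ∑ c ∈ Ico i (k + 1), d c := by
            rw [lowDeg_eq_sum_Ico (i := i) (by omega) fun c hc => ?_]
            · refine Finset.sum_congr rfl fun c hc => ?_
              have := Finset.mem_Ico.1 hc
              exact Finsupp.filter_apply_pos _ _ (by omega)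
            · exact Finsupp.filter_apply_neg _ _ (by omega)
          rw [h1]
          rw [lowDeg_eq_add (i := i) (by omega),
            ← Finset.sum_Ico_consecutive _ (Nat.zero_le i) (by omega : i ≤ k + 1)] at hirr hdom
          omega

/-- A vector that is not cut at `n` has an irreducible block around `n`, between the last cut before
`n` and the first cut after it. -/
theorem exists_isBlock {q : ℕ} {b : ℕ → ℕ} (hb : Monotone b) {n N : ℕ} (hnN : n < N) {d : ℕ →₀ ℕ}
    (hd : d ∈ sortedSupport q b N) (hcut : ¬ IsCut q b n d) :
    ∃ p ∈ range n ×ˢ Ico n N, IsBlock q b p.1 p.2 d := by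
  classical
  have h0 : IsCut q b 0 d := by simp [IsCut, lowDeg]
  have hN : IsCut q b N d := lowDeg_eq_sum_root hb (Nat.zero_le N) (mem_sortedSupport.1 hd).1
  have hex : ∃ k, n < k ∧ IsCut q b k d := ⟨N, hnN, hN⟩
  obtain ⟨hj1, hj2⟩ := Nat.find_spec hex
  have hjN : Nat.find hex ≤ N := Nat.find_min' hex ⟨hnN, hN⟩
  have hjm := fun k (hk : k < Nat.find hex) => Nat.find_min hex hk
  set j := Nat.find hex
  set i := Nat.findGreatest (fun k => IsCut q b k d) n with hi
  have hi1 : IsCut q b i d := Nat.findGreatest_spec (P := fun k => IsCut q b k d) (Nat.zero_le n) h0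
  have hi2 : i ≤ n := Nat.findGreatest_le n
  have hi3 : i ≠ n := fun h => hcut (h ▸ hi1)
  refine ⟨(i, j - 1), Finset.mem_product.2 ⟨Finset.mem_range.2 (by omega),
    Finset.mem_Ico.2 ⟨by omega, by omega⟩⟩, hi1, ?_, fun k hk => ?_⟩
  · rwa [Nat.sub_add_cancel (by omega)]
  · have hk : i ≤ k ∧ k < j - 1 := Finset.mem_Ico.1 hk
    rcases le_or_gt (k + 1) n with h | h
    · exact Nat.findGreatest_is_greatest (P := fun k => IsCut q b k d) (by omega) h
    · exact fun hc => hjm (k + 1) (by omega) ⟨h, hc⟩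

open scoped Classical in
/-- The sorted vectors that are not cut at `n` make up at most the fraction `t / (1 - t) ^ 2` of the
total weight. -/
theorem sum_weight_not_isCut_le {q : ℕ} (hq : 0 < q) {γ t : ℝ} (ht : 0 < t) (ht1 : t < 1)
    (hγ : Real.exp (-(γ ^ 2 * q)) ≤ t / (16 * Real.exp q ^ 2)) {b : ℕ → ℕ} (hb : Monotone b)
    {n N : ℕ} (hnN : n < N) :
    ∑ d ∈ sortedSupport q b N with ¬ IsCut q b n d, weight q γ b N d ≤
      t / (1 - t) ^ 2 * ∑ d ∈ sortedSupport q b N, weight q γ b N d := by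
  set W := ∑ d ∈ sortedSupport q b N, weight q γ b N d with hW
  have hW0 : 0 ≤ W := Finset.sum_nonneg fun d _ => weight_nonneg _ _ _ _ _
  have hgeom : ∀ s : Finset ℕ, ∑ k ∈ s, t ^ k ≤ (1 - t)⁻¹ := fun s => by
    rw [← tsum_geometric_of_lt_one ht.le ht1]
    exact (summable_geometric_of_lt_one ht.le ht1).sum_le_tsum _ fun _ _ => by positivity
  have h1 : ∑ i ∈ range n, t ^ (n - 1 - i) ≤ (1 - t)⁻¹ := by
    rw [Finset.sum_range_reflect fun k => t ^ k]
    exact hgeom _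
  have h2 : ∑ j ∈ Ico n N, t ^ (j - n) ≤ (1 - t)⁻¹ := by
    rw [Finset.sum_Ico_eq_sum_range]
    simp only [Nat.add_sub_cancel_left]
    exact hgeom _
  calc ∑ d ∈ sortedSupport q b N with ¬ IsCut q b n d, weight q γ b N d
      ≤ ∑ d ∈ sortedSupport q b N with ¬ IsCut q b n d, ∑ p ∈ range n ×ˢ Ico n N,
          if IsBlock q b p.1 p.2 d then weight q γ b N d else 0 := by
        refine Finset.sum_le_sum fun d hd => ?_
        rw [Finset.mem_filter] at hd
        obtain ⟨p, hp, hpd⟩ := exists_isBlock hb hnN hd.1 hd.2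
        refine le_trans (le_of_eq (if_pos hpd).symm) (Finset.single_le_sum
          (f := fun p : ℕ × ℕ => if IsBlock q b p.1 p.2 d then weight q γ b N d else 0)
          (fun p _ => ?_) hp)
        split_ifs
        exacts [weight_nonneg _ _ _ _ _, le_rfl]
    _ ≤ ∑ d ∈ sortedSupport q b N, ∑ p ∈ range n ×ˢ Ico n N,
          if IsBlock q b p.1 p.2 d then weight q γ b N d else 0 := by
        refine Finset.sum_le_sum_of_subset_of_nonneg (Finset.filter_subset _ _) fun d _ _ =>
          Finset.sum_nonneg fun p _ => ?_
        split_ifs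
        exacts [weight_nonneg _ _ _ _ _, le_rfl]
    _ = ∑ p ∈ range n ×ˢ Ico n N,
          ∑ d ∈ sortedSupport q b N with IsBlock q b p.1 p.2 d, weight q γ b N d := by
        rw [Finset.sum_comm]
        simp only [Finset.sum_filter]
    -- a block starting at `p.1` and ending with `p.2` has `p.2 - p.1` interior cut points
    _ ≤ ∑ p ∈ range n ×ˢ Ico n N, t * (t ^ (n - 1 - p.1) * t ^ (p.2 - n)) * W := by
        refine Finset.sum_le_sum fun p hp => ?_
        rw [Finset.mem_product, Finset.mem_range, Finset.mem_Ico] at hp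
        refine (sum_weight_block_le hq ht ht1.le hγ hb (by omega) hp.2.2).trans_eq ?_
        rw [← pow_add, ← pow_succ', ← hW]
        congr 2
        omega
    _ = t * ((∑ i ∈ range n, t ^ (n - 1 - i)) * ∑ j ∈ Ico n N, t ^ (j - n)) * W := by
        rw [← Finset.sum_mul, ← Finset.mul_sum, Finset.sum_mul_sum, ← Finset.sum_product']
    _ ≤ t * ((1 - t)⁻¹ * (1 - t)⁻¹) * W := by
        have : 0 ≤ (1 - t)⁻¹ := inv_nonneg.2 (by linarith)
        gcongr
    _ = _ := by
        rw [← mul_inv, ← sq, div_eq_mul_inv]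

/-! ### Orthogonality of the monomials on the cylinder -/

/-- The squared norm of `e^{γ k z}` with respect to `cylMeasure γ`. -/
def monoNormSq (γ : ℝ) (k : ℕ) : ℝ :=
  2 * Real.pi / γ * Real.sqrt Real.pi * Real.exp (γ ^ 2 * (k : ℝ) ^ 2)

theorem integral_exp_mul_gaussian (c : ℝ) :
    ∫ x : ℝ, Real.exp (2 * c * x) * Real.exp (-x ^ 2) = Real.sqrt Real.pi * Real.exp (c ^ 2) := by
  have h : ∀ x : ℝ, Real.exp (2 * c * x) * Real.exp (-x ^ 2) =
      Real.exp (c ^ 2) * Real.exp (-1 * (x - c) ^ 2) := fun x => by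
    rw [← Real.exp_add, ← Real.exp_add]
    congr 1
    ring
  simp_rw [h]
  rw [integral_const_mul, integral_sub_right_eq_self (fun x => Real.exp (-1 * x ^ 2)) c,
    integral_gaussian, div_one, mul_comm]

theorem integral_exp_circle {γ : ℝ} (hγ : 0 < γ) (k l : ℕ) :
    ∫ y in Set.Ico 0 (2 * Real.pi / γ), Complex.exp (γ * ((l : ℂ) - k) * Complex.I * y) =
      if k = l then ((2 * Real.pi / γ : ℝ) : ℂ) else 0 := by
  have h0 : 0 ≤ 2 * Real.pi / γ := by positivity
  rw [integral_Ico_eq_integral_Ioc, ← intervalIntegral.integral_of_le h0]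
  split_ifs with h
  · subst h
    simp
  · have hc : (γ : ℂ) * ((l : ℂ) - k) * Complex.I ≠ 0 := by
      refine mul_ne_zero (mul_ne_zero (by exact_mod_cast hγ.ne') (sub_ne_zero.2 ?_)) Complex.I_ne_zero
      exact_mod_cast Ne.symm h
    rw [integral_exp_mul_complex hc]
    have h1 : (γ : ℂ) * ((l : ℂ) - k) * Complex.I * ((2 * Real.pi / γ : ℝ) : ℂ) =
        ((l - k : ℤ) : ℂ) * (2 * Real.pi * Complex.I) := by
      have : (γ : ℂ) ≠ 0 := by exact_mod_cast hγ.ne'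
      push_cast
      field_simp
    rw [h1, Complex.exp_int_mul_two_pi_mul_I]
    simp

theorem integral_cylMeasure_eq_mul (γ : ℝ) {f : ℂ → ℂ} {g h : ℝ → ℂ}
    (hf : ∀ z : ℂ, f z = g z.re * h z.im) :
    ∫ z, f z ∂cylMeasure γ = (∫ x : ℝ, Real.exp (-x ^ 2) * g x) *
      ∫ y in Set.Ico 0 (2 * Real.pi / γ), h y := by
  have hs : {z : ℂ | 0 ≤ z.im ∧ z.im < 2 * Real.pi / γ} =
      Complex.measurableEquivRealProd ⁻¹' (Set.univ ×ˢ Set.Ico 0 (2 * Real.pi / γ)) := by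
    ext z
    simp
  have hd : (fun z : ℂ => ENNReal.ofReal (Real.exp (-z.re ^ 2))) =
      fun z : ℂ => ((Real.toNNReal (Real.exp (-z.re ^ 2)) : NNReal) : ENNReal) := rfl
  rw [cylMeasure, hd, integral_withDensity_eq_integral_smul (by fun_prop), hs]
  have h1 : ∀ z : ℂ, (Real.exp (-z.re ^ 2)).toNNReal • f z =
      (fun p : ℝ × ℝ => (Real.exp (-p.1 ^ 2) * g p.1) * h p.2)
        (Complex.measurableEquivRealProd z) := by
    intro z
    rw [NNReal.smul_def, Real.coe_toNNReal _ (Real.exp_pos _).le, hf]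
    simp [mul_assoc]
  simp_rw [h1]
  refine (Complex.volume_preserving_equiv_real_prod.setIntegral_preimage_emb
    Complex.measurableEquivRealProd.measurableEmbedding
    (fun p : ℝ × ℝ => (Real.exp (-p.1 ^ 2) * g p.1) * h p.2) _).trans ?_
  rw [Measure.volume_eq_prod,
    setIntegral_prod_mul (fun x : ℝ => (Real.exp (-x ^ 2) : ℂ) * g x) h, setIntegral_univ]

theorem integral_exp_pow_mul_conj {γ : ℝ} (hγ : 0 < γ) (k l : ℕ) :
    ∫ z : ℂ, Complex.exp (γ * z) ^ l * (starRingEnd ℂ) (Complex.exp (γ * z) ^ k) ∂cylMeasure γ =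
      if k = l then (monoNormSq γ k : ℂ) else 0 := by
  rw [integral_cylMeasure_eq_mul γ (g := fun x => ((Real.exp (γ * (k + l) * x) : ℝ) : ℂ))
    (h := fun y => Complex.exp (γ * ((l : ℂ) - k) * Complex.I * y)) ?_, integral_exp_circle hγ]
  · split_ifs with h
    · subst h
      have : ∀ x : ℝ, ((Real.exp (-x ^ 2) : ℝ) : ℂ) * ((Real.exp (γ * (k + k) * x) : ℝ) : ℂ) =
          ((Real.exp (2 * (γ * k) * x) * Real.exp (-x ^ 2) : ℝ) : ℂ) := fun x => by
        push_cast
        ring_nf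
      simp_rw [this]
      rw [integral_complex_ofReal, integral_exp_mul_gaussian, ← Complex.ofReal_mul, monoNormSq, mul_pow]
      congr 1
      ring
    · rw [mul_zero]
  · intro z
    rw [← Complex.exp_nat_mul, ← Complex.exp_nat_mul, ← Complex.exp_conj, ← Complex.exp_add,
      Complex.ofReal_exp, ← Complex.exp_add]
    congr 1
    simp only [map_mul, map_natCast, Complex.conj_ofReal]
    apply Complex.ext <;> simp <;> ring

/-- The point at which a wavefunction evaluates its polynomial: the variable `X c` stands for
`e^{γ z_c}` if `c < N`, and for `1` otherwise. -/
def evalPoint (γ : ℝ) {N : ℕ} (z : Fin N → ℂ) (c : ℕ) : ℂ :=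
  if h : c < N then Complex.exp (γ * z ⟨c, h⟩) else 1

theorem evalPoint_val (γ : ℝ) {N : ℕ} (z : Fin N → ℂ) (j : Fin N) :
    evalPoint γ z j = Complex.exp (γ * z j) := dif_pos j.2

theorem isExpPoly_eval (γ : ℝ) (N : ℕ) (P : MvPolynomial ℕ ℂ) :
    IsExpPoly γ (fun z : Fin N → ℂ => P.eval (evalPoint γ z)) := by
  refine ⟨aeval (fun c => if h : c < N then X ⟨c, h⟩ else 1) P, fun z => ?_⟩
  induction P using MvPolynomial.induction_on with
  | C a => simp
  | add p q hp hq => simp [hp, hq]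
  | mul_X p c hp =>
    simp only at hp ⊢
    rw [map_mul, hp, map_mul, map_mul, aeval_X, eval_X, evalPoint]
    split_ifs <;> simp

/-- The vector in the Hilbert space given by a polynomial in `e^{γ z₁}, …, e^{γ z_N}`. -/
def expVec (γ : ℝ) (N : ℕ) : MvPolynomial ℕ ℂ →ₗ[ℂ] NSpace γ N where
  toFun P := (isExpPoly_eval γ N P).memLp.toLp _
  map_add' P Q := by
    rw [← MemLp.toLp_add]
    exact MemLp.toLp_congr _ _ (.of_forall fun z => by simp)
  map_smul' c P := by
    rw [RingHom.id_apply, ← MemLp.toLp_const_smul]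
    exact MemLp.toLp_congr _ _ (.of_forall fun z => by simp)

theorem toLp_eq_expVec {γ : ℝ} {N : ℕ} {f : (Fin N → ℂ) → ℂ} (hf : IsExpPoly γ f)
    (P : MvPolynomial ℕ ℂ) (h : ∀ z, f z = P.eval (evalPoint γ z)) :
    hf.memLp.toLp f = expVec γ N P :=
  MemLp.toLp_congr _ (isExpPoly_eval γ N P).memLp (.of_forall h)

/-- The vector of the monomial with exponents `f`. -/
def monoVec (γ : ℝ) {N : ℕ} (f : Fin N → ℕ) : NSpace γ N :=
  expVec γ N (∏ j : Fin N, X (j : ℕ) ^ f j)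

theorem inner_monoVec {γ : ℝ} (hγ : 0 < γ) {N : ℕ} (f g : Fin N → ℕ) :
    inner ℂ (monoVec γ f) (monoVec γ g) =
      if f = g then ((∏ j, monoNormSq γ (f j) : ℝ) : ℂ) else 0 := by
  have h1 : inner ℂ (monoVec γ f) (monoVec γ g) = ∫ z : Fin N → ℂ,
      ∏ j, (Complex.exp (γ * z j) ^ g j * (starRingEnd ℂ) (Complex.exp (γ * z j) ^ f j))
        ∂cylMeasureN γ N := by
    rw [L2.inner_def]
    refine integral_congr_ae ?_
    filter_upwards [(isExpPoly_eval γ N (∏ j : Fin N, X (j : ℕ) ^ f j)).memLp.coeFn_toLp,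
      (isExpPoly_eval γ N (∏ j : Fin N, X (j : ℕ) ^ g j)).memLp.coeFn_toLp] with z hz hz'
    rw [monoVec, monoVec]
    refine (congrArg₂ (inner ℂ) hz hz').trans ?_
    rw [RCLike.inner_apply]
    simp only [map_prod, map_pow, eval_X, evalPoint_val, ← Finset.prod_mul_distrib]
  rw [h1, integral_fintype_prod_eq_prod (μ := fun _ : Fin N => cylMeasure γ) (fun j x =>
    Complex.exp (γ * x) ^ g j * (starRingEnd ℂ) (Complex.exp (γ * x) ^ f j))]
  simp_rw [integral_exp_pow_mul_conj hγ]
  split_ifs with h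
  · subst h
    simp
  · obtain ⟨j, hj⟩ := Function.ne_iff.1 h
    exact Finset.prod_eq_zero (Finset.mem_univ j) (if_neg hj)

/-! ### Exchange symmetry of the coefficients -/

/-- The first `N` entries of an exponent vector. -/
def restrictVec (N : ℕ) (d : ℕ →₀ ℕ) : Fin N → ℕ := fun j => d j

/-- The exponent vector with entries `f`, followed by zeros. -/
def extendVec {N : ℕ} (f : Fin N → ℕ) : ℕ →₀ ℕ :=
  Finsupp.onFinset (range N) (fun c => if h : c < N then f ⟨c, h⟩ else 0) fun c hc =>
    Finset.mem_range.2 (by by_contra h; simp [h] at hc)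

theorem extendVec_apply {N : ℕ} (f : Fin N → ℕ) (c : ℕ) :
    extendVec f c = if h : c < N then f ⟨c, h⟩ else 0 := rfl

theorem restrictVec_extendVec {N : ℕ} (f : Fin N → ℕ) : restrictVec N (extendVec f) = f := by
  ext j
  rw [restrictVec, extendVec_apply, dif_pos j.2]

theorem extendVec_restrictVec {N : ℕ} {d : ℕ →₀ ℕ} (hd : ∀ c, N ≤ c → d c = 0) :
    extendVec (restrictVec N d) = d := by
  ext c
  rw [extendVec_apply]
  split_ifs with h
  · rfl
  · exact (hd c (by omega)).symm

theorem extendVec_restrictVec_of_coeff {q : ℕ} {b : ℕ → ℕ} {N : ℕ} {d : ℕ →₀ ℕ}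
    (hd : (segPoly q b 0 N).coeff d ≠ 0) : extendVec (restrictVec N d) = d :=
  extendVec_restrictVec fun _ hc => segPoly_apply_eq_zero hd (by omega)

theorem monotone_restrictVec_iff {N : ℕ} {d : ℕ →₀ ℕ} :
    Monotone (restrictVec N d) ↔ IsSorted N d := by
  refine ⟨fun h k hk => ?_, fun h a c hac => h.le hac c.2⟩
  exact h (a := ⟨k, by omega⟩) (b := ⟨k + 1, hk⟩) (Fin.mk_le_mk.2 (Nat.le_succ k))

/-- The number of permutations that leave `f` unchanged. -/
def stabF {N : ℕ} (f : Fin N → ℕ) : ℕ := #{σ : Equiv.Perm (Fin N) | f ∘ σ = f}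

theorem stabCard_eq (N : ℕ) (d : ℕ →₀ ℕ) : stabCard N d = stabF (restrictVec N d) := by
  rw [stabCard, stabF]
  congr 1
  refine Finset.filter_congr fun σ _ => ?_
  rw [funext_iff]
  rfl

theorem stabF_pos {N : ℕ} (f : Fin N → ℕ) : 0 < stabF f :=
  Finset.card_pos.2 ⟨1, by simp⟩

theorem occFactorial_eq_stabF {N : ℕ} (f : Fin N → ℕ) : occFactorial f = stabF f := by
  have h := DomMulAct.stabilizer_card' f
  rw [Fintype.card_subtype] at h
  rw [stabF, h, occFactorial]
  refine Finset.prod_congr rfl fun k _ => ?_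
  rw [Fintype.card_subtype]

/-- The distinct rearrangements of `f`. -/
def orbit {N : ℕ} (f : Fin N → ℕ) : Finset (Fin N → ℕ) :=
  univ.image fun σ : Equiv.Perm (Fin N) => f ∘ σ

theorem mem_orbit {N : ℕ} {f g : Fin N → ℕ} : g ∈ orbit f ↔ ∃ σ : Equiv.Perm (Fin N), f ∘ σ = g := by
  simp [orbit]

theorem sum_perm_comp {E : Type*} [AddCommMonoid E] {N : ℕ} (f : Fin N → ℕ)
    (H : (Fin N → ℕ) → E) :
    ∑ σ : Equiv.Perm (Fin N), H (f ∘ σ) = stabF f • ∑ g ∈ orbit f, H g := by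
  rw [Finset.sum_comp H fun σ : Equiv.Perm (Fin N) => f ∘ σ, Finset.smul_sum]
  refine Finset.sum_congr rfl fun g hg => ?_
  obtain ⟨τ, rfl⟩ := mem_orbit.1 hg
  congr 1
  refine Finset.card_bij' (fun σ _ => σ * τ⁻¹) (fun σ _ => σ * τ) ?_ ?_ ?_ ?_
  · intro σ hσ
    rw [Finset.mem_filter] at hσ ⊢
    refine ⟨Finset.mem_univ _, ?_⟩
    rw [Equiv.Perm.coe_mul, ← Function.comp_assoc, hσ.2, Function.comp_assoc,
      ← Equiv.Perm.coe_mul, mul_inv_cancel]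
    rfl
  · intro σ hσ
    rw [Finset.mem_filter] at hσ ⊢
    refine ⟨Finset.mem_univ _, ?_⟩
    rw [Equiv.Perm.coe_mul, ← Function.comp_assoc, hσ.2]
  · intro σ _
    simp
  · intro σ _
    simp

theorem map_range_eq_ofFn (N : ℕ) (d : ℕ → ℕ) :
    (Ico 0 N).val.map d = (List.ofFn fun j : Fin N => d j : Multiset ℕ) := by
  rw [← Finset.range_eq_Ico, Finset.range_val, Multiset.range, Multiset.map_coe, List.ofFn_eq_map,
    ← List.map_coe_finRange_eq_range, List.map_map]
  rfl

theorem mem_orbit_iff_perm {N : ℕ} {f g : Fin N → ℕ} :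
    g ∈ orbit f ↔ (List.ofFn g).Perm (List.ofFn f) := by
  rw [mem_orbit]
  constructor
  · rintro ⟨σ, rfl⟩
    exact σ.ofFn_comp_perm f
  · intro h
    have h1 : f ∘ Tuple.sort f = g ∘ Tuple.sort g := by
      refine List.ofFn_injective (List.Perm.eq_of_sortedLE
        (Tuple.monotone_sort f).sortedLE_ofFn (Tuple.monotone_sort g).sortedLE_ofFn ?_)
      exact ((Tuple.sort f).ofFn_comp_perm f).trans
        (h.symm.trans ((Tuple.sort g).ofFn_comp_perm g).symm)
    refine ⟨Tuple.sort f * (Tuple.sort g)⁻¹, ?_⟩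
    rw [Equiv.Perm.coe_mul, ← Function.comp_assoc, h1, Function.comp_assoc, ← Equiv.Perm.coe_mul,
      mul_inv_cancel]
    rfl

theorem mem_rearr_iff_restrictVec {N : ℕ} {b : ℕ → ℕ} {d : ℕ →₀ ℕ} :
    d ∈ rearr b 0 N ↔ (∀ c, N ≤ c → d c = 0) ∧ restrictVec N d ∈ orbit (fun j : Fin N => b j) := by
  rw [mem_rearr, mem_orbit_iff_perm, map_range_eq_ofFn, map_range_eq_ofFn, Multiset.coe_eq_coe]
  refine and_congr_left fun _ => ⟨fun h c hc => ?_, fun h c hc => ?_⟩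
  · by_contra hne
    have := Finset.mem_Ico.1 (h (Finsupp.mem_support_iff.2 hne))
    omega
  · rw [Finset.mem_Ico]
    by_contra hne
    exact Finsupp.mem_support_iff.1 hc (h c (by omega))

theorem monomial_eq_prod_fin {N : ℕ} {d : ℕ →₀ ℕ} (hd : ∀ c, N ≤ c → d c = 0) :
    (monomial d 1 : MvPolynomial ℕ ℂ) = ∏ j : Fin N, X (j : ℕ) ^ restrictVec N d j := by
  rw [monomial_eq, C_1, one_mul, Finsupp.prod_of_support_subset d (s := range N) _ _ (by simp),
    Finset.prod_range]
  · rfl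
  · intro c hc
    rw [Finset.mem_range]
    by_contra h
    exact Finsupp.mem_support_iff.1 hc (hd c (by omega))

/-- The monomial symmetric polynomial as a sum over permutations. -/
theorem stabF_smul_msym (b : ℕ → ℕ) (N : ℕ) :
    stabF (fun j : Fin N => b j) • msym b 0 N =
      ∑ σ : Equiv.Perm (Fin N), ∏ j : Fin N, X (j : ℕ) ^ b (σ j) := by
  refine Eq.trans ?_ (sum_perm_comp (fun j : Fin N => b j)
    (fun f => ∏ j : Fin N, (X (j : ℕ) : MvPolynomial ℕ ℂ) ^ f j)).symm
  rw [msym]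
  congr 1
  refine Finset.sum_bij' (fun d _ => restrictVec N d) (fun f _ => extendVec f) ?_ ?_ ?_ ?_ ?_
  · exact fun d hd => (mem_rearr_iff_restrictVec.1 hd).2
  · intro f hf
    rw [mem_rearr_iff_restrictVec, restrictVec_extendVec]
    exact ⟨fun c hc => by rw [extendVec_apply, dif_neg (by omega)], hf⟩
  · exact fun d hd => extendVec_restrictVec (mem_rearr_iff_restrictVec.1 hd).1
  · exact fun f _ => restrictVec_extendVec f
  · exact fun d hd => monomial_eq_prod_fin (mem_rearr_iff_restrictVec.1 hd).1

theorem vand_zero_eq (q N : ℕ) :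
    vand q 0 N = (∏ j : Fin N, ∏ k ∈ Ioi j, (X (k : ℕ) - X (j : ℕ))) ^ q := by
  have h : ∀ c : Fin N, ∏ a ∈ Ico 0 (c : ℕ), (X (c : ℕ) - X a : MvPolynomial ℕ ℂ) =
      ∏ a ∈ Iio c, (X (c : ℕ) - X (a : ℕ)) := fun c => by
    rw [← Finset.range_eq_Ico, ← Nat.Iio_eq_range, ← Fin.map_valEmbedding_Iio, Finset.prod_map]
    rfl
  rw [vand, ← Finset.range_eq_Ico, Finset.prod_range]
  simp only [mul_zero, pow_zero, one_mul, Finset.prod_pow, h]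
  congr 1
  exact Finset.prod_comm' (by simp)

/-- The extension of a permutation of the first `N` variables to all variables. -/
def extendPerm {N : ℕ} (σ : Equiv.Perm (Fin N)) : Equiv.Perm ℕ := σ.extendDomain Fin.equivSubtype

theorem extendPerm_val {N : ℕ} (σ : Equiv.Perm (Fin N)) (j : Fin N) :
    extendPerm σ j = σ j :=
  Equiv.Perm.extendDomain_apply_image σ Fin.equivSubtype j

theorem rename_vand (q : ℕ) {N : ℕ} (σ : Equiv.Perm (Fin N)) :
    rename (extendPerm σ) (vand q 0 N) =
      (((Equiv.Perm.sign σ : ℤ) : MvPolynomial ℕ ℂ)) ^ q * vand q 0 N := by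
  rw [vand_zero_eq, map_pow, ← mul_pow]
  congr 1
  have h := Matrix.det_permute σ (Matrix.vandermonde fun j : Fin N => (X (j : ℕ) : MvPolynomial ℕ ℂ))
  have h' : (Matrix.vandermonde fun j : Fin N => (X (j : ℕ) : MvPolynomial ℕ ℂ)).submatrix σ id =
      Matrix.vandermonde fun j : Fin N => (X (σ j : ℕ) : MvPolynomial ℕ ℂ) := rfl
  rw [h', Matrix.det_vandermonde, Matrix.det_vandermonde] at h
  simpa [map_prod, extendPerm_val] using h

theorem rename_msym (b : ℕ → ℕ) {N : ℕ} (σ : Equiv.Perm (Fin N)) :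
    rename (extendPerm σ) (msym b 0 N) = msym b 0 N := by
  have h := stabF_smul_msym b N
  have h1 := congrArg (rename (extendPerm σ)) h
  rw [map_nsmul] at h1
  have h2 : rename (extendPerm σ) (∑ τ : Equiv.Perm (Fin N), ∏ j : Fin N,
      (X (j : ℕ) : MvPolynomial ℕ ℂ) ^ b (τ j)) =
      ∑ τ : Equiv.Perm (Fin N), ∏ j : Fin N, X (j : ℕ) ^ b (τ j) := by
    simp only [map_sum, map_prod, map_pow, rename_X, extendPerm_val]
    rw [← Equiv.sum_comp (Equiv.mulRight σ)]
    refine Finset.sum_congr rfl fun τ _ => ?_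
    rw [← Equiv.prod_comp σ (fun j : Fin N => (X (j : ℕ) : MvPolynomial ℕ ℂ) ^ b (τ j))]
    rfl
  rw [h2, ← h] at h1
  have h0 : (stabF (fun j : Fin N => b j)) ≠ 0 := (stabF_pos _).ne'
  ext d
  have h3 := congrArg (coeff d) h1
  rw [coeff_smul, coeff_smul, nsmul_eq_mul, nsmul_eq_mul] at h3
  exact mul_left_cancel₀ (Nat.cast_ne_zero.2 h0) h3

/-- The coefficients are symmetric for even `q` and antisymmetric for odd `q`. -/
theorem coeff_extendVec_comp (q : ℕ) (b : ℕ → ℕ) {N : ℕ} (f : Fin N → ℕ)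
    (σ : Equiv.Perm (Fin N)) :
    (segPoly q b 0 N).coeff (extendVec (f ∘ σ)) =
      ((Equiv.Perm.sign σ : ℤ) : ℂ) ^ q * (segPoly q b 0 N).coeff (extendVec f) := by
  have h : (extendVec (f ∘ σ)).mapDomain (extendPerm σ) = extendVec f := by
    ext c
    by_cases hc : c < N
    · have h1 : c = extendPerm σ (σ.symm ⟨c, hc⟩ : Fin N) := by
        rw [extendPerm_val, Equiv.apply_symm_apply]
      rw [h1, Finsupp.mapDomain_apply (extendPerm σ).injective, ← h1, extendVec_apply,
        extendVec_apply, dif_pos (Fin.is_lt _), dif_pos hc]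
      simp
    · have h1 : extendPerm σ c = c :=
        Equiv.Perm.extendDomain_apply_not_subtype σ Fin.equivSubtype hc
      nth_rewrite 1 [← h1]
      rw [Finsupp.mapDomain_apply (extendPerm σ).injective, extendVec_apply, extendVec_apply,
        dif_neg hc, dif_neg hc]
  have h2 := coeff_rename_mapDomain (extendPerm σ) (extendPerm σ).injective (segPoly q b 0 N)
    (extendVec (f ∘ σ))
  rw [h, segPoly, map_mul, rename_vand, rename_msym] at h2
  have h3 : (((Equiv.Perm.sign σ : ℤ) : MvPolynomial ℕ ℂ)) ^ q =
      C (((Equiv.Perm.sign σ : ℤ) : ℂ) ^ q) := by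
    rw [map_pow]
    simp
  rw [h3, mul_left_comm, coeff_C_mul] at h2
  exact h2.symm

/-- The vector of the (anti)symmetrization of the monomial with exponents `f`. -/
def symVec (γ : ℝ) (q : ℕ) {N : ℕ} (f : Fin N → ℕ) : NSpace γ N :=
  ∑ σ : Equiv.Perm (Fin N), (((Equiv.Perm.sign σ : ℤ) : ℂ) ^ q) • monoVec γ (f ∘ σ)

theorem coeff_smul_symVec (γ : ℝ) (q : ℕ) (b : ℕ → ℕ) {N : ℕ} (f : Fin N → ℕ) :
    (segPoly q b 0 N).coeff (extendVec f) • symVec γ q f =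
      (stabF f : ℂ) • ∑ g ∈ orbit f, (segPoly q b 0 N).coeff (extendVec g) • monoVec γ g := by
  rw [symVec, Finset.smul_sum, Nat.cast_smul_eq_nsmul, ← sum_perm_comp f
    (fun g => (segPoly q b 0 N).coeff (extendVec g) • monoVec γ g)]
  refine Finset.sum_congr rfl fun σ _ => ?_
  rw [coeff_extendVec_comp, smul_smul, mul_comm]

/-- The vector of a segment polynomial is a sum over sorted exponent vectors. -/
theorem expVec_segPoly (γ : ℝ) (q : ℕ) (b : ℕ → ℕ) (N : ℕ) :
    expVec γ N (segPoly q b 0 N) = ∑ d ∈ sortedSupport q b N,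
      ((segPoly q b 0 N).coeff d / stabCard N d) • symVec γ q (restrictVec N d) := by
  set P := segPoly q b 0 N with hP
  have hsort : ∀ d ∈ P.support,
      extendVec (restrictVec N d ∘ Tuple.sort (restrictVec N d)) ∈ sortedSupport q b N := by
    intro d hd
    rw [mem_sortedSupport, ← hP, ← monotone_restrictVec_iff, restrictVec_extendVec]
    refine ⟨?_, Tuple.monotone_sort _⟩
    rw [mem_support_iff] at hd
    rw [hP, coeff_extendVec_comp, extendVec_restrictVec_of_coeff hd]
    exact mul_ne_zero (pow_ne_zero _ (by exact_mod_cast (Equiv.Perm.sign _).ne_zero)) hd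
  have h1 : expVec γ N P = ∑ d ∈ P.support, P.coeff d • monoVec γ (restrictVec N d) := by
    conv_lhs => rw [P.as_sum]
    rw [map_sum]
    refine Finset.sum_congr rfl fun d hd => ?_
    rw [monoVec, ← monomial_eq_prod_fin fun c hc =>
      segPoly_apply_eq_zero (mem_support_iff.1 hd) (by omega), ← map_smul, smul_monomial,
      smul_eq_mul, mul_one]
  rw [h1, ← Finset.sum_fiberwise_of_maps_to hsort]
  refine Finset.sum_congr rfl fun e he => ?_
  have he' := mem_sortedSupport.1 he
  have hee := extendVec_restrictVec_of_coeff he'.1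
  have h2 := coeff_smul_symVec γ q b (restrictVec N e)
  rw [hee, ← hP, ← stabCard_eq] at h2
  have h0 : (stabCard N e : ℂ) ≠ 0 := by exact_mod_cast (stabCard_pos N e).ne'
  rw [div_eq_inv_mul, mul_smul, h2, inv_smul_smul₀ h0]
  refine Finset.sum_bij' (fun d _ => restrictVec N d) (fun f _ => extendVec f) ?_ ?_ ?_ ?_ ?_
  · intro d hd
    rw [Finset.mem_filter] at hd
    refine mem_orbit.2 ⟨(Tuple.sort (restrictVec N d))⁻¹, ?_⟩
    rw [← hd.2, restrictVec_extendVec, Function.comp_assoc, ← Equiv.Perm.coe_mul, mul_inv_cancel]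
    rfl
  · intro f hf
    obtain ⟨σ, rfl⟩ := mem_orbit.1 hf
    rw [Finset.mem_filter, mem_support_iff, restrictVec_extendVec]
    constructor
    · rw [hP, coeff_extendVec_comp, hee]
      exact mul_ne_zero (pow_ne_zero _ (by exact_mod_cast (Equiv.Perm.sign σ).ne_zero)) he'.1
    · have hm : Monotone (restrictVec N e ∘ (1 : Equiv.Perm (Fin N))) :=
        monotone_restrictVec_iff.2 he'.2
      have hm' := Tuple.monotone_sort (restrictVec N e ∘ σ)
      rw [Function.comp_assoc, ← Equiv.Perm.coe_mul] at hm' ⊢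
      rw [Tuple.unique_monotone hm' hm]
      exact hee
  · intro d hd
    exact extendVec_restrictVec_of_coeff (mem_support_iff.1 (Finset.mem_filter.1 hd).1)
  · exact fun f _ => restrictVec_extendVec f
  · intro d hd
    rw [extendVec_restrictVec_of_coeff (mem_support_iff.1 (Finset.mem_filter.1 hd).1)]

/-! ### The occupation basis and the expansion of the model wavefunctions -/

/-- The squared norm of `monoVec γ f`. -/
def vecNormSq (γ : ℝ) {N : ℕ} (f : Fin N → ℕ) : ℝ := ∏ j, monoNormSq γ (f j)

theorem vecNormSq_comp (γ : ℝ) {N : ℕ} (f : Fin N → ℕ) (σ : Equiv.Perm (Fin N)) :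
    vecNormSq γ (f ∘ σ) = vecNormSq γ f :=
  Equiv.prod_comp σ fun j => monoNormSq γ (f j)

theorem sign_pow_mul_self (q : ℕ) {N : ℕ} (σ : Equiv.Perm (Fin N)) :
    ((Equiv.Perm.sign σ : ℤ) : ℂ) ^ q * ((Equiv.Perm.sign σ : ℤ) : ℂ) ^ q = 1 := by
  rw [← mul_pow, ← Int.cast_mul, ← Units.val_mul, Int.units_mul_self]
  simp

theorem inner_symVec {γ : ℝ} (hγ : 0 < γ) (q : ℕ) {N : ℕ} (f g : Fin N → ℕ) :
    inner ℂ (symVec γ q f) (symVec γ q g) = ∑ σ : Equiv.Perm (Fin N), ∑ τ : Equiv.Perm (Fin N),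
      ((Equiv.Perm.sign σ : ℤ) : ℂ) ^ q * (((Equiv.Perm.sign τ : ℤ) : ℂ) ^ q *
        if f ∘ σ = g ∘ τ then (vecNormSq γ f : ℂ) else 0) := by
  rw [symVec, symVec, sum_inner]
  refine Finset.sum_congr rfl fun σ _ => ?_
  rw [inner_sum]
  refine Finset.sum_congr rfl fun τ _ => ?_
  rw [inner_smul_left, inner_smul_right, inner_monoVec hγ, map_pow, map_intCast]
  congr 3
  exact congrArg _ (vecNormSq_comp γ f σ)

theorem inner_symVec_of_ne {γ : ℝ} (hγ : 0 < γ) (q : ℕ) {N : ℕ} {f g : Fin N → ℕ}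
    (hf : Monotone f) (hg : Monotone g) (hfg : f ≠ g) :
    inner ℂ (symVec γ q f) (symVec γ q g) = 0 := by
  rw [inner_symVec hγ]
  refine Finset.sum_eq_zero fun σ _ => Finset.sum_eq_zero fun τ _ => ?_
  rw [if_neg, mul_zero, mul_zero]
  intro h
  have h1 : f = g ∘ (τ * σ⁻¹ : Equiv.Perm (Fin N)) := by
    rw [Equiv.Perm.coe_mul, ← Function.comp_assoc, ← h, Function.comp_assoc,
      ← Equiv.Perm.coe_mul, mul_inv_cancel]
    rfl
  have h2 : Monotone (g ∘ (1 : Equiv.Perm (Fin N))) := hg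
  exact hfg (h1.trans (Tuple.unique_monotone (h1 ▸ hf) h2))

/-- The squared norm of an (anti)symmetrized monomial. The hypothesis excludes the vectors that
vanish by antisymmetry. -/
theorem inner_symVec_self {γ : ℝ} (hγ : 0 < γ) (q : ℕ) {N : ℕ} {f : Fin N → ℕ}
    (hf : ∀ σ : Equiv.Perm (Fin N), f ∘ σ = f → ((Equiv.Perm.sign σ : ℤ) : ℂ) ^ q = 1) :
    inner ℂ (symVec γ q f) (symVec γ q f) = ((stabF f * N ! * vecNormSq γ f : ℝ) : ℂ) := by
  rw [inner_symVec hγ]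
  have h : ∀ σ : Equiv.Perm (Fin N), ∑ τ : Equiv.Perm (Fin N),
      ((Equiv.Perm.sign σ : ℤ) : ℂ) ^ q * (((Equiv.Perm.sign τ : ℤ) : ℂ) ^ q *
        if f ∘ σ = f ∘ τ then (vecNormSq γ f : ℂ) else 0) = stabF f * vecNormSq γ f := by
    intro σ
    rw [← Equiv.sum_comp (Equiv.mulRight σ)]
    have h1 : ∀ ρ : Equiv.Perm (Fin N), ((Equiv.Perm.sign σ : ℤ) : ℂ) ^ q *
        (((Equiv.Perm.sign (Equiv.mulRight σ ρ) : ℤ) : ℂ) ^ q *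
          if f ∘ σ = f ∘ (Equiv.mulRight σ ρ) then (vecNormSq γ f : ℂ) else 0) =
        if f ∘ ρ = f then (vecNormSq γ f : ℂ) else 0 := by
      intro ρ
      have h2 : f ∘ σ = f ∘ (Equiv.mulRight σ ρ) ↔ f ∘ ρ = f := by
        rw [Equiv.coe_mulRight, Equiv.Perm.coe_mul, ← Function.comp_assoc]
        exact ⟨fun h => (σ.surjective.injective_comp_right h).symm, fun h => by rw [h]⟩
      simp only [h2]
      split_ifs with h3
      · rw [Equiv.coe_mulRight, Equiv.Perm.sign_mul, Units.val_mul, Int.cast_mul, mul_pow, hf ρ h3,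
          one_mul, ← mul_assoc, sign_pow_mul_self, one_mul]
      · simp
    rw [Finset.sum_congr rfl fun ρ _ => h1 ρ, ← Finset.sum_filter, Finset.sum_const, nsmul_eq_mul,
      stabF]
  rw [Finset.sum_congr rfl fun σ _ => h σ, Finset.sum_const, Finset.card_univ, Fintype.card_perm,
    Fintype.card_fin, nsmul_eq_mul]
  push_cast
  ring

/-- The normalization of the orbitals, apart from the Gaussian factor. -/
def orbConst (γ : ℝ) : ℝ := Real.sqrt (γ / (2 * Real.pi ^ (3 / 2 : ℝ)))

theorem orbConst_pos {γ : ℝ} (hγ : 0 < γ) : 0 < orbConst γ := by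
  unfold orbConst
  positivity

theorem orbConst_sq_mul {γ : ℝ} (hγ : 0 < γ) (k : ℕ) :
    (orbConst γ * Real.exp (-γ ^ 2 * k ^ 2 / 2)) ^ 2 * monoNormSq γ k = 1 := by
  have hpi : Real.pi ^ (3 / 2 : ℝ) = Real.pi * Real.sqrt Real.pi := by
    rw [Real.sqrt_eq_rpow, ← Real.rpow_one_add' Real.pi_pos.le (by norm_num)]
    norm_num
  rw [mul_pow, orbConst, Real.sq_sqrt (by positivity), monoNormSq, hpi, ← Real.exp_nat_mul]
  have h1 : Real.exp ((2 : ℕ) * (-γ ^ 2 * k ^ 2 / 2)) * Real.exp (γ ^ 2 * (k : ℝ) ^ 2) = 1 := by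
    rw [← Real.exp_add, Real.exp_eq_one_iff]
    push_cast
    ring
  have h2 : γ / (2 * (Real.pi * Real.sqrt Real.pi)) * (2 * Real.pi / γ * Real.sqrt Real.pi) = 1 := by
    have := Real.sqrt_pos.2 Real.pi_pos
    have := Real.pi_pos
    field_simp
  calc _ = (γ / (2 * (Real.pi * Real.sqrt Real.pi)) * (2 * Real.pi / γ * Real.sqrt Real.pi)) *
        (Real.exp ((2 : ℕ) * (-γ ^ 2 * k ^ 2 / 2)) * Real.exp (γ ^ 2 * (k : ℝ) ^ 2)) := by ring
    _ = 1 := by rw [h1, h2, one_mul]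

/-- The normalization of `slater γ q f` relative to `symVec γ q f`. -/
def slaterConst (γ : ℝ) {N : ℕ} (f : Fin N → ℕ) : ℝ :=
  1 / Real.sqrt (stabF f * N !) * ∏ j, (orbConst γ * Real.exp (-γ ^ 2 * (f j : ℝ) ^ 2 / 2))

theorem slaterConst_sq_mul {γ : ℝ} (hγ : 0 < γ) {N : ℕ} (f : Fin N → ℕ) :
    slaterConst γ f ^ 2 * (stabF f * N ! * vecNormSq γ f) = 1 := by
  have h0 : (0 : ℝ) < stabF f * N ! := by
    have := stabF_pos f
    have := Nat.factorial_pos N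
    positivity
  have h1 : (∏ j, (orbConst γ * Real.exp (-γ ^ 2 * (f j : ℝ) ^ 2 / 2))) ^ 2 * vecNormSq γ f = 1 := by
    rw [← Finset.prod_pow, vecNormSq, ← Finset.prod_mul_distrib]
    exact Finset.prod_eq_one fun j _ => orbConst_sq_mul hγ (f j)
  rw [slaterConst, mul_pow, div_pow, one_pow, Real.sq_sqrt h0.le, mul_mul_mul_comm, h1, mul_one,
    one_div_mul_cancel h0.ne']

theorem slater_eq_smul_symVec (γ : ℝ) (q : ℕ) {N : ℕ} (f : Fin N → ℕ) :
    slater γ q f = (slaterConst γ f : ℂ) • symVec γ q f := by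
  have h : (slaterConst γ f : ℂ) • symVec γ q f = expVec γ N (C (slaterConst γ f : ℂ) *
      ∑ σ : Equiv.Perm (Fin N), C (((Equiv.Perm.sign σ : ℤ) : ℂ) ^ q) *
        ∏ j : Fin N, X (j : ℕ) ^ f (σ j)) := by
    rw [← smul_eq_C_mul, map_smul, map_sum, symVec]
    congr 1
    refine Finset.sum_congr rfl fun σ _ => ?_
    rw [← smul_eq_C_mul, map_smul]
    rfl
  rw [h]
  refine toLp_eq_expVec (isExpPoly_slaterFun γ q f) _ fun z => ?_
  rw [map_mul, eval_C, map_sum, slaterFun, ← Equiv.sum_comp (Equiv.inv (Equiv.Perm (Fin N))),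
    slaterConst, Complex.ofReal_mul, mul_assoc, occFactorial_eq_stabF]
  congr 1
  rw [Finset.mul_sum]
  refine Finset.sum_congr rfl fun σ _ => ?_
  rw [map_mul, eval_C, Equiv.inv_apply, Equiv.Perm.sign_inv, mul_left_comm]
  congr 1
  rw [map_prod, ← Equiv.prod_comp σ, Complex.ofReal_prod,
    ← Equiv.prod_comp σ (fun j => ((orbConst γ * Real.exp (-γ ^ 2 * (f j : ℝ) ^ 2 / 2) : ℝ) : ℂ)),
    ← Finset.prod_mul_distrib]
  refine Finset.prod_congr rfl fun j _ => ?_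
  rw [map_pow, eval_X, evalPoint_val, show σ⁻¹ (σ j) = j from σ.symm_apply_apply j, orbital,
    orbConst, ← Complex.exp_nat_mul]
  congr 2
  ring

theorem inner_slater_of_ne {γ : ℝ} (hγ : 0 < γ) (q : ℕ) {N : ℕ} {f g : Fin N → ℕ}
    (hf : Monotone f) (hg : Monotone g) (hfg : f ≠ g) :
    inner ℂ (slater γ q f) (slater γ q g) = 0 := by
  rw [slater_eq_smul_symVec, slater_eq_smul_symVec, inner_smul_left, inner_smul_right,
    inner_symVec_of_ne hγ q hf hg hfg, mul_zero, mul_zero]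

theorem inner_slater_self {γ : ℝ} (hγ : 0 < γ) (q : ℕ) (b : ℕ → ℕ) {N : ℕ} {d : ℕ →₀ ℕ}
    (hd : (segPoly q b 0 N).coeff d ≠ 0) :
    inner ℂ (slater γ q (restrictVec N d)) (slater γ q (restrictVec N d)) = 1 := by
  have h := inner_symVec_self hγ q (f := restrictVec N d) fun σ hσ => by
    have h := coeff_extendVec_comp q b (restrictVec N d) σ
    rw [hσ, extendVec_restrictVec_of_coeff hd] at h
    exact (mul_eq_right₀ hd).1 h.symm
  rw [slater_eq_smul_symVec, inner_smul_left, inner_smul_right, h, Complex.conj_ofReal,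
    ← mul_assoc, ← Complex.ofReal_mul, ← sq, ← Complex.ofReal_mul, slaterConst_sq_mul hγ,
    Complex.ofReal_one]

/-- The amplitude of an occupation basis vector in the model wavefunction, up to a positive
constant. -/
def amplitude (γ : ℝ) (q : ℕ) (b : ℕ → ℕ) (N : ℕ) (d : ℕ →₀ ℕ) : ℂ :=
  (segPoly q b 0 N).coeff d *
    ((Real.exp (γ ^ 2 / 2 * ∑ c ∈ range N, (d c : ℝ) ^ 2) / Real.sqrt (stabCard N d) : ℝ) : ℂ)

theorem norm_amplitude_sq (γ : ℝ) (q : ℕ) (b : ℕ → ℕ) (N : ℕ) (d : ℕ →₀ ℕ) :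
    ‖amplitude γ q b N d‖ ^ 2 = weight q γ b N d := by
  have h0 : (0 : ℝ) < stabCard N d := by exact_mod_cast stabCard_pos N d
  rw [amplitude, norm_mul, Complex.norm_real, mul_pow, Real.norm_eq_abs, sq_abs, div_pow,
    Real.sq_sqrt h0.le, ← Real.exp_nat_mul, weight]
  have : ((2 : ℕ) : ℝ) * (γ ^ 2 / 2 * ∑ c ∈ range N, (d c : ℝ) ^ 2) =
      γ ^ 2 * ∑ c ∈ range N, (d c : ℝ) ^ 2 := by
    push_cast
    ring
  rw [this]
  ring

/-- The combination of occupation basis vectors with the amplitudes of the model wavefunction,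
over a set `T` of sorted exponent vectors. -/
def modelVec (γ : ℝ) (q : ℕ) (b : ℕ → ℕ) (N : ℕ) (T : Finset (ℕ →₀ ℕ)) : NSpace γ N :=
  ∑ d ∈ T, amplitude γ q b N d • slater γ q (restrictVec N d)

theorem inner_slater {γ : ℝ} (hγ : 0 < γ) (q : ℕ) (b : ℕ → ℕ) {N : ℕ} {f : Fin N → ℕ}
    (hf : Monotone f) {d : ℕ →₀ ℕ} (hd : d ∈ sortedSupport q b N) :
    inner ℂ (slater γ q f) (slater γ q (restrictVec N d)) = if d = extendVec f then 1 else 0 := by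
  have hd := mem_sortedSupport.1 hd
  split_ifs with h
  · have : f = restrictVec N d := by rw [h, restrictVec_extendVec]
    rw [this, inner_slater_self hγ q b hd.1]
  · refine inner_slater_of_ne hγ q hf (monotone_restrictVec_iff.2 hd.2) ?_
    rintro rfl
    exact h (extendVec_restrictVec_of_coeff hd.1).symm

open scoped Classical in
theorem inner_slater_modelVec {γ : ℝ} (hγ : 0 < γ) (q : ℕ) (b : ℕ → ℕ) {N : ℕ} {f : Fin N → ℕ}
    (hf : Monotone f) {T : Finset (ℕ →₀ ℕ)} (hT : T ⊆ sortedSupport q b N) :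
    inner ℂ (slater γ q f) (modelVec γ q b N T) =
      if extendVec f ∈ T then amplitude γ q b N (extendVec f) else 0 := by
  rw [modelVec, inner_sum]
  have h : ∀ d ∈ T, inner ℂ (slater γ q f) (amplitude γ q b N d • slater γ q (restrictVec N d)) =
      if d = extendVec f then amplitude γ q b N d else 0 := fun d hd => by
    rw [inner_smul_right, inner_slater hγ q b hf (hT hd), mul_ite, mul_one, mul_zero]
  rw [Finset.sum_congr rfl h, Finset.sum_ite_eq']

theorem inner_modelVec {γ : ℝ} (hγ : 0 < γ) (q : ℕ) (b : ℕ → ℕ) {N : ℕ} {S T : Finset (ℕ →₀ ℕ)}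
    (hS : S ⊆ sortedSupport q b N) (hT : T ⊆ sortedSupport q b N) :
    inner ℂ (modelVec γ q b N S) (modelVec γ q b N T) =
      ((∑ d ∈ S ∩ T, weight q γ b N d : ℝ) : ℂ) := by
  classical
  rw [modelVec, sum_inner, ← Finset.filter_mem_eq_inter, Finset.sum_filter, Complex.ofReal_sum]
  refine Finset.sum_congr rfl fun d hd => ?_
  have hd' := mem_sortedSupport.1 (hS hd)
  rw [inner_smul_left, inner_slater_modelVec hγ q b (monotone_restrictVec_iff.2 hd'.2) hT,
    extendVec_restrictVec_of_coeff hd'.1]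
  split_ifs
  · rw [Complex.conj_mul', ← norm_amplitude_sq, Complex.ofReal_pow]
  · simp

theorem norm_modelVec_sq {γ : ℝ} (hγ : 0 < γ) (q : ℕ) (b : ℕ → ℕ) {N : ℕ} {T : Finset (ℕ →₀ ℕ)}
    (hT : T ⊆ sortedSupport q b N) :
    ‖modelVec γ q b N T‖ ^ 2 = ∑ d ∈ T, weight q γ b N d := by
  rw [norm_sq_eq_re_inner (𝕜 := ℂ), inner_modelVec hγ q b hT hT, Finset.inter_self]
  exact Complex.ofReal_re _

theorem prod_sub_pow_eq {R : Type*} [CommRing R] (q N : ℕ) (x : Fin N → R) :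
    ∏ j : Fin N, ∏ k ∈ Ioi j, (x j - x k) ^ q =
      (-1) ^ (q * (N * (N - 1) / 2)) * (∏ j : Fin N, ∏ k ∈ Ioi j, (x k - x j)) ^ q := by
  have h : ∀ j : Fin N, ∏ k ∈ Ioi j, (x j - x k) =
      (-1) ^ (N - 1 - (j : ℕ)) * ∏ k ∈ Ioi j, (x k - x j) := fun j => by
    rw [← Fin.card_Ioi, ← Finset.prod_const, ← Finset.prod_mul_distrib]
    exact Finset.prod_congr rfl fun k _ => by ring
  simp only [Finset.prod_pow, h, Finset.prod_mul_distrib, Finset.prod_pow_eq_pow_sum]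
  rw [mul_pow, ← pow_mul, mul_comm q]
  congr 3
  rw [← Finset.sum_range fun j => N - 1 - j, Finset.sum_range_reflect fun j => j,
    Finset.sum_range_id]

theorem monomialSym_eq_eval (γ : ℝ) (b : ℕ → ℕ) {N : ℕ} (z : Fin N → ℂ) :
    monomialSym (fun j : Fin N => b j) (fun j => Complex.exp (γ * z j)) =
      (msym b 0 N).eval (evalPoint γ z) := by
  have h := congrArg (eval (evalPoint γ z)) (stabF_smul_msym b N)
  have h0 : (stabF (fun j : Fin N => b j) : ℂ) ≠ 0 := by exact_mod_cast (stabF_pos _).ne'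
  simp only [map_mul, map_natCast, map_sum, map_prod, map_pow, eval_X, evalPoint_val,
    nsmul_eq_mul] at h
  rw [monomialSym, occFactorial_eq_stabF, one_div, inv_mul_eq_iff_eq_mul₀ h0, h,
    ← Equiv.sum_comp (Equiv.inv (Equiv.Perm (Fin N)))]
  refine Finset.sum_congr rfl fun σ _ => ?_
  rw [← Equiv.prod_comp σ]
  simp

/-- The model wavefunction is a positive multiple of the expansion with the amplitudes. -/
theorem exists_psi_eq_smul_modelVec {γ : ℝ} (hγ : 0 < γ) (q : ℕ) (b : ℕ → ℕ) (N : ℕ) :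
    ∃ K : ℝ, 0 < K ∧ psi γ q (fun j : Fin N => b j) =
      (K : ℂ) • modelVec γ q b N (sortedSupport q b N) := by
  set β : Fin N → ℕ := fun j => b j with hβ
  set K₀ : ℝ := 1 / (Real.sqrt (N ! : ℝ) * Real.sqrt (2 * Real.pi ^ (3 / 2 : ℝ) / γ) ^ N *
    Real.exp (γ ^ 2 / 2 * ∑ j : Fin N, ((rootPartition q β j : ℕ) : ℝ) ^ 2)) with hK₀
  have hN : (0 : ℝ) < N ! := by exact_mod_cast Nat.factorial_pos N
  have hK₀pos : 0 < K₀ := by positivity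
  have hκ : kappa γ q β = (-1) ^ (q * (N * (N - 1) / 2)) * K₀ := by
    have hsign : ((-1 : ℝ) ^ (q * (N * (N - 1) / 2)))⁻¹ = (-1) ^ (q * (N * (N - 1) / 2)) := by
      rw [← inv_pow]
      norm_num
    rw [kappa, hK₀, mul_assoc, mul_assoc, one_div, mul_inv, hsign, one_div, mul_assoc]
  have hpsi : psi γ q β = (K₀ : ℂ) • expVec γ N (segPoly q b 0 N) := by
    rw [← map_smul]
    refine toLp_eq_expVec (isExpPoly_psiFun γ q β) _ fun z => ?_
    rw [psiFun, hκ, prod_sub_pow_eq, monomialSym_eq_eval, smul_eval, segPoly, map_mul, vand_zero_eq]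
    simp only [map_pow, map_prod, map_sub, eval_X, evalPoint_val]
    have hs : ((-1 : ℂ) ^ (q * (N * (N - 1) / 2))) * (-1) ^ (q * (N * (N - 1) / 2)) = 1 := by
      rw [← mul_pow]
      norm_num
    push_cast
    linear_combination (K₀ * (msym b 0 N).eval (evalPoint γ z) * (∏ j : Fin N, ∏ k ∈ Ioi j,
      (Complex.exp (γ * z k) - Complex.exp (γ * z j))) ^ q) * hs
  have ho := orbConst_pos hγ
  refine ⟨K₀ * Real.sqrt N ! / orbConst γ ^ N, by positivity, ?_⟩
  rw [hpsi, expVec_segPoly, modelVec, Finset.smul_sum, Finset.smul_sum]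
  refine Finset.sum_congr rfl fun d _ => ?_
  rw [slater_eq_smul_symVec, smul_smul, smul_smul, smul_smul]
  congr 1
  have hM : (0 : ℝ) < stabCard N d := by exact_mod_cast stabCard_pos N d
  have hreal : (1 : ℝ) / stabCard N d = Real.sqrt N ! / orbConst γ ^ N *
      (Real.exp (γ ^ 2 / 2 * ∑ c ∈ range N, (d c : ℝ) ^ 2) / Real.sqrt (stabCard N d)) *
        slaterConst γ (restrictVec N d) := by
    have h1 : ∏ j : Fin N, (orbConst γ * Real.exp (-γ ^ 2 * (restrictVec N d j : ℝ) ^ 2 / 2)) =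
        orbConst γ ^ N * (Real.exp (γ ^ 2 / 2 * ∑ c ∈ range N, (d c : ℝ) ^ 2))⁻¹ := by
      rw [Finset.prod_mul_distrib, Finset.prod_const, Finset.card_univ, Fintype.card_fin,
        ← Real.exp_sum, ← Real.exp_neg, Finset.sum_range, Finset.mul_sum, ← Finset.sum_neg_distrib]
      congr 2
      refine Finset.sum_congr rfl fun j _ => ?_
      rw [restrictVec]
      ring
    rw [slaterConst, h1, ← stabCard_eq, Real.sqrt_mul hM.le]
    have h2 := Real.sq_sqrt hM.le
    have h3 := Real.sqrt_pos.2 hM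
    have h4 := Real.sqrt_pos.2 hN
    field_simp
    rw [h2]
  have hcomp := congrArg (fun x : ℝ => (x : ℂ)) hreal
  simp only [amplitude]
  push_cast at hcomp ⊢
  linear_combination (K₀ * (segPoly q b 0 N).coeff d) * hcomp

/-! ### Composition of sequences -/

/-- The sequence `b₁` up to index `n`, followed by the sequence `b₂` raised by `v`. -/
def composeSeq (n v : ℕ) (b₁ b₂ : ℕ → ℕ) (c : ℕ) : ℕ := if c < n then b₁ c else v + b₂ (c - n)

theorem composeSeq_of_lt {n v : ℕ} {b₁ b₂ : ℕ → ℕ} {c : ℕ} (hc : c < n) :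
    composeSeq n v b₁ b₂ c = b₁ c := if_pos hc

theorem composeSeq_add (n v : ℕ) (b₁ b₂ : ℕ → ℕ) (c : ℕ) :
    composeSeq n v b₁ b₂ (n + c) = v + b₂ c := by
  rw [composeSeq, if_neg (by omega), Nat.add_sub_cancel_left]

theorem monotone_composeSeq {n v : ℕ} {b₁ b₂ : ℕ → ℕ} (hb₁ : Monotone b₁) (hb₂ : Monotone b₂)
    (hv : ∀ c < n, b₁ c ≤ v) : Monotone (composeSeq n v b₁ b₂) := by
  intro a c hac
  simp only [composeSeq]
  split_ifs with h1 h2 h2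
  · exact hb₁ hac
  · exact (hv a h1).trans (Nat.le_add_right _ _)
  · omega
  · exact Nat.add_le_add_left (hb₂ (Nat.sub_le_sub_right hac n)) v

/-- The exponent vector with the constant entries `t` on `[n, n + m)`. -/
def constVec (n m t : ℕ) : ℕ →₀ ℕ :=
  Finsupp.onFinset (Ico n (n + m)) (fun c => if n ≤ c ∧ c < n + m then t else 0) fun c hc => by
    rw [Finset.mem_Ico]
    by_contra h
    exact hc (if_neg h)

/-- The exponent vector `e`, moved to the right by `n` places and raised by `t`. -/
def shiftVec (n m t : ℕ) (e : ℕ →₀ ℕ) : ℕ →₀ ℕ := e.mapDomain (n + ·) + constVec n m t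

theorem shiftVec_apply {n m t : ℕ} {e : ℕ →₀ ℕ} (he : ∀ c, m ≤ c → e c = 0) (c : ℕ) :
    shiftVec n m t e c = if n ≤ c ∧ c < n + m then t + e (c - n) else 0 := by
  have h : constVec n m t c = if n ≤ c ∧ c < n + m then t else 0 := rfl
  rw [shiftVec, Finsupp.add_apply, h]
  by_cases hc : n ≤ c
  · obtain ⟨k, rfl⟩ := Nat.exists_eq_add_of_le hc
    rw [Finsupp.mapDomain_apply (f := (n + ·)) (add_right_injective n), Nat.add_sub_cancel_left]
    split_ifs with h
    · exact add_comm _ _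
    · rw [he k (by omega)]
  · rw [Finsupp.mapDomain_of_notMem_range, if_neg (by omega), if_neg (by omega)]
    rintro ⟨k, hk⟩
    simp only at hk
    omega

/-- The inverse of `shiftVec`. -/
def unshiftVec (n m t : ℕ) (d : ℕ →₀ ℕ) : ℕ →₀ ℕ :=
  Finsupp.onFinset (range m) (fun c => if c < m then d (n + c) - t else 0) fun c hc => by
    rw [Finset.mem_range]
    by_contra h
    exact hc (if_neg h)

theorem unshiftVec_apply (n m t : ℕ) (d : ℕ →₀ ℕ) (c : ℕ) :
    unshiftVec n m t d c = if c < m then d (n + c) - t else 0 := rfl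

theorem unshiftVec_shiftVec {n m t : ℕ} {e : ℕ →₀ ℕ} (he : ∀ c, m ≤ c → e c = 0) :
    unshiftVec n m t (shiftVec n m t e) = e := by
  ext c
  rw [unshiftVec_apply, shiftVec_apply he]
  split_ifs with h1 h2
  · rw [Nat.add_sub_cancel_left, Nat.add_sub_cancel_left]
  · omega
  · exact (he c (by omega)).symm

theorem shiftVec_unshiftVec {n m t : ℕ} {d : ℕ →₀ ℕ} (hd : ∀ c, ¬ (n ≤ c ∧ c < n + m) → d c = 0)
    (ht : ∀ c, n ≤ c → c < n + m → t ≤ d c) : shiftVec n m t (unshiftVec n m t d) = d := by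
  ext c
  rw [shiftVec_apply fun c hc => by rw [unshiftVec_apply, if_neg (by omega)]]
  split_ifs with h1
  · rw [unshiftVec_apply, if_pos (by omega), Nat.add_sub_cancel' h1.1,
      Nat.add_sub_cancel' (ht c h1.1 h1.2)]
  · exact (hd c h1).symm

theorem monomial_shiftVec (n m t : ℕ) (e : ℕ →₀ ℕ) :
    (monomial (shiftVec n m t e) 1 : MvPolynomial ℕ ℂ) =
      rename (n + ·) (monomial e 1) * monomial (constVec n m t) 1 := by
  rw [rename_monomial, monomial_mul, one_mul, shiftVec]

theorem map_Ico_shift (n m : ℕ) (f : ℕ → ℕ) :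
    (Ico n (n + m)).val.map f = (Ico 0 m).val.map fun c => f (n + c) := by
  have h : Ico n (n + m) = (Ico 0 m).map (addLeftEmbedding n) := by
    rw [Finset.map_add_left_Ico, add_zero]
  rw [h, Finset.map_val, Multiset.map_map]
  rfl

theorem msym_composeSeq (n m v : ℕ) (b₁ b₂ : ℕ → ℕ) :
    msym (composeSeq n v b₁ b₂) n (n + m) =
      rename (n + ·) (msym b₂ 0 m) * monomial (constVec n m v) 1 := by
  have hmap : ∀ e : ℕ →₀ ℕ, (∀ c, m ≤ c → e c = 0) →
      ((Ico n (n + m)).val.map (shiftVec n m v e) =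
        (Ico n (n + m)).val.map (composeSeq n v b₁ b₂) ↔ (Ico 0 m).val.map e = (Ico 0 m).val.map b₂) := by
    intro e he
    have h1 : (Ico n (n + m)).val.map (shiftVec n m v e) =
        ((Ico 0 m).val.map e).map (v + ·) := by
      rw [map_Ico_shift, Multiset.map_map]
      refine Multiset.map_congr rfl fun c hc => ?_
      have hc := Finset.mem_Ico.1 (Finset.mem_def.2 hc)
      rw [shiftVec_apply he, if_pos (by omega), Nat.add_sub_cancel_left]
      rfl
    have h2 : (Ico n (n + m)).val.map (composeSeq n v b₁ b₂) =
        ((Ico 0 m).val.map b₂).map (v + ·) := by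
      rw [map_Ico_shift, Multiset.map_map]
      exact Multiset.map_congr rfl fun c _ => composeSeq_add n v b₁ b₂ c
    rw [h1, h2]
    exact (Multiset.map_injective (add_right_injective v)).eq_iff
  have hsupp : ∀ e ∈ rearr b₂ 0 m, ∀ c, m ≤ c → e c = 0 := fun e he c hc =>
    support_subset_of_mem_rearr he (by omega)
  rw [msym, msym, map_sum, Finset.sum_mul]
  refine Finset.sum_bij' (fun d _ => unshiftVec n m v d) (fun e _ => shiftVec n m v e) ?_ ?_ ?_ ?_ ?_
  all_goals
    have hback : ∀ d ∈ rearr (composeSeq n v b₁ b₂) n (n + m),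
        shiftVec n m v (unshiftVec n m v d) = d := by
      intro d hd
      refine shiftVec_unshiftVec (fun c hc => support_subset_of_mem_rearr hd hc) fun c h1 h2 => ?_
      have h3 : d c ∈ (Ico n (n + m)).val.map d :=
        Multiset.mem_map_of_mem d (Finset.mem_def.1 (Finset.mem_Ico.2 ⟨h1, h2⟩))
      rw [(mem_rearr.1 hd).2, map_Ico_shift] at h3
      obtain ⟨k, _, hk⟩ := Multiset.mem_map.1 h3
      rw [← hk, composeSeq_add]
      exact Nat.le_add_right _ _
  · intro d hd
    have hu : ∀ c, m ≤ c → unshiftVec n m v d c = 0 := fun c hc => by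
      rw [unshiftVec_apply, if_neg (by omega)]
    refine mem_rearr.2 ⟨fun c hc => ?_, (hmap _ hu).1 ?_⟩
    · by_contra h
      exact Finsupp.mem_support_iff.1 hc (hu c (by simpa using h))
    · rw [hback d hd]
      exact (mem_rearr.1 hd).2
  · intro e he
    refine mem_rearr.2 ⟨fun c hc => ?_, (hmap e (hsupp e he)).2 (mem_rearr.1 he).2⟩
    by_contra h
    rw [Finset.mem_Ico] at h
    exact Finsupp.mem_support_iff.1 hc (by rw [shiftVec_apply (hsupp e he), if_neg h])
  · exact hback
  · exact fun e he => unshiftVec_shiftVec (hsupp e he)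
  · intro d hd
    rw [← monomial_shiftVec, hback d hd]

theorem constVec_add (n m s t : ℕ) : constVec n m (s + t) = constVec n m s + constVec n m t := by
  ext c
  simp only [constVec, Finsupp.onFinset_apply, Finsupp.add_apply]
  split_ifs <;> rfl

theorem prod_X_pow_eq (n m t : ℕ) :
    ∏ c ∈ range m, (X (n + c) : MvPolynomial ℕ ℂ) ^ t = monomial (constVec n m t) 1 := by
  rw [monomial_eq, C_1, one_mul, Finsupp.prod_of_support_subset _ (s := Ico n (n + m)) _ _ (by simp),
    Finset.prod_Ico_eq_prod_range, Nat.add_sub_cancel_left]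
  · refine Finset.prod_congr rfl fun c hc => ?_
    have := Finset.mem_range.1 hc
    rw [constVec, Finsupp.onFinset_apply, if_pos (by omega)]
  · exact Finsupp.support_onFinset_subset

theorem vand_shift (q n m : ℕ) :
    vand q n (n + m) = rename (n + ·) (vand q 0 m) * monomial (constVec n m (q * n)) 1 := by
  rw [← prod_X_pow_eq, vand, vand, Finset.prod_Ico_eq_prod_range, Nat.add_sub_cancel_left,
    ← Finset.range_eq_Ico, map_prod, ← Finset.prod_mul_distrib]
  refine Finset.prod_congr rfl fun c _ => ?_
  rw [Finset.prod_Ico_eq_prod_range, Nat.add_sub_cancel_left, ← Finset.range_eq_Ico]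
  simp only [map_pow, map_prod, map_sub, rename_X, mul_zero, pow_zero, one_mul]
  exact mul_comm _ _

theorem segPoly_composeSeq (q n m v : ℕ) (b₁ b₂ : ℕ → ℕ) :
    segPoly q (composeSeq n v b₁ b₂) n (n + m) =
      rename (n + ·) (segPoly q b₂ 0 m) * monomial (constVec n m (q * n + v)) 1 := by
  rw [segPoly, segPoly, msym_composeSeq, vand_shift, map_mul, mul_mul_mul_comm, monomial_mul,
    one_mul, constVec_add, add_comm (constVec n m v)]

theorem coeff_shiftVec (q n m v : ℕ) (b₁ b₂ : ℕ → ℕ) (e : ℕ →₀ ℕ) :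
    (segPoly q (composeSeq n v b₁ b₂) n (n + m)).coeff (shiftVec n m (q * n + v) e) =
      (segPoly q b₂ 0 m).coeff e := by
  rw [segPoly_composeSeq, shiftVec, coeff_mul_monomial, mul_one,
    coeff_rename_mapDomain _ (add_right_injective n)]

theorem segPoly_congr (q : ℕ) {b b' : ℕ → ℕ} {i j : ℕ} (h : ∀ c, i ≤ c → c < j → b c = b' c) :
    segPoly q b i j = segPoly q b' i j := by
  have h1 : (Ico i j).val.map b = (Ico i j).val.map b' := Multiset.map_congr rfl fun c hc => by
    have hc := Finset.mem_Ico.1 (Finset.mem_def.2 hc)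
    exact h c hc.1 hc.2
  have h2 : rearr b i j = rearr b' i j := by
    ext d
    rw [mem_rearr, mem_rearr, h1]
  rw [segPoly, segPoly, msym, msym, h2]

/-- The exponent vector `d`, followed by the shift of `e`. -/
def combineVec (n m t : ℕ) (p : (ℕ →₀ ℕ) × (ℕ →₀ ℕ)) : ℕ →₀ ℕ := p.1 + shiftVec n m t p.2

section compose

variable {q n m v : ℕ} {b₁ b₂ : ℕ → ℕ} {d e : ℕ →₀ ℕ}

theorem combineVec_apply (hd : ∀ c, n ≤ c → d c = 0) (he : ∀ c, m ≤ c → e c = 0) (t c : ℕ) :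
    combineVec n m t (d, e) c =
      if c < n then d c else if c < n + m then t + e (c - n) else 0 := by
  rw [combineVec, Finsupp.add_apply, shiftVec_apply he]
  change d c + _ = _
  split_ifs with h1 h2 h3 <;> first | omega | skip
  · rw [hd c (by omega), zero_add]
  · rw [hd c (by omega)]

theorem le_root_of_mem_sortedSupport {b : ℕ → ℕ} {N : ℕ} (hb : Monotone b)
    (hd : d ∈ sortedSupport q b N) {c : ℕ} (hc : c < N) : d c ≤ root q b (N - 1) :=
  IsCut.le_root hb hd (lowDeg_eq_sum_root hb (Nat.zero_le N) (mem_sortedSupport.1 hd).1) le_rfl hc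

theorem apply_eq_zero_of_mem_sortedSupport {b : ℕ → ℕ} {N : ℕ}
    (hd : d ∈ sortedSupport q b N) (c : ℕ) (hc : N ≤ c) : d c = 0 :=
  segPoly_apply_eq_zero (mem_sortedSupport.1 hd).1 (by omega)

/-- Entries of the two parts of a composed vector are separated. -/
theorem lt_shift_of_mem (hq : 0 < q) (hb₁ : Monotone b₁) (hv : ∀ c < n, b₁ c ≤ v)
    (hd : d ∈ sortedSupport q b₁ n) {c : ℕ} (hc : c < n) : d c < q * n + v := by
  have h1 := le_root_of_mem_sortedSupport hb₁ hd hc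
  have h2 := hv (n - 1) (by omega)
  have h3 : q * (n - 1) < q * n := Nat.mul_lt_mul_of_pos_left (by omega) hq
  rw [root] at h1
  omega

theorem isCut_combineVec (hb₁ : Monotone b₁) (hd : d ∈ sortedSupport q b₁ n)
    (he : e ∈ sortedSupport q b₂ m) :
    IsCut q (composeSeq n v b₁ b₂) n (combineVec n m (q * n + v) (d, e)) := by
  have h := lowDeg_eq_sum_root hb₁ (Nat.zero_le n) (mem_sortedSupport.1 hd).1
  have h1 : lowDeg n (combineVec n m (q * n + v) (d, e)) = lowDeg n d :=
    Finset.sum_congr rfl fun c hc => by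
      rw [combineVec_apply (apply_eq_zero_of_mem_sortedSupport hd)
        (apply_eq_zero_of_mem_sortedSupport he), if_pos (Finset.mem_range.1 hc)]
  rw [IsCut, h1, h]
  refine Finset.sum_congr rfl fun c hc => ?_
  rw [root, root, composeSeq_of_lt (Finset.mem_Ico.1 hc).2]

theorem filter_combineVec (hd : ∀ c, n ≤ c → d c = 0) (he : ∀ c, m ≤ c → e c = 0) (t : ℕ) :
    (combineVec n m t (d, e)).filter (· < n) = d ∧
      (combineVec n m t (d, e)).filter (fun c => ¬ c < n) = shiftVec n m t e := by
  constructor <;> ext c <;> rw [Finsupp.filter_apply, combineVec_apply hd he]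
  · split_ifs with h
    · rfl
    · exact (hd c (by omega)).symm
  · rw [shiftVec_apply he]
    split_ifs <;> first | rfl | omega

theorem coeff_combineVec (hb₁ : Monotone b₁) (hb₂ : Monotone b₂) (hv : ∀ c < n, b₁ c ≤ v)
    (hd : d ∈ sortedSupport q b₁ n) (he : e ∈ sortedSupport q b₂ m) :
    (segPoly q (composeSeq n v b₁ b₂) 0 (n + m)).coeff (combineVec n m (q * n + v) (d, e)) =
      (segPoly q b₁ 0 n).coeff d * (segPoly q b₂ 0 m).coeff e := by
  obtain ⟨h1, h2⟩ := filter_combineVec (apply_eq_zero_of_mem_sortedSupport hd)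
    (apply_eq_zero_of_mem_sortedSupport he) (q * n + v)
  rw [coeff_segPoly_eq_mul q (monotone_composeSeq hb₁ hb₂ hv) (Nat.zero_le n)
    (Nat.le_add_right n m) (isCut_combineVec hb₁ hd he), h1, h2, coeff_shiftVec,
    segPoly_congr q fun c _ hc => composeSeq_of_lt hc]

/-- The entries of a composed vector are those of its first part, followed by the shifted entries
of its second part. -/
theorem restrictVec_combineVec (hd : ∀ c, n ≤ c → d c = 0) (he : ∀ c, m ≤ c → e c = 0) (t : ℕ) :
    restrictVec (n + m) (combineVec n m t (d, e)) =
      Fin.append (restrictVec n d) (fun j => t + restrictVec m e j) := by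
  ext j
  refine Fin.addCases (fun i => ?_) (fun i => ?_) j
  · rw [Fin.append_left, restrictVec, combineVec_apply hd he, Fin.val_castAdd, if_pos i.2]
    rfl
  · rw [Fin.append_right, restrictVec, combineVec_apply hd he, Fin.val_natAdd, if_neg (by omega),
      if_pos (by omega), Nat.add_sub_cancel_left]
    rfl

theorem occFactorial_append {f : Fin n → ℕ} {g : Fin m → ℕ} (hfg : ∀ i j, f i ≠ g j) :
    occFactorial (Fin.append f g) = occFactorial f * occFactorial g := by
  classical
  have hcount : ∀ k, #{j | Fin.append f g j = k} = #{j | f j = k} + #{j | g j = k} := fun k => by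
    simp only [Finset.card_filter, Fin.sum_univ_add, Fin.append_left, Fin.append_right]
  have himage : univ.image (Fin.append f g) = univ.image f ∪ univ.image g := by
    ext k
    simp only [Finset.mem_image, Finset.mem_univ, true_and, Finset.mem_union]
    constructor
    · rintro ⟨j, rfl⟩
      refine Fin.addCases (fun i => ?_) (fun i => ?_) j
      · exact Or.inl ⟨i, (Fin.append_left f g i).symm⟩
      · exact Or.inr ⟨i, (Fin.append_right f g i).symm⟩
    · rintro (⟨j, rfl⟩ | ⟨j, rfl⟩)
      · exact ⟨_, Fin.append_left f g j⟩
      · exact ⟨_, Fin.append_right f g j⟩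
  have hdisj : Disjoint (univ.image f) (univ.image g) := by
    rw [Finset.disjoint_left]
    intro k hk hk'
    obtain ⟨i, _, rfl⟩ := Finset.mem_image.1 hk
    obtain ⟨j, _, hj⟩ := Finset.mem_image.1 hk'
    exact hfg i j hj.symm
  rw [occFactorial, himage, Finset.prod_union hdisj]
  congr 1
  · refine Finset.prod_congr rfl fun k hk => ?_
    obtain ⟨i, _, rfl⟩ := Finset.mem_image.1 hk
    have : #{j | g j = f i} = 0 :=
      Finset.card_eq_zero.2 (Finset.filter_eq_empty_iff.2 fun j _ h => hfg i j h.symm)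
    rw [hcount, this, add_zero]
  · refine Finset.prod_congr rfl fun k hk => ?_
    obtain ⟨i, _, rfl⟩ := Finset.mem_image.1 hk
    have : #{j | f j = g i} = 0 :=
      Finset.card_eq_zero.2 (Finset.filter_eq_empty_iff.2 fun j _ h => hfg j i h)
    rw [hcount, this, zero_add]

theorem occFactorial_const_add (t : ℕ) (g : Fin m → ℕ) :
    occFactorial (fun j => t + g j) = occFactorial g := by
  rw [occFactorial_eq_stabF, occFactorial_eq_stabF, stabF, stabF]
  congr 1
  refine Finset.filter_congr fun σ _ => ?_
  simp [funext_iff]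

theorem stabCard_combineVec (hq : 0 < q) (hb₁ : Monotone b₁) (hv : ∀ c < n, b₁ c ≤ v)
    (hd : d ∈ sortedSupport q b₁ n) (he : e ∈ sortedSupport q b₂ m) :
    stabCard (n + m) (combineVec n m (q * n + v) (d, e)) = stabCard n d * stabCard m e := by
  rw [stabCard_eq, stabCard_eq, stabCard_eq, restrictVec_combineVec
    (apply_eq_zero_of_mem_sortedSupport hd) (apply_eq_zero_of_mem_sortedSupport he),
    ← occFactorial_eq_stabF, occFactorial_append, occFactorial_const_add, occFactorial_eq_stabF,
    occFactorial_eq_stabF]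
  intro i j
  have h : restrictVec n d i < q * n + v := lt_shift_of_mem hq hb₁ hv hd i.2
  omega

/-- The amplitude of a composed vector is, up to a positive factor that does not depend on the
vector, the product of the amplitudes. -/
theorem exists_amplitude_combineVec (γ : ℝ) (hq : 0 < q) (hb₁ : Monotone b₁) (hb₂ : Monotone b₂)
    (hv : ∀ c < n, b₁ c ≤ v) (m : ℕ) : ∃ κ : ℝ, 0 < κ ∧ ∀ d ∈ sortedSupport q b₁ n,
      ∀ e ∈ sortedSupport q b₂ m, amplitude γ q (composeSeq n v b₁ b₂) (n + m)
        (combineVec n m (q * n + v) (d, e)) =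
          κ * (amplitude γ q b₁ n d * amplitude γ q b₂ m e) := by
  set t := q * n + v with ht
  refine ⟨Real.exp (γ ^ 2 / 2 * (m * (t : ℝ) ^ 2 + 2 * t * ∑ c ∈ Ico 0 m, (root q b₂ c : ℝ))),
    Real.exp_pos _, fun d hd e he => ?_⟩
  have hdeg : (∑ c ∈ range m, (e c : ℝ)) = ∑ c ∈ Ico 0 m, (root q b₂ c : ℝ) := by
    exact_mod_cast lowDeg_eq_sum_root hb₂ (Nat.zero_le m) (mem_sortedSupport.1 he).1
  have hsq : ∑ c ∈ range (n + m), (combineVec n m t (d, e) c : ℝ) ^ 2 =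
      ∑ c ∈ range n, (d c : ℝ) ^ 2 + (∑ c ∈ range m, (e c : ℝ) ^ 2 +
        (m * (t : ℝ) ^ 2 + 2 * t * ∑ c ∈ Ico 0 m, (root q b₂ c : ℝ))) := by
    have happ := combineVec_apply (apply_eq_zero_of_mem_sortedSupport hd)
      (apply_eq_zero_of_mem_sortedSupport he) t
    rw [Finset.sum_range_add, ← hdeg, Finset.mul_sum]
    congr 1
    · exact Finset.sum_congr rfl fun c hc => by rw [happ, if_pos (Finset.mem_range.1 hc)]
    · have hm : (m : ℝ) * (t : ℝ) ^ 2 = ∑ c ∈ range m, (t : ℝ) ^ 2 := by simp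
      rw [hm, ← Finset.sum_add_distrib, ← Finset.sum_add_distrib]
      refine Finset.sum_congr rfl fun c hc => ?_
      have := Finset.mem_range.1 hc
      rw [happ, if_neg (by omega), if_pos (by omega), Nat.add_sub_cancel_left]
      push_cast
      ring
  rw [amplitude, amplitude, amplitude, coeff_combineVec hb₁ hb₂ hv hd he,
    stabCard_combineVec hq hb₁ hv hd he, hsq, mul_add, mul_add (γ ^ 2 / 2), Real.exp_add,
    Real.exp_add, Nat.cast_mul, Real.sqrt_mul (by positivity)]
  push_cast
  ring

theorem combineVec_injOn : Set.InjOn (combineVec n m (q * n + v))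
    (sortedSupport q b₁ n ×ˢ sortedSupport q b₂ m : Finset ((ℕ →₀ ℕ) × (ℕ →₀ ℕ))) := by
  rintro ⟨d, e⟩ hp ⟨d', e'⟩ hp' h
  rw [Finset.mem_coe, Finset.mem_product] at hp hp'
  have hd : ∀ c, n ≤ c → d c = 0 := apply_eq_zero_of_mem_sortedSupport hp.1
  have he : ∀ c, m ≤ c → e c = 0 := apply_eq_zero_of_mem_sortedSupport hp.2
  have hd' : ∀ c, n ≤ c → d' c = 0 := apply_eq_zero_of_mem_sortedSupport hp'.1
  have he' : ∀ c, m ≤ c → e' c = 0 := apply_eq_zero_of_mem_sortedSupport hp'.2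
  obtain ⟨h1, h2⟩ := filter_combineVec hd he (q * n + v)
  obtain ⟨h3, h4⟩ := filter_combineVec hd' he' (q * n + v)
  rw [h] at h1 h2
  refine Prod.ext (h1.symm.trans h3) ?_
  change e = e'
  rw [← unshiftVec_shiftVec (n := n) (t := q * n + v) he,
    ← unshiftVec_shiftVec (n := n) (t := q * n + v) he', ← h2, h4]

open scoped Classical in
/-- The sorted exponent vectors that are cut at `n` are the compositions of sorted exponent vectors
of the two parts. -/
theorem image_combineVec (hq : 0 < q) (hb₁ : Monotone b₁) (hb₂ : Monotone b₂)
    (hv : ∀ c < n, b₁ c ≤ v) (m : ℕ) :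
    (sortedSupport q b₁ n ×ˢ sortedSupport q b₂ m).image (combineVec n m (q * n + v)) =
      (sortedSupport q (composeSeq n v b₁ b₂) (n + m)).filter
        (IsCut q (composeSeq n v b₁ b₂) n) := by
  have hb := monotone_composeSeq hb₁ hb₂ hv
  ext d
  rw [Finset.mem_image, Finset.mem_filter]
  constructor
  · rintro ⟨⟨d, e⟩, hp, rfl⟩
    obtain ⟨hd, he⟩ : d ∈ sortedSupport q b₁ n ∧ e ∈ sortedSupport q b₂ m :=
      Finset.mem_product.1 hp
    refine ⟨mem_sortedSupport.2 ⟨?_, fun k hk => ?_⟩, isCut_combineVec hb₁ hd he⟩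
    · rw [coeff_combineVec hb₁ hb₂ hv hd he]
      exact mul_ne_zero (mem_sortedSupport.1 hd).1 (mem_sortedSupport.1 he).1
    · have happ := combineVec_apply (apply_eq_zero_of_mem_sortedSupport hd)
        (apply_eq_zero_of_mem_sortedSupport he) (q * n + v)
      rw [happ, happ]
      split_ifs with h1 h2 h3 <;> first | omega | skip
      · exact (mem_sortedSupport.1 hd).2 k h2
      · have h3 : d k < q * n + v := lt_shift_of_mem hq hb₁ hv hd h1
        omega
      · have h3 := (mem_sortedSupport.1 he).2 (k - n) (by omega)
        rw [show k - n + 1 = k + 1 - n by omega] at h3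
        omega
  · rintro ⟨hd, hcut⟩
    have hd' := mem_sortedSupport.1 hd
    have hcoeff := coeff_segPoly_eq_mul q hb (Nat.zero_le n) (Nat.le_add_right n m) hcut
    have hshift : shiftVec n m (q * n + v) (unshiftVec n m (q * n + v)
        (d.filter fun c => ¬ c < n)) = d.filter fun c => ¬ c < n := by
      refine shiftVec_unshiftVec (fun c hc => ?_) fun c h1 h2 => ?_
      · rw [Finsupp.filter_apply]
        split_ifs with h
        · rfl
        · exact segPoly_apply_eq_zero hd'.1 (by omega)
      · rw [Finsupp.filter_apply, if_pos (by omega)]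
        have h3 := hcut.root_le hb hd h1 h2
        have h4 : composeSeq n v b₁ b₂ n = v + b₂ 0 := composeSeq_add n v b₁ b₂ 0
        rw [root, h4] at h3
        omega
    rw [← hshift, coeff_shiftVec, segPoly_congr q (b' := b₁) fun c _ hc => composeSeq_of_lt hc]
      at hcoeff
    rw [hcoeff] at hd'
    refine ⟨(d.filter (· < n), unshiftVec n m (q * n + v) (d.filter fun c => ¬ c < n)),
      Finset.mem_product.2 ⟨mem_sortedSupport.2 ⟨left_ne_zero_of_mul hd'.1, fun k hk => ?_⟩,
        mem_sortedSupport.2 ⟨right_ne_zero_of_mul hd'.1, fun k hk => ?_⟩⟩, ?_⟩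
    · rw [Finsupp.filter_apply, Finsupp.filter_apply, if_pos (by omega), if_pos hk]
      exact hd'.2 k (by omega)
    · rw [unshiftVec_apply, unshiftVec_apply, if_pos (by omega), if_pos hk, Finsupp.filter_apply,
        Finsupp.filter_apply, if_pos (by omega), if_pos (by omega)]
      exact Nat.sub_le_sub_right (hd'.2 (n + k) (by omega)) _
    · rw [combineVec, hshift]
      exact Finsupp.filter_add_filter_not d _

end compose

/-! ### The product of occupation basis vectors -/

/-- The permutation of `Fin (n + m)` that acts as `τ₁` on the first `n` points and as `τ₂` on the
last `m` points. -/
def joinPerm {n m : ℕ} (τ₁ : Equiv.Perm (Fin n)) (τ₂ : Equiv.Perm (Fin m)) :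
    Equiv.Perm (Fin (n + m)) := finSumFinEquiv.permCongr (Equiv.Perm.sumCongr τ₁ τ₂)

theorem sign_joinPerm {n m : ℕ} (τ₁ : Equiv.Perm (Fin n)) (τ₂ : Equiv.Perm (Fin m)) :
    Equiv.Perm.sign (joinPerm τ₁ τ₂) = Equiv.Perm.sign τ₁ * Equiv.Perm.sign τ₂ := by
  rw [joinPerm, Equiv.Perm.sign_permCongr, Equiv.Perm.sign_sumCongr]

theorem joinPerm_castAdd {n m : ℕ} (τ₁ : Equiv.Perm (Fin n)) (τ₂ : Equiv.Perm (Fin m)) (i : Fin n) :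
    joinPerm τ₁ τ₂ (Fin.castAdd m i) = Fin.castAdd m (τ₁ i) := by
  simp [joinPerm, Equiv.permCongr_apply]

theorem joinPerm_natAdd {n m : ℕ} (τ₁ : Equiv.Perm (Fin n)) (τ₂ : Equiv.Perm (Fin m)) (i : Fin m) :
    joinPerm τ₁ τ₂ (Fin.natAdd n i) = Fin.natAdd n (τ₂ i) := by
  simp [joinPerm, Equiv.permCongr_apply]

/-- The product of two occupation basis vectors with separated entries is an occupation basis
vector. -/
theorem qProdFun_slaterFun (γ : ℝ) (q : ℕ) {n m : ℕ} {f : Fin n → ℕ} {g : Fin m → ℕ}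
    (hfg : ∀ i j, f i ≠ g j) (z : Fin (n + m) → ℂ) :
    qProdFun q (slaterFun γ q f) (slaterFun γ q g) z = slaterFun γ q (Fin.append f g) z := by
  set S := ∑ σ : Equiv.Perm (Fin (n + m)), ((Equiv.Perm.sign σ : ℤ) : ℂ) ^ q *
    ∏ j, orbital γ (Fin.append f g j) (z (σ j)) with hS
  set c₁ : ℝ := 1 / Real.sqrt (occFactorial f * n ! : ℝ) with hc₁
  set c₂ : ℝ := 1 / Real.sqrt (occFactorial g * m ! : ℝ) with hc₂
  have hsum : ∑ σ : Equiv.Perm (Fin (n + m)), ((Equiv.Perm.sign σ : ℤ) : ℂ) ^ q *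
      (slaterFun γ q f (fun i => z (σ (Fin.castAdd m i))) *
        slaterFun γ q g (fun i => z (σ (Fin.natAdd n i)))) = c₁ * c₂ * (n ! * m !) * S := by
    have hterm : ∀ σ : Equiv.Perm (Fin (n + m)), ((Equiv.Perm.sign σ : ℤ) : ℂ) ^ q *
        (slaterFun γ q f (fun i => z (σ (Fin.castAdd m i))) *
          slaterFun γ q g (fun i => z (σ (Fin.natAdd n i)))) =
        ∑ τ₁ : Equiv.Perm (Fin n), ∑ τ₂ : Equiv.Perm (Fin m), c₁ * c₂ *
          (((Equiv.Perm.sign (σ * joinPerm τ₁ τ₂) : ℤ) : ℂ) ^ q *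
            ∏ j, orbital γ (Fin.append f g j) (z ((σ * joinPerm τ₁ τ₂) j))) := by
      intro σ
      rw [slaterFun, slaterFun, ← hc₁, ← hc₂, mul_mul_mul_comm, Finset.sum_mul_sum, mul_left_comm,
        Finset.mul_sum, Finset.mul_sum]
      refine Finset.sum_congr rfl fun τ₁ _ => ?_
      rw [Finset.mul_sum, Finset.mul_sum]
      refine Finset.sum_congr rfl fun τ₂ _ => ?_
      rw [Fin.prod_univ_add, Equiv.Perm.sign_mul, sign_joinPerm]
      simp only [Equiv.Perm.mul_apply, joinPerm_castAdd, joinPerm_natAdd, Fin.append_left,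
        Fin.append_right, Units.val_mul, Int.cast_mul, mul_pow]
      ring
    rw [Finset.sum_congr rfl fun σ _ => hterm σ, Finset.sum_comm]
    have hinner : ∀ τ₁ : Equiv.Perm (Fin n), ∑ σ : Equiv.Perm (Fin (n + m)),
        ∑ τ₂ : Equiv.Perm (Fin m), c₁ * c₂ *
          (((Equiv.Perm.sign (σ * joinPerm τ₁ τ₂) : ℤ) : ℂ) ^ q *
            ∏ j, orbital γ (Fin.append f g j) (z ((σ * joinPerm τ₁ τ₂) j))) =
        m ! * (c₁ * c₂ * S) := by
      intro τ₁
      rw [Finset.sum_comm]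
      have : ∀ τ₂ : Equiv.Perm (Fin m), ∑ σ : Equiv.Perm (Fin (n + m)), c₁ * c₂ *
          (((Equiv.Perm.sign (σ * joinPerm τ₁ τ₂) : ℤ) : ℂ) ^ q *
            ∏ j, orbital γ (Fin.append f g j) (z ((σ * joinPerm τ₁ τ₂) j))) = c₁ * c₂ * S := by
        intro τ₂
        rw [← Finset.mul_sum, hS]
        congr 1
        exact Equiv.sum_comp (Equiv.mulRight (joinPerm τ₁ τ₂)) fun σ : Equiv.Perm (Fin (n + m)) =>
          ((Equiv.Perm.sign σ : ℤ) : ℂ) ^ q * ∏ j, orbital γ (Fin.append f g j) (z (σ j))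
      rw [Finset.sum_congr rfl fun τ₂ _ => this τ₂, Finset.sum_const, Finset.card_univ,
        Fintype.card_perm, Fintype.card_fin, nsmul_eq_mul]
    rw [Finset.sum_congr rfl fun τ₁ _ => hinner τ₁, Finset.sum_const, Finset.card_univ,
      Fintype.card_perm, Fintype.card_fin, nsmul_eq_mul]
    ring
  rw [qProdFun, hsum, slaterFun, ← hS, occFactorial_append hfg, ← mul_assoc]
  congr 1
  have hn : (0 : ℝ) < n ! := by exact_mod_cast Nat.factorial_pos n
  have hm : (0 : ℝ) < m ! := by exact_mod_cast Nat.factorial_pos m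
  have hN : (0 : ℝ) < (n + m)! := by exact_mod_cast Nat.factorial_pos (n + m)
  have hf : (0 : ℝ) < occFactorial f := by
    rw [occFactorial_eq_stabF]
    exact_mod_cast stabF_pos f
  have hg : (0 : ℝ) < occFactorial g := by
    rw [occFactorial_eq_stabF]
    exact_mod_cast stabF_pos g
  have hreal : 1 / Real.sqrt ((n + m)! * n ! * m ! : ℝ) * (c₁ * c₂ * (n ! * m !)) =
      1 / Real.sqrt ((occFactorial f * occFactorial g : ℕ) * (n + m)! : ℝ) := by
    rw [hc₁, hc₂, Nat.cast_mul, Real.sqrt_mul (by positivity), Real.sqrt_mul hN.le,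
      Real.sqrt_mul hf.le, Real.sqrt_mul hg.le, Real.sqrt_mul (by positivity), Real.sqrt_mul hf.le]
    have h1 := Real.mul_self_sqrt hn.le
    have h2 := Real.mul_self_sqrt hm.le
    have h3 := Real.sqrt_pos.2 hn
    have h4 := Real.sqrt_pos.2 hm
    have h5 := Real.sqrt_pos.2 hN
    have h6 := Real.sqrt_pos.2 hf
    have h7 := Real.sqrt_pos.2 hg
    set s₁ := Real.sqrt n !
    set s₂ := Real.sqrt m !
    rw [← h1, ← h2]
    field_simp
  rw [← hreal]
  push_cast
  rfl

theorem odotBasis_eq_slater (γ : ℝ) (q : ℕ) {n m : ℕ} [NeZero n] (b : Fin n → ℕ) {f : Fin n → ℕ}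
    {g : Fin m → ℕ} (hfg : ∀ i j, f i ≠ shift q b g j) :
    odotBasis γ q b f g = slater γ q (Fin.append f (shift q b g)) :=
  MemLp.toLp_congr _ _ (.of_forall fun z => qProdFun_slaterFun γ q hfg z)

theorem restrictVec_injOn (q : ℕ) (b : ℕ → ℕ) (N : ℕ) :
    Set.InjOn (restrictVec N) (sortedSupport q b N : Set (ℕ →₀ ℕ)) := by
  intro d hd d' hd' h
  rw [← extendVec_restrictVec_of_coeff (mem_sortedSupport.1 hd).1, h,
    extendVec_restrictVec_of_coeff (mem_sortedSupport.1 hd').1]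

theorem inner_slater_eq_zero {γ : ℝ} (hγ : 0 < γ) (q : ℕ) (b : ℕ → ℕ) {N : ℕ} {f : Fin N → ℕ}
    (hf : Monotone f) (h : f ∉ (sortedSupport q b N).image (restrictVec N)) :
    inner ℂ (slater γ q f) (modelVec γ q b N (sortedSupport q b N)) = 0 := by
  rw [inner_slater_modelVec hγ q b hf subset_rfl, if_neg]
  intro h'
  exact h (Finset.mem_image.2 ⟨_, h', restrictVec_extendVec f⟩)

open scoped Classical in
/-- The product of the expansions of the two model wavefunctions is, up to a positive factor, the
part of the expansion of the composed model wavefunction that is cut at `n`. -/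
theorem exists_odot_modelVec {γ : ℝ} (hγ : 0 < γ) {q : ℕ} (hq : 0 < q) {n m : ℕ} [NeZero n]
    (b : Fin n → ℕ) {b₁ b₂ : ℕ → ℕ} (hb₁ : Monotone b₁) (hb₂ : Monotone b₂)
    (hv : ∀ c < n, b₁ c ≤ lastEntry b) :
    ∃ κ : ℝ, 0 < κ ∧
      (∀ s₁ s₂ : ℂ, odot γ q b (s₁ • modelVec γ q b₁ n (sortedSupport q b₁ n))
        (s₂ • modelVec γ q b₂ m (sortedSupport q b₂ m)) = (s₁ * s₂ * (κ : ℂ)⁻¹) •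
          modelVec γ q (composeSeq n (lastEntry b) b₁ b₂) (n + m)
            {d ∈ sortedSupport q (composeSeq n (lastEntry b) b₁ b₂) (n + m) |
              IsCut q (composeSeq n (lastEntry b) b₁ b₂) n d}) ∧
      ‖modelVec γ q (composeSeq n (lastEntry b) b₁ b₂) (n + m)
        {d ∈ sortedSupport q (composeSeq n (lastEntry b) b₁ b₂) (n + m) |
          IsCut q (composeSeq n (lastEntry b) b₁ b₂) n d}‖ =
        κ * (‖modelVec γ q b₁ n (sortedSupport q b₁ n)‖ *
          ‖modelVec γ q b₂ m (sortedSupport q b₂ m)‖) := by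
  obtain ⟨κ, hκ, hamp⟩ := exists_amplitude_combineVec γ hq hb₁ hb₂ hv m
  have himage := image_combineVec hq hb₁ hb₂ hv m
  set v := lastEntry b with hvdef
  set B := composeSeq n v b₁ b₂ with hB
  set S₁ := sortedSupport q b₁ n with hS₁
  set S₂ := sortedSupport q b₂ m with hS₂
  have hinj : Set.InjOn (combineVec n m (q * n + v)) (S₁ ×ˢ S₂ : Finset ((ℕ →₀ ℕ) × (ℕ →₀ ℕ))) :=
    combineVec_injOn
  have hκ0 : (κ : ℂ) ≠ 0 := by exact_mod_cast hκ.ne'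
  refine ⟨κ, hκ, fun s₁ s₂ => ?_, ?_⟩
  · set F : (Fin n → ℕ) → (Fin m → ℕ) → NSpace γ (n + m) := fun f g =>
      (inner ℂ (slater γ q f) (s₁ • modelVec γ q b₁ n S₁) *
        inner ℂ (slater γ q g) (s₂ • modelVec γ q b₂ m S₂)) • odotBasis γ q b f g with hF
    have hsum : odot γ q b (s₁ • modelVec γ q b₁ n S₁) (s₂ • modelVec γ q b₂ m S₂) =
        ∑ d ∈ S₁, ∑ e ∈ S₂, F (restrictVec n d) (restrictVec m e) := by
      have h1 : odot γ q b (s₁ • modelVec γ q b₁ n S₁) (s₂ • modelVec γ q b₂ m S₂) =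
          ∑ p ∈ (S₁.image (restrictVec n)).subtype Monotone ×ˢ
            (S₂.image (restrictVec m)).subtype Monotone, F p.1.1 p.2.1 := by
        refine tsum_eq_sum fun p hp => ?_
        rw [Finset.mem_product, not_and_or, Finset.mem_subtype, Finset.mem_subtype] at hp
        rcases hp with hp | hp
        · rw [inner_smul_right, inner_slater_eq_zero hγ q b₁ p.1.2 hp, mul_zero, zero_mul, zero_smul]
        · rw [inner_smul_right _ (modelVec γ q b₂ m S₂), inner_slater_eq_zero hγ q b₂ p.2.2 hp,
            mul_zero, mul_zero, zero_smul]
      have hmono : ∀ (b' : ℕ → ℕ) (N : ℕ), ∀ f ∈ (sortedSupport q b' N).image (restrictVec N),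
          Monotone f := by
        intro b' N f hf
        obtain ⟨d, hd, rfl⟩ := Finset.mem_image.1 hf
        exact monotone_restrictVec_iff.2 (mem_sortedSupport.1 hd).2
      rw [h1, Finset.sum_product, Finset.sum_subtype_of_mem (fun f => ∑ g ∈
        (S₂.image (restrictVec m)).subtype Monotone, F f g.1) (hmono b₁ n),
        Finset.sum_image (restrictVec_injOn q b₁ n)]
      refine Finset.sum_congr rfl fun d _ => ?_
      rw [Finset.sum_subtype_of_mem (fun g => F (restrictVec n d) g) (hmono b₂ m),
        Finset.sum_image (restrictVec_injOn q b₂ m)]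
    rw [hsum, ← Finset.sum_product', modelVec, ← himage, Finset.sum_image hinj, Finset.smul_sum]
    refine Finset.sum_congr rfl fun p hp => ?_
    obtain ⟨d, e⟩ := p
    obtain ⟨hd, he⟩ : d ∈ S₁ ∧ e ∈ S₂ := Finset.mem_product.1 hp
    have hdm := mem_sortedSupport.1 hd
    have hem := mem_sortedSupport.1 he
    have hsep : ∀ i j, restrictVec n d i ≠ shift q b (restrictVec m e) j := by
      intro i j
      have h : restrictVec n d i < q * n + v := lt_shift_of_mem hq hb₁ hv hd i.2
      rw [shift]
      omega
    simp only [hF]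
    rw [inner_smul_right, inner_smul_right,
      inner_slater_modelVec hγ q b₁ (monotone_restrictVec_iff.2 hdm.2) subset_rfl,
      inner_slater_modelVec hγ q b₂ (monotone_restrictVec_iff.2 hem.2) subset_rfl,
      extendVec_restrictVec_of_coeff hdm.1, extendVec_restrictVec_of_coeff hem.1, if_pos hd,
      if_pos he, odotBasis_eq_slater γ q b hsep, hamp d hd e he, smul_smul,
      restrictVec_combineVec (apply_eq_zero_of_mem_sortedSupport hd)
        (apply_eq_zero_of_mem_sortedSupport he)]
    have hc : s₁ * s₂ * (κ : ℂ)⁻¹ * (κ * (amplitude γ q b₁ n d * amplitude γ q b₂ m e)) =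
        s₁ * amplitude γ q b₁ n d * (s₂ * amplitude γ q b₂ m e) := by
      field_simp
    rw [hc]
    rfl
  · rw [← sq_eq_sq₀ (norm_nonneg _) (by positivity), mul_pow, mul_pow,
      norm_modelVec_sq hγ q _ (Finset.filter_subset _ _), norm_modelVec_sq hγ q _ subset_rfl,
      norm_modelVec_sq hγ q _ subset_rfl, ← himage, Finset.sum_image hinj, Finset.sum_mul_sum,
      ← Finset.sum_product', Finset.mul_sum]
    refine Finset.sum_congr rfl fun p hp => ?_
    obtain ⟨d, e⟩ := p
    obtain ⟨hd, he⟩ : d ∈ S₁ ∧ e ∈ S₂ := Finset.mem_product.1 hp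
    rw [← norm_amplitude_sq, hamp d hd e he, norm_mul, norm_mul, Complex.norm_real,
      Real.norm_of_nonneg hκ.le, mul_pow, mul_pow, norm_amplitude_sq, norm_amplitude_sq]

/-! ### The main estimate -/

theorem rootVec_mem_sortedSupport {q : ℕ} (hq : 0 < q) {b : ℕ → ℕ} (hb : Monotone b) (N : ℕ) :
    rootVec q b 0 N ∈ sortedSupport q b N := by
  refine mem_sortedSupport.2 ⟨?_, fun k hk => ?_⟩
  · rw [coeff_rootVec q hb (Nat.zero_le N)]
    exact one_ne_zero
  · rw [rootVec_apply, rootVec_apply, if_pos (by omega), if_pos (by omega)]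
    exact (root_strictMono hq hb).monotone (Nat.le_succ k)

theorem weight_pos_of_mem (γ : ℝ) {q : ℕ} {b : ℕ → ℕ} {N : ℕ} {d : ℕ →₀ ℕ}
    (hd : d ∈ sortedSupport q b N) : 0 < weight q γ b N d := by
  have h1 := norm_pos_iff.2 (mem_sortedSupport.1 hd).1
  have h2 : (0 : ℝ) < stabCard N d := by exact_mod_cast stabCard_pos N d
  unfold weight
  positivity

theorem modelVec_ne_zero {γ : ℝ} (hγ : 0 < γ) {q : ℕ} {b : ℕ → ℕ} {N : ℕ} {T : Finset (ℕ →₀ ℕ)}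
    (hT : T ⊆ sortedSupport q b N) (hne : T.Nonempty) : modelVec γ q b N T ≠ 0 := by
  intro h
  have h1 := norm_modelVec_sq hγ q b hT
  rw [h, norm_zero] at h1
  have h2 := Finset.sum_pos (fun d hd => weight_pos_of_mem γ (hT hd)) hne
  rw [← h1] at h2
  norm_num at h2

/-- The distance between the normalizations of `x + y` and of `x`, for orthogonal `x` and `y`. -/
theorem norm_inv_smul_sub_sq_le {E : Type*} [NormedAddCommGroup E] [InnerProductSpace ℂ E] {x y : E}
    (hx : x ≠ 0) (hxy : inner ℂ x y = 0) :
    ‖(‖x + y‖ : ℂ)⁻¹ • (x + y) - (‖x‖ : ℂ)⁻¹ • x‖ ^ 2 ≤ 2 * (‖y‖ ^ 2 / ‖x + y‖ ^ 2) := by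
  have hpy : ‖x + y‖ ^ 2 = ‖x‖ ^ 2 + ‖y‖ ^ 2 := by
    rw [@norm_add_sq ℂ, hxy]
    simp
  have ha : 0 < ‖x‖ := norm_pos_iff.2 hx
  have hac : ‖x‖ ≤ ‖x + y‖ := by
    refine le_of_sq_le_sq ?_ (norm_nonneg _)
    nlinarith [sq_nonneg ‖y‖]
  have hc : 0 < ‖x + y‖ := ha.trans_le hac
  have hinner : inner ℂ (x + y) x = ((‖x‖ ^ 2 : ℝ) : ℂ) := by
    rw [inner_add_left, inner_eq_zero_symm.1 hxy, add_zero, inner_self_eq_norm_sq_to_K]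
    push_cast
    rfl
  have h1 : ∀ w : E, w ≠ 0 → ‖(‖w‖ : ℂ)⁻¹ • w‖ = 1 := fun w hw => by
    rw [norm_smul, norm_inv, Complex.norm_real, norm_norm, inv_mul_cancel₀ (norm_ne_zero_iff.2 hw)]
  rw [@norm_sub_sq ℂ, h1 x hx, h1 _ (norm_pos_iff.1 hc), inner_smul_left, inner_smul_right, hinner,
    map_inv₀, Complex.conj_ofReal, ← Complex.ofReal_inv, ← Complex.ofReal_inv, ← Complex.ofReal_mul,
    ← Complex.ofReal_mul]
  have hre : ∀ r : ℝ, RCLike.re (r : ℂ) = r := fun r => Complex.ofReal_re r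
  rw [hre]
  set a := ‖x‖
  set c := ‖x + y‖
  have hy : ‖y‖ ^ 2 = c ^ 2 - a ^ 2 := by linarith
  have hr : a ^ 2 / c ^ 2 ≤ a / c := by
    rw [← div_pow, sq]
    exact mul_le_of_le_one_left (by positivity) ((div_le_one hc).2 hac)
  have e1 : c⁻¹ * (a⁻¹ * a ^ 2) = a / c := by
    field_simp
  have e2 : (c ^ 2 - a ^ 2) / c ^ 2 = 1 - a ^ 2 / c ^ 2 := by
    field_simp
  rw [e1, hy, e2]
  linarith

/-- The rate in the main estimate leaves room for the factor `16 * exp q ^ 2`: the difference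
`γ ^ 2 * q - decayRate q γ * q` is at least `10 * q - 2 * log 2`, which exceeds
`4 * log 2 + 2 * q`. -/
theorem exp_le_of_decayRate {q : ℕ} (hq : 0 < q) (γ : ℝ) :
    Real.exp (-(γ ^ 2 * q)) ≤ Real.exp (-(decayRate q γ * q)) / (16 * Real.exp q ^ 2) := by
  have hq1 : (1 : ℝ) ≤ q := by exact_mod_cast hq
  have h16 : (16 : ℝ) = Real.exp (4 * Real.log 2) := by
    rw [mul_comm, Real.exp_mul, Real.exp_log two_pos]
    norm_num
  have hlog : -Real.log 2 ≤ Real.log (1 - Real.exp (-(4 * q + 1))) := by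
    rw [← Real.log_inv]
    refine Real.log_le_log (by norm_num) ?_
    have h1 : Real.exp (-(4 * q + 1)) ≤ Real.exp (-Real.log 2) :=
      Real.exp_le_exp.2 (by linarith [Real.log_two_lt_d9])
    rw [Real.exp_neg (Real.log 2), Real.exp_log two_pos] at h1
    linarith
  have hpi : 0 ≤ Real.pi * Real.sqrt (2 / 3) * q := by positivity
  have hC : decayRate q γ * q = γ ^ 2 * q - 2 * (4 * q + 1) * q -
      2 * Real.log (1 - Real.exp (-(4 * q + 1))) - Real.pi * Real.sqrt (2 / 3) * q := by
    rw [decayRate]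
    field_simp
  rw [h16, ← Real.exp_nat_mul, ← Real.exp_add, ← Real.exp_sub]
  refine Real.exp_le_exp.2 ?_
  rw [hC]
  push_cast
  nlinarith [Real.log_two_lt_d9]

/-- The extension of a finite sequence to all natural numbers by its last entry. -/
def extendSeq {N : ℕ} [NeZero N] (b : Fin N → ℕ) (c : ℕ) : ℕ :=
  b ⟨min c (N - 1), by have := NeZero.pos N; omega⟩

theorem extendSeq_val {N : ℕ} [NeZero N] (b : Fin N → ℕ) (j : Fin N) : extendSeq b j = b j := by
  rw [extendSeq]
  congr 1
  ext
  simp only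
  omega

theorem monotone_extendSeq {N : ℕ} [NeZero N] {b : Fin N → ℕ} (hb : Monotone b) :
    Monotone (extendSeq b) := fun _ _ h => hb (Fin.mk_le_mk.2 (by omega))

theorem compose_eq_composeSeq {N₁ N₂ : ℕ} [NeZero N₁] [NeZero N₂] (b₁ : Fin N₁ → ℕ)
    (b₂ : Fin N₂ → ℕ) : compose b₁ b₂ = fun j : Fin (N₁ + N₂) =>
      composeSeq N₁ (lastEntry b₁) (extendSeq b₁) (extendSeq b₂) j := by
  ext j
  refine Fin.addCases (fun i => ?_) (fun i => ?_) j
  · rw [compose, Fin.append_left, Fin.val_castAdd, composeSeq_of_lt i.2, extendSeq_val]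
  · rw [compose, Fin.append_right, Fin.val_natAdd, composeSeq_add, extendSeq_val]

theorem normalized_smul {γ : ℝ} {N : ℕ} {K : ℝ} (hK : 0 < K) (f : NSpace γ N) :
    normalized ((K : ℂ) • f) = normalized f := by
  have hK0 : (K : ℂ) ≠ 0 := by exact_mod_cast hK.ne'
  rw [normalized, normalized, norm_smul, Complex.norm_real, Real.norm_of_nonneg hK.le, smul_smul]
  congr 1
  push_cast
  rw [mul_inv]
  field_simp

theorem modelVec_sortedSupport_ne_zero {γ : ℝ} (hγ : 0 < γ) {q : ℕ} (hq : 0 < q) {b : ℕ → ℕ}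
    (hb : Monotone b) (N : ℕ) : modelVec γ q b N (sortedSupport q b N) ≠ 0 :=
  modelVec_ne_zero hγ subset_rfl ⟨_, rootVec_mem_sortedSupport hq hb N⟩

/-- The distance between the normalizations of `x + y` and of `x`, for orthogonal `x` and `y` such
that `y` carries at most the fraction `r² / (1 - r²)²` of the total weight. -/
theorem norm_inv_smul_sub_le {E : Type*} [NormedAddCommGroup E] [InnerProductSpace ℂ E] {x y : E}
    {r : ℝ} (hr : 0 ≤ r) (hr1 : r ^ 2 < 1) (hx : x ≠ 0) (hxy : inner ℂ x y = 0)
    (hy : ‖y‖ ^ 2 ≤ r ^ 2 / (1 - r ^ 2) ^ 2 * ‖x + y‖ ^ 2) :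
    ‖(‖x + y‖ : ℂ)⁻¹ • (x + y) - (‖x‖ : ℂ)⁻¹ • x‖ ≤ 2 * r / (1 - r ^ 2) := by
  have h1 : 0 < 1 - r ^ 2 := by linarith
  refine le_of_sq_le_sq ?_ (by positivity)
  refine (norm_inv_smul_sub_sq_le hx hxy).trans ?_
  have h2 : ‖y‖ ^ 2 / ‖x + y‖ ^ 2 ≤ r ^ 2 / (1 - r ^ 2) ^ 2 :=
    div_le_of_le_mul₀ (by positivity) (by positivity) hy
  have h3 : (2 * r / (1 - r ^ 2)) ^ 2 = 4 * (r ^ 2 / (1 - r ^ 2) ^ 2) := by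
    rw [div_pow, mul_pow]
    ring
  have h4 : 0 ≤ r ^ 2 / (1 - r ^ 2) ^ 2 := by positivity
  rw [h3]
  linarith

/-- The estimate for the expansions of the wavefunctions in the occupation basis. The product of
the parts is proportional to the portion of `Ψ_b` that is supported on the configurations with a
cut after the first `n` particles. -/
theorem norm_normalized_modelVec_sub_odot_le {γ : ℝ} (hγ : 0 < γ) {q : ℕ} (hq : 0 < q)
    (hC : 0 < decayRate q γ) {n m : ℕ} [NeZero n] [NeZero m] (b : Fin n → ℕ) {b₁ b₂ : ℕ → ℕ}
    (hb₁ : Monotone b₁) (hb₂ : Monotone b₂) (hv : ∀ c < n, b₁ c ≤ lastEntry b) :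
    ‖normalized (modelVec γ q (composeSeq n (lastEntry b) b₁ b₂) (n + m)
          (sortedSupport q (composeSeq n (lastEntry b) b₁ b₂) (n + m))) -
        odot γ q b (normalized (modelVec γ q b₁ n (sortedSupport q b₁ n)))
          (normalized (modelVec γ q b₂ m (sortedSupport q b₂ m)))‖ ≤
      2 * Real.exp (-(decayRate q γ * q / 2)) / (1 - Real.exp (-(decayRate q γ * q))) := by
  classical
  obtain ⟨κ, hκ, hodot, hnorm⟩ := exists_odot_modelVec hγ hq (m := m) b hb₁ hb₂ hv
  have hm : Monotone (composeSeq n (lastEntry b) b₁ b₂) := monotone_composeSeq hb₁ hb₂ hv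
  have hn₁ := norm_pos_iff.2 (modelVec_sortedSupport_ne_zero hγ hq hb₁ n)
  have hn₂ := norm_pos_iff.2 (modelVec_sortedSupport_ne_zero hγ hq hb₂ m)
  rw [normalized, normalized, normalized, hodot]
  have hsq : Real.exp (-(decayRate q γ * q / 2)) ^ 2 = Real.exp (-(decayRate q γ * q)) := by
    rw [← Real.exp_nat_mul]
    congr 1
    push_cast
    ring
  have hq0 : (0 : ℝ) < q := by exact_mod_cast hq
  have ht1 : Real.exp (-(decayRate q γ * q)) < 1 :=
    Real.exp_lt_one_iff.2 (by have := mul_pos hC hq0; linarith)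
  have hweight := sum_weight_not_isCut_le hq (Real.exp_pos _) ht1 (exp_le_of_decayRate hq γ) hm
    (Nat.lt_add_of_pos_right (n := n) (NeZero.pos m))
  rw [← norm_modelVec_sq hγ q _ (Finset.filter_subset _ _), ← norm_modelVec_sq hγ q _ subset_rfl]
    at hweight
  generalize composeSeq n (lastEntry b) b₁ b₂ = B at *
  have hsum : modelVec γ q B (n + m) {d ∈ sortedSupport q B (n + m) | IsCut q B n d} +
      modelVec γ q B (n + m) {d ∈ sortedSupport q B (n + m) | ¬ IsCut q B n d} =
      modelVec γ q B (n + m) (sortedSupport q B (n + m)) :=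
    Finset.sum_filter_add_sum_filter_not _ _ _
  have horth : inner ℂ (modelVec γ q B (n + m) {d ∈ sortedSupport q B (n + m) | IsCut q B n d})
      (modelVec γ q B (n + m) {d ∈ sortedSupport q B (n + m) | ¬ IsCut q B n d}) = 0 := by
    rw [inner_modelVec hγ q B (Finset.filter_subset _ _) (Finset.filter_subset _ _),
      Finset.disjoint_iff_inter_eq_empty.1 (Finset.disjoint_filter_filter_not _ _ _),
      Finset.sum_empty, Complex.ofReal_zero]
  generalize modelVec γ q B (n + m) {d ∈ sortedSupport q B (n + m) | ¬ IsCut q B n d} = y at *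
  generalize modelVec γ q B (n + m) {d ∈ sortedSupport q B (n + m) | IsCut q B n d} = x at *
  generalize modelVec γ q b₁ n (sortedSupport q b₁ n) = x₁ at *
  generalize modelVec γ q b₂ m (sortedSupport q b₂ m) = x₂ at *
  have hx : x ≠ 0 := norm_pos_iff.1 (hnorm ▸ by positivity)
  have hscal : (‖x₁‖ : ℂ)⁻¹ * (‖x₂‖ : ℂ)⁻¹ * (κ : ℂ)⁻¹ = (‖x‖ : ℂ)⁻¹ := by
    rw [hnorm]
    push_cast
    rw [mul_inv, mul_inv]
    ring
  rw [← hsq] at ht1 hweight ⊢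
  rw [← hsum] at hweight ⊢
  rw [hscal]
  exact norm_inv_smul_sub_le (Real.exp_pos _).le ht1 hx horth hweight

end

end FQHE

theorem mainTheorem8 (q : ℕ) (hq : 0 < q) (γ : ℝ) (hγ : 0 < γ)
    (hC : 0 < FQHE.decayRate q γ)
    (N₁ N₂ : ℕ) [NeZero N₁] [NeZero N₂]
    (b₁ : Fin N₁ → ℕ) (hb₁ : Monotone b₁) (b₂ : Fin N₂ → ℕ) (hb₂ : Monotone b₂) :
    FQHE.psi γ q (FQHE.compose b₁ b₂) ≠ 0 ∧ FQHE.psi γ q b₁ ≠ 0 ∧ FQHE.psi γ q b₂ ≠ 0 ∧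
    ‖FQHE.normalized (FQHE.psi γ q (FQHE.compose b₁ b₂)) -
        FQHE.odot γ q b₁ (FQHE.normalized (FQHE.psi γ q b₁))
          (FQHE.normalized (FQHE.psi γ q b₂))‖ ≤
      2 * Real.exp (-(FQHE.decayRate q γ * q / 2)) /
        (1 - Real.exp (-(FQHE.decayRate q γ * q))) := by
  obtain ⟨K, hK, hpsi⟩ := FQHE.exists_psi_eq_smul_modelVec hγ q (FQHE.composeSeq N₁
    (FQHE.lastEntry b₁) (FQHE.extendSeq b₁) (FQHE.extendSeq b₂)) (N₁ + N₂)
  obtain ⟨K₁, hK₁, hpsi₁⟩ := FQHE.exists_psi_eq_smul_modelVec hγ q (FQHE.extendSeq b₁) N₁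
  obtain ⟨K₂, hK₂, hpsi₂⟩ := FQHE.exists_psi_eq_smul_modelVec hγ q (FQHE.extendSeq b₂) N₂
  rw [← FQHE.compose_eq_composeSeq] at hpsi
  rw [show (fun j : Fin N₁ => FQHE.extendSeq b₁ j) = b₁ from funext (FQHE.extendSeq_val b₁)]
    at hpsi₁
  rw [show (fun j : Fin N₂ => FQHE.extendSeq b₂ j) = b₂ from funext (FQHE.extendSeq_val b₂)]
    at hpsi₂
  have hm₁ := FQHE.monotone_extendSeq hb₁
  have hm₂ := FQHE.monotone_extendSeq hb₂
  have hv : ∀ c < N₁, FQHE.extendSeq b₁ c ≤ FQHE.lastEntry b₁ := fun c _ => hb₁ le_top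
  have hm := FQHE.monotone_composeSeq hm₁ hm₂ hv
  rw [hpsi, hpsi₁, hpsi₂, FQHE.normalized_smul hK, FQHE.normalized_smul hK₁,
    FQHE.normalized_smul hK₂]
  exact ⟨smul_ne_zero (by exact_mod_cast hK.ne') (FQHE.modelVec_sortedSupport_ne_zero hγ hq hm _),
    smul_ne_zero (by exact_mod_cast hK₁.ne') (FQHE.modelVec_sortedSupport_ne_zero hγ hq hm₁ _),
    smul_ne_zero (by exact_mod_cast hK₂.ne') (FQHE.modelVec_sortedSupport_ne_zero hγ hq hm₂ _),
    FQHE.norm_normalized_modelVec_sub_odot_le hγ hq hC b₁ hm₁ hm₂ hv⟩
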